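/- **Setting (heavy-tailed linear bandits).** There are $K\ge 2$ arms with feature vectors $\phi_a\in\mathbb R^d$, $d\ge 1$, that affinely span $\mathbb R^d$. In each round $t=1,\dots,T$ ($T\ge1$) the environment chooses, depending on the past and on its own randomization, a vector $\theta_t$ and a distribution of the loss vector $\ell_t\in\mathbb R^K$ with conditional mean $\mathbb E[\ell_{t,a}]=\langle\phi_a,\theta_t\rangle$ and $\mathbb E|\ell_{t,a}|^{\varepsilon}\le\sigma$ for all $a$, where $\varepsilon\in(1,2]$ and $\sigma>0$ are known; the learner draws $a_t\sim p_t$ and sees $\ell_{t,a_t}$. The regret is $\mathrm{Reg}_T=\max_a\mathbb E[\sum_{t\le T}(\ell_{t,a_t}-\ell_{t,a})]$. The environment satisfies a $(\Delta,C,T)$ self-bounding constraint if every algorithm has $\mathrm{Reg}_T\ge\mathbb E[\sum_{t\le T}\Delta_{a_t}]-C$. **Algorithm.** Fix $\alpha\in[1/2,1)$ with $1-\alpha=\Theta(1/\log K)$, i.e. $c_1\le(1-\alpha)\log K\le c_2$ for constants $0<c_1\le c_2$, and put $\bar\alpha=(\varepsilon-1)(1-\alpha)$. For $p$ in the simplex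 let $\mu(p)=\sum_a p_a\phi_a$, $V(p)=\sum_a p_a(\phi_a-\mu(p))(\phi_a-\mu(p))^\top$, and let $p_0\in\arg\max_p\log\det V(p)$. Let $\psi(q)=-\frac1\alpha\sum_a(q_a^\alpha-q_a)$ and $\bar\psi(q)=-\frac1{\bar\alpha}\sum_a(q_a^{\bar\alpha}-q_a)$. In round $t$, $q_t$ minimizes $\langle\sum_{s<t}(\hat\ell_s-b_s),q\rangle+\beta_t\psi(q)+\bar\beta\bar\psi(q)$ over the simplex; with $q_{t*}=\min\{\|q_t\|_\infty,1-\|q_t\|_\infty\}$ put $\gamma_t=256(1-\alpha)^{-2}\sigma^{2/\varepsilon}d\beta_t^{-2}q_{t*}^{2(1-\alpha)}$, $s_t=(1-\alpha)\beta_tq_{t*}^{\alpha-1}/8$, $p_t=(1-\gamma_t)q_t+\gamma_tp_0$ and, with $\bar\phi_a=\phi_a-\mu(p_t)$ and $V_t=V(p_t)$, $\tilde\ell_{t,a}=\bar\phi_a^\top V_t^{-1}\bar\phi_{a_t}\ell_{t,a_t}$, $\hat\ell_{t,a}=\tilde\ell_{t,a}\mathbf 1\{|\tilde\ell_{t,a}|\le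 s_t\}$, $b_{t,a}=\sigma\sum_bp_{t,b}|\bar\phi_a^\top V_t^{-1}\bar\phi_b|^\varepsilon s_t^{1-\varepsilon}$. Finally $h_t=-\psi(q_t)$, $z_t=(1-\alpha)^{1-\varepsilon}\sigma q_{t*}^{(\varepsilon-1)(1-\alpha)}d^{\varepsilon/2}(1-\|p_t\|_\infty)^{2-\varepsilon}$, $w_t=\sigma^{3/\varepsilon}(1-\alpha)^{-2}d\,q_{t*}^{2(1-\alpha)}$, and $\beta_{t+1}=\beta_t+\frac1{h_t}(\beta_t^{1-\varepsilon}z_t+\beta_t^{-2}w_t)$. The inputs are $\beta_1>0$ so large that $\gamma_t\le\frac12$ in every round, and $\bar\beta\ge64(1-\alpha)^{-3}d^\varepsilon\beta_1^{1-\varepsilon}\max\{\sigma^{3/\varepsilon},\sigma\}$. Let $z_{\max},w_{\max}$ be the suprema of $z_t,w_t$ over $t\le T$ and all histories, $\bar h=-\bar\psi(q_1)$, and $\kappa=z_{\max}\beta_1^{1-\varepsilon}+w_{\max}\beta_1^{-2}+\beta_1h_1+\bar\beta\bar h$. **Claim.** (i) With $\lesssim$ and $O$ hiding a constant that depends only on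 $c_1,c_2$: $h_1z_{\max}\lesssim\sigma(\log K)^{\varepsilon-1}d^{\varepsilon/2}$, $h_1w_{\max}\lesssim\sigma^{3/\varepsilon}d\log^2K$, $h_1^{1-1/\varepsilon}z_{\max}^{1/\varepsilon}\lesssim(\log K)^{1-1/\varepsilon}\sigma^{1/\varepsilon}d^{1/2}$, $h_1^{2/3}w_{\max}^{1/3}\lesssim(\log K)^{2/3}\sigma^{1/\varepsilon}d^{1/3}$. For $\Delta$ and an arm $a^*$ with $\Delta_a>0$ for all $a\ne a^*$, let $\Delta_{\min}=\min_{a\ne a^*}\Delta_a$, $\zeta(\Delta)=2^{\varepsilon-1}((1-\alpha)\alpha)^{1-\varepsilon}\sigma\bigl(\sum_{a\ne a^*}\Delta_a^{\alpha/(\alpha-1)}\bigr)^{(1-\alpha)(\varepsilon-1)}\Delta_{\min}^{\alpha(\varepsilon-1)-1}d^{\varepsilon/2}$ and $\omega(\Delta)=(\alpha(1-\alpha))^{-2}\sigma^{3/\varepsilon}\bigl(\sum_{a\ne a^*}\Delta_a^{\alpha/(\alpha-1)}\bigr)^{2(1-\alpha)}d$; then $\zeta(\Delta)\lesssim(\log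 K)^{\varepsilon-1}\sigma d^{\varepsilon/2}/\Delta_{\min}$ and, if $\Delta_{\min}\le1$, $\omega(\Delta)\lesssim\sigma^{3/\varepsilon}d(\log K/\Delta_{\min})^2$. In the adversarial regime (any such environment), $$\mathrm{Reg}_T=O\bigl((\log K)^{1-1/\varepsilon}\sigma^{1/\varepsilon}d^{1/2}T^{1/\varepsilon}+(\log K)^{2/3}\sigma^{1/\varepsilon}d^{1/3}T^{1/3}+\kappa\bigr).$$ (ii) If the environment satisfies a $(\Delta,C,T)$ self-bounding constraint with $C\ge0$, $\Delta_{a^*}\ge 0$, $\Delta_a>0$ for $a\neq a^*$ and $\Delta_{\min}\le1$, then, with a constant depending only on $c_1,c_2,\varepsilon$ and a positive lower bound on $\sigma$, $$\mathrm{Reg}_T=O\bigl(\iota+\iota'+C^{1/\varepsilon}(\iota+\iota')^{1-1/\varepsilon}+\kappa\bigr),$$ where, with $\log_+x=\max\{1,\log x\}$, $$\iota=\Bigl(\frac{2\sigma}{\varepsilon}\Bigr)^{\frac1{\varepsilon-1}}d^{\frac{\varepsilon}{2(\varepsilon-1)}}\frac{\log K}{\Delta_{\min}^{1/(\varepsilon-1)}}\cdot\frac1{\varepsilon-1}\log_+\!\Bigl(\frac{\sigma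 d^{\varepsilon/2}T(\log K)^{\varepsilon-1}}{\sigma^{\varepsilon/(\varepsilon-1)}d^{\varepsilon^2/(2(\varepsilon-1))}\log^\varepsilon K/\Delta_{\min}^{\varepsilon/(\varepsilon-1)}+C}\Bigr),$$ $$\iota'=\Bigl(\frac32\Bigr)^{-\frac12}\sigma^{\frac3{2\varepsilon}}d^{\frac12}\frac{\log K}{\Delta_{\min}}\log_+\!\Bigl(\frac{\sigma^{3/\varepsilon}d\,T\log^2K}{(\sigma^{3/(2\varepsilon)}d^{1/2}\log K/\Delta_{\min})^3+C}\Bigr).$$ -/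

import Mathlib

open MeasureTheory ProbabilityTheory Set
open scoped Matrix

noncomputable section

namespace HTBandit

universe u

/-! ### The interaction protocol

Arms are `Fin K`, features are `φ : Fin K → ℝᵈ`.  Rounds are numbered `0, 1, 2, …`, so index `t`
is the `(t + 1)`-st round. -/

/-- What is generated in one round: the pulled arm and the whole loss vector. -/
abbrev Round (K : ℕ) := Fin K × (Fin K → ℝ)

/-- What the learner has seen after `t` rounds: pulled arms and the incurred losses. -/
abbrev Obs (K t : ℕ) := Fin t → Fin K × ℝ

/-- The part of the history that is visible to the learner. -/
def observe {K t : ℕ} (h : Fin t → Round K) : Obs K t :=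
  fun i => ((h i).1, (h i).2 (h i).1)

lemma measurable_observe {K t : ℕ} : Measurable (observe : (Fin t → Round K) → Obs K t) := by
  have hev : Measurable (fun r : Round K => r.2 r.1) :=
    measurable_from_prod_countable_right (fun a => measurable_pi_apply a)
  refine measurable_pi_lambda _ fun i => ?_
  exact (measurable_fst.comp (measurable_pi_apply i)).prodMk (hev.comp (measurable_pi_apply i))

/-- A (non-oblivious) adversary for heavy-tailed linear bandits.  It first draws a private random
seed.  In each round it chooses, depending on the seed and on everything that happened before, a
parameter `θ` and a distribution of the loss vector; every arm `a` has mean loss `⟨φ a, θ⟩` and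
raw `ε`-th moment at most `σ`. -/
structure Environment {K d : ℕ} (φ : Fin K → Fin d → ℝ) (ε σ : ℝ) where
  Seed : Type u
  [instSeed : MeasurableSpace Seed]
  seedLaw : Measure Seed
  [isProbability : IsProbabilityMeasure seedLaw]
  θ : (t : ℕ) → Seed × (Fin t → Round K) → Fin d → ℝ
  loss : (t : ℕ) → Kernel (Seed × (Fin t → Round K)) (Fin K → ℝ)
  [isMarkov : ∀ t, IsMarkovKernel (loss t)]
  mean_eq : ∀ t x a, ∫ y, y a ∂(loss t x) = φ a ⬝ᵥ θ t x
  moment_le : ∀ t x a, ∫⁻ y, ENNReal.ofReal (|y a| ^ ε) ∂(loss t x) ≤ ENNReal.ofReal σ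

attribute [instance] Environment.instSeed Environment.isProbability Environment.isMarkov

/-- A (randomized) learning algorithm: a conditional distribution of the next arm given the
observed history. -/
structure Policy (K : ℕ) where
  act : (t : ℕ) → Kernel (Obs K t) (Fin K)
  [isMarkov : ∀ t, IsMarkovKernel (act t)]

attribute [instance] Policy.isMarkov

section Protocol

variable {K d : ℕ} {φ : Fin K → Fin d → ℝ} {ε σ : ℝ}

/-- One round: given the past, the arm and the loss vector are drawn independently, the arm from
the policy (which sees only the observed history) and the loss vector from the environment. -/
def stepKernel (env : Environment.{u} φ ε σ) (π : Policy K) (t : ℕ) :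
    Kernel (env.Seed × (Fin t → Round K)) (Round K) :=
  ((π.act t).comap (fun x => observe x.2) (measurable_observe.comp measurable_snd)) ×ₖ
    (env.loss t)

instance (env : Environment.{u} φ ε σ) (π : Policy K) (t : ℕ) :
    IsMarkovKernel (stepKernel env π t) := by
  unfold stepKernel; infer_instance

/-- The joint law of the seed and of the first `t` rounds. -/
def trajLaw (env : Environment.{u} φ ε σ) (π : Policy K) :
    (t : ℕ) → Measure (env.Seed × (Fin t → Round K))
  | 0 => env.seedLaw.map (fun s => (s, fun i : Fin 0 => i.elim0))
  | t + 1 => ((trajLaw env π t) ⊗ₘ (stepKernel env π t)).map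
      (fun x => (x.1.1, (Fin.snoc x.1.2 x.2 : Fin (t + 1) → Round K)))

lemma measurable_snoc {S : Type u} [MeasurableSpace S] {t : ℕ} :
    Measurable (fun x : (S × (Fin t → Round K)) × Round K =>
      (x.1.1, (Fin.snoc x.1.2 x.2 : Fin (t + 1) → Round K))) := by
  refine (measurable_fst.comp measurable_fst).prodMk (measurable_pi_lambda _ fun i => ?_)
  refine Fin.lastCases ?_ (fun j => ?_) i
  · simp only [Fin.snoc_last]
    exact measurable_snd
  · simp only [Fin.snoc_castSucc]
    exact (measurable_pi_apply j).comp (measurable_snd.comp measurable_fst)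

instance (env : Environment.{u} φ ε σ) (π : Policy K) (t : ℕ) :
    IsProbabilityMeasure (trajLaw env π t) := by
  induction t with
  | zero =>
    exact Measure.isProbabilityMeasure_map
      (measurable_id.prodMk measurable_const).aemeasurable
  | succ t ih => exact Measure.isProbabilityMeasure_map measurable_snoc.aemeasurable

/-- The pseudo-regret `max_a 𝔼[∑ₜ ℓ_{t,aₜ} - ∑ₜ ℓ_{t,a}]` after `T` rounds. -/
def regret (env : Environment.{u} φ ε σ) (π : Policy K) (T : ℕ) : ℝ :=
  ⨆ a : Fin K, ∫ ω, (∑ t : Fin T, (ω.2 t).2 (ω.2 t).1 - ∑ t : Fin T, (ω.2 t).2 a)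
    ∂(trajLaw env π T)

/-- The `(Δ, C, T)` self-bounding constraint: for every algorithm,
`Reg_T ≥ 𝔼[∑ₜ Δ_{aₜ}] - C`. -/
def SelfBounding (env : Environment.{u} φ ε σ) (Δ : Fin K → ℝ) (C : ℝ) (T : ℕ) : Prop :=
  ∀ π : Policy K,
    ∫ ω, (∑ t : Fin T, Δ (ω.2 t).1) ∂(trajLaw env π T) - C ≤ regret env π T

end Protocol

/-! ### The algorithm -/

/-- `min {‖q‖_∞, 1 - ‖q‖_∞}` (the norm of `Fin K → ℝ` is the sup norm). -/
def qStar {K : ℕ} (q : Fin K → ℝ) : ℝ := min ‖q‖ (1 - ‖q‖)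

/-- The negative Tsallis entropy `-(1/α) ∑_a (q_a ^ α - q_a)`. -/
def tsallis {K : ℕ} (α : ℝ) (q : Fin K → ℝ) : ℝ := -(1 / α) * ∑ a, (q a ^ α - q a)

/-- The mean feature vector `𝔼_{a ∼ p}[φ_a]`. -/
def meanFeature {K d : ℕ} (φ : Fin K → Fin d → ℝ) (p : Fin K → ℝ) : Fin d → ℝ :=
  ∑ a, p a • φ a

/-- The covariance `𝔼_{a ∼ p}[(φ_a - μ(p)) (φ_a - μ(p))ᵀ]`. -/
def covFeature {K d : ℕ} (φ : Fin K → Fin d → ℝ) (p : Fin K → ℝ) : Matrix (Fin d) (Fin d) ℝ :=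
  ∑ a, p a • Matrix.vecMulVec (φ a - meanFeature φ p) (φ a - meanFeature φ p)

/-- The quantity `(φ_a - μ(p))ᵀ V(p)⁻¹ (φ_b - μ(p))`. -/
def gram {K d : ℕ} (φ : Fin K → Fin d → ℝ) (p : Fin K → ℝ) (a b : Fin K) : ℝ :=
  (φ a - meanFeature φ p) ⬝ᵥ ((covFeature φ p)⁻¹ *ᵥ (φ b - meanFeature φ p))

/-- The inputs of the algorithm. -/
structure Params (K d : ℕ) where
  φ : Fin K → Fin d → ℝ
  ε : ℝ
  σ : ℝ
  α : ℝ
  β₁ : ℝ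
  βbar : ℝ
  p₀ : Fin K → ℝ

namespace Params

variable {K d : ℕ} (P : Params K d)

/-- The exponent `ᾱ = (ε - 1)(1 - α)` of the auxiliary regularizer. -/
def αbar : ℝ := (P.ε - 1) * (1 - P.α)

/-- The state of the algorithm at the start of a round: the cumulative shifted loss estimate
`∑_{s<t} (ℓ̂_s - b_s)` and the inverse learning rate `β_t`. -/
abbrev State (K : ℕ) := (Fin K → ℝ) × ℝ

/-- The objective `⟨L, q⟩ + β ψ(q) + β̄ ψ̄(q)` of follow-the-regularized-leader. -/
def objective (S : State K) (q : Fin K → ℝ) : ℝ :=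
  S.1 ⬝ᵥ q + S.2 * tsallis P.α q + P.βbar * tsallis P.αbar q

/-- `q_t`: a minimizer of the objective over the probability simplex. -/
def q (S : State K) : Fin K → ℝ :=
  Classical.epsilon fun x => x ∈ stdSimplex ℝ (Fin K) ∧
    IsMinOn (P.objective S) (stdSimplex ℝ (Fin K)) x

/-- The exploration rate `γ_t`. -/
def γ (S : State K) : ℝ :=
  256 / (1 - P.α) ^ 2 * P.σ ^ (2 / P.ε) * d / S.2 ^ 2 * qStar (P.q S) ^ (2 * (1 - P.α))

/-- The clipping threshold `s_{t,a}` (the same for all arms). -/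
def s (S : State K) : ℝ := (1 - P.α) * S.2 * qStar (P.q S) ^ (P.α - 1) / 8

/-- The sampling distribution `p_t = (1 - γ_t) q_t + γ_t p₀`. -/
def p (S : State K) : Fin K → ℝ := (1 - P.γ S) • P.q S + P.γ S • P.p₀

/-- The variance-reduced loss estimate `ℓ̃_{t,a}` after pulling `o.1` and incurring `o.2`. -/
def lossEst (S : State K) (o : Fin K × ℝ) (a : Fin K) : ℝ := gram P.φ (P.p S) a o.1 * o.2

/-- The clipped loss estimate `ℓ̂_{t,a}`. -/
def clippedEst (S : State K) (o : Fin K × ℝ) (a : Fin K) : ℝ :=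
  if |P.lossEst S o a| ≤ P.s S then P.lossEst S o a else 0

/-- The bonus `b_{t,a}`. -/
def bonus (S : State K) (a : Fin K) : ℝ :=
  P.σ * (∑ b, P.p S b * |gram P.φ (P.p S) a b| ^ P.ε) * P.s S ^ (1 - P.ε)

/-- The penalty `h_t = -ψ(q_t)`. -/
def h (S : State K) : ℝ := -tsallis P.α (P.q S)

/-- The stability quantity `z_t`. -/
def z (S : State K) : ℝ :=
  (1 - P.α) ^ (1 - P.ε) * P.σ * qStar (P.q S) ^ ((P.ε - 1) * (1 - P.α)) *
    (d : ℝ) ^ (P.ε / 2) * (1 - ‖P.p S‖) ^ (2 - P.ε)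

/-- The exploration quantity `w_t`. -/
def w (S : State K) : ℝ :=
  P.σ ^ (3 / P.ε) / (1 - P.α) ^ 2 * d * qStar (P.q S) ^ (2 * (1 - P.α))

/-- One round of updates: the cumulative loss estimate, and the learning rate
`β_{t+1} = β_t + (β_t^{1-ε} z_t + β_t^{-2} w_t) / h_t`. -/
def next (S : State K) (o : Fin K × ℝ) : State K :=
  (fun a => S.1 a + (P.clippedEst S o a - P.bonus S a),
    S.2 + 1 / P.h S * (S.2 ^ (1 - P.ε) * P.z S + P.w S / S.2 ^ 2))

/-- The state after the observations of the first `t` rounds. -/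
def state : (t : ℕ) → Obs K t → State K
  | 0, _ => (0, P.β₁)
  | t + 1, o => P.next (state t fun i => o i.castSucc) (o (Fin.last t))

/-- The state at the start of the first round. -/
def state₁ : State K := (0, P.β₁)

/-- `π` is the algorithm with inputs `P`, run for `T` rounds. -/
def Runs (π : Policy K) (T : ℕ) : Prop :=
  ∀ t < T, ∀ (o : Obs K t) (a : Fin K), (π.act t o).real {a} = P.p (P.state t o) a

/-- The standing assumptions on the problem and the prescribed choice of the inputs.
* The feature vectors affinely span `ℝᵈ`; this is what makes the covariances invertible.
* `p₀` maximizes `log det V(p)`.  This is written without `log`, since the logarithm of a vanishing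
  determinant has to be read as `-∞`.
* `1 - α = Θ(1 / log K)`, with `α ≥ 1/2`.
* `β₁` is so large that `γ_t ≤ 1/2` in all rounds, and `β̄` is above its threshold. -/
structure Admissible (c₁ c₂ : ℝ) (T : ℕ) : Prop where
  two_le_K : 2 ≤ K
  one_le_d : 1 ≤ d
  span : affineSpan ℝ (range P.φ) = ⊤
  one_lt_ε : 1 < P.ε
  ε_le_two : P.ε ≤ 2
  σ_pos : 0 < P.σ
  half_le_α : 1 / 2 ≤ P.α
  α_lt_one : P.α < 1
  le_α : c₁ / Real.log K ≤ 1 - P.α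
  α_le : 1 - P.α ≤ c₂ / Real.log K
  p₀_mem : P.p₀ ∈ stdSimplex ℝ (Fin K)
  p₀_max : IsMaxOn (fun p => (covFeature P.φ p).det) (stdSimplex ℝ (Fin K)) P.p₀
  β₁_pos : 0 < P.β₁
  γ_le_half : ∀ t < T, ∀ o : Obs K t, P.γ (P.state t o) ≤ 1 / 2
  βbar_ge : 64 / (1 - P.α) ^ 3 * (d : ℝ) ^ P.ε * P.β₁ ^ (1 - P.ε) *
    max (P.σ ^ (3 / P.ε)) P.σ ≤ P.βbar

/-- `zmax` is the largest possible value of `z_t` in the first `T` rounds. -/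
def IsZMax (T : ℕ) (zmax : ℝ) : Prop :=
  IsLUB {x | ∃ t < T, ∃ o : Obs K t, x = P.z (P.state t o)} zmax

/-- `wmax` is the largest possible value of `w_t` in the first `T` rounds. -/
def IsWMax (T : ℕ) (wmax : ℝ) : Prop :=
  IsLUB {x | ∃ t < T, ∃ o : Obs K t, x = P.w (P.state t o)} wmax

/-- `h₁ = -ψ(q₁)`. -/
def h₁ : ℝ := P.h P.state₁

/-- `h̄ = -ψ̄(q₁)`. -/
def hbar : ℝ := -tsallis P.αbar (P.q P.state₁)

/-- `κ = z_max β₁^{1-ε} + w_max β₁^{-2} + β₁ h₁ + β̄ h̄`. -/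
def κ (zmax wmax : ℝ) : ℝ :=
  zmax * P.β₁ ^ (1 - P.ε) + wmax / P.β₁ ^ 2 + P.β₁ * P.h₁ + P.βbar * P.hbar

/-- The smallest gap `Δ_min = min_{a ≠ a⋆} Δ_a`. -/
def minGap (Δ : Fin K → ℝ) (aStar : Fin K) : ℝ := ⨅ a : {a : Fin K // a ≠ aStar}, Δ a

/-- The self-bounding coefficient `ζ(Δ)`. -/
def ζ (Δ : Fin K → ℝ) (aStar : Fin K) : ℝ :=
  2 ^ (P.ε - 1) * ((1 - P.α) * P.α) ^ (1 - P.ε) * P.σ *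
    (∑ a ∈ Finset.univ.erase aStar, Δ a ^ (P.α / (P.α - 1))) ^ ((1 - P.α) * (P.ε - 1)) *
    minGap Δ aStar ^ (P.α * (P.ε - 1) - 1) * (d : ℝ) ^ (P.ε / 2)

/-- The self-bounding coefficient `ω(Δ)`. -/
def ω (Δ : Fin K → ℝ) (aStar : Fin K) : ℝ :=
  1 / (P.α * (1 - P.α)) ^ 2 * P.σ ^ (3 / P.ε) *
    (∑ a ∈ Finset.univ.erase aStar, Δ a ^ (P.α / (P.α - 1))) ^ (2 * (1 - P.α)) * d

end Params

/-- `log₊ x = max {1, log x}`. -/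
def logPlus (x : ℝ) : ℝ := max 1 (Real.log x)

/-- The leading term `ι` of the gap-dependent bound. -/
def iota (K d T : ℕ) (ε σ gap C : ℝ) : ℝ :=
  (2 * σ / ε) ^ (1 / (ε - 1)) * (d : ℝ) ^ (ε / (2 * (ε - 1))) *
    (Real.log K / gap ^ (1 / (ε - 1))) *
    logPlus (σ * (d : ℝ) ^ (ε / 2) * T * Real.log K ^ (ε - 1) /
      (σ ^ (ε / (ε - 1)) * (d : ℝ) ^ (ε ^ 2 / (2 * (ε - 1))) * Real.log K ^ ε /
        gap ^ (ε / (ε - 1)) + C)) / (ε - 1)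

/-- The second term `ι'` of the gap-dependent bound. -/
def iota' (K d T : ℕ) (ε σ gap C : ℝ) : ℝ :=
  (3 / 2 : ℝ) ^ (-(1 / 2) : ℝ) * σ ^ (3 / (2 * ε)) * (d : ℝ) ^ (1 / 2 : ℝ) *
    (Real.log K / gap) *
    logPlus (σ ^ (3 / ε) * d * T * Real.log K ^ 2 /
      ((σ ^ (3 / (2 * ε)) * (d : ℝ) ^ (1 / 2 : ℝ) * Real.log K / gap) ^ 3 + C))

end HTBandit

end

namespace HTBandit

/-! ### Weighted power means -/

/-! The proof is a potential argument. For a comparator arm `a`, the potential is the accumulated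
estimate of `a` minus the optimal value of the regularized objective. It starts at `β₁ h₁ + β̄ h̄`.
It is never negative, because both entropies vanish at a vertex of the simplex. `potential_next`
bounds its change in one round by the linearized regret of the shifted estimates, a second-order
term and twice the cost `β^{1-ε} z + β^{-2} w`. `expected_round_le` shows that the conditional mean
of the true regret plus the first two terms is at most `1024` costs, so the regret is at most the
initial potential plus `1026` expected accumulated costs (`expected_regret_le`).

Three facts make the round estimate work. A determinant-maximizing design has leverages at most `d`,
so exploration at rate `γ` keeps every bonus below the clipping level. The bonus dominates the
clipping bias and is itself paid for by `z`, through an `ε`-moment bound on the leverages that gains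
a power of `1 - ‖p‖`. Finally, the auxiliary regularizer absorbs the change of the learning rate, so
no small probability more than doubles in a round and the entropy at most doubles
(`objective_step`).

The rest is deterministic. Each round raises `β` by at least `z β^{-ρ} / h`, with `ρ = ε - 1`, and
by at least the analogue for `w` with `ρ = 2`. A truncated telescoping sum then bounds the cost over
rounds with `h ≤ θ` by `2 (θ^ρ ∑ z)^{1/(1+ρ)}`. Since `K^{1-α}` is bounded, so is `h`, and one
application gives the adversarial bound.

For the gap-dependent bound the rounds are split into dyadic levels of `h`. Up to the scales of `z`
and `w`, the quantities `h^{ε-1} z` and `h² w` are at most the probability of playing an arm other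
than `a⋆`, whose expected sum is at most `(Reg + C) / Δ_min`. Logarithmically many levels suffice,
and the resulting inequality is solved for the regret. -/

lemma sum_mul_rpow_le {ι : Type*} (s : Finset ι) (w x : ι → ℝ) {θ : ℝ} (hθ : 0 < θ) (hθ1 : θ ≤ 1)
    (hw : ∀ i ∈ s, 0 ≤ w i) (hx : ∀ i ∈ s, 0 ≤ x i) :
    ∑ i ∈ s, w i * x i ^ θ ≤ (∑ i ∈ s, w i) ^ (1 - θ) * (∑ i ∈ s, w i * x i) ^ θ := by
  have hW : 0 ≤ ∑ i ∈ s, w i := Finset.sum_nonneg hw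
  have hM : 0 ≤ ∑ i ∈ s, w i * x i := Finset.sum_nonneg fun i hi => mul_nonneg (hw i hi) (hx i hi)
  rcases hW.eq_or_lt with h0 | hpos
  · have hz := (Finset.sum_eq_zero_iff_of_nonneg hw).1 h0.symm
    rw [Finset.sum_eq_zero fun i hi => by rw [hz i hi, zero_mul]]
    positivity
  · set W := ∑ i ∈ s, w i with hWdef
    have hc := (Real.concaveOn_rpow hθ.le hθ1).le_map_sum (t := s) (w := fun i => w i / W) (p := x)
      (fun i hi => div_nonneg (hw i hi) hW) (by rw [← Finset.sum_div]; exact div_self hpos.ne')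
      (fun i hi => hx i hi)
    simp only [smul_eq_mul, div_mul_eq_mul_div, ← Finset.sum_div] at hc
    rw [Real.div_rpow hM hW, div_le_iff₀ hpos] at hc
    calc _ ≤ _ := hc
      _ = _ := by rw [Real.rpow_sub hpos, Real.rpow_one]; ring

lemma sum_rpow_le_card {ι : Type*} (s : Finset ι) (x : ι → ℝ) {θ : ℝ} (hθ : 0 < θ) (hθ1 : θ ≤ 1)
    (hx : ∀ i ∈ s, 0 ≤ x i) :
    ∑ i ∈ s, x i ^ θ ≤ (s.card : ℝ) ^ (1 - θ) * (∑ i ∈ s, x i) ^ θ := by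
  simpa using sum_mul_rpow_le s (fun _ => 1) x hθ hθ1 (fun _ _ => zero_le_one) hx

/-! ### Covariance of the features -/

section Design

variable {K d : ℕ} (φ : Fin K → Fin d → ℝ) (p : Fin K → ℝ)

lemma sum_centered (hp : ∑ a, p a = 1) (x : Fin d → ℝ) :
    ∑ b, p b * ((φ b - meanFeature φ p) ⬝ᵥ x) = 0 := by
  have h : (∑ b, p b • (φ b - meanFeature φ p)) = 0 := by
    simp only [smul_sub, Finset.sum_sub_distrib, ← Finset.sum_smul, hp, one_smul]
    simp [meanFeature]
  have := congrArg (fun v => v ⬝ᵥ x) h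
  simpa [sum_dotProduct] using this

lemma dot_cov (x y : Fin d → ℝ) :
    x ⬝ᵥ (covFeature φ p *ᵥ y) =
      ∑ b, p b * (((φ b - meanFeature φ p) ⬝ᵥ x) * ((φ b - meanFeature φ p) ⬝ᵥ y)) := by
  simp only [covFeature, Matrix.sum_mulVec, Matrix.smul_mulVec, dotProduct_sum, dotProduct_smul,
    smul_eq_mul, Matrix.vecMulVec_mulVec]
  refine Finset.sum_congr rfl fun b _ => ?_
  simp [dotProduct_comm x]

lemma cov_apply (hp : ∑ a, p a = 1) (i j : Fin d) :
    covFeature φ p i j = ∑ b, p b * (φ b i * φ b j) - meanFeature φ p i * meanFeature φ p j := by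
  have h1 : ∀ i, meanFeature φ p i = ∑ b, p b * φ b i := fun i => by
    simp [meanFeature, Finset.sum_apply]
  simp only [covFeature, Matrix.sum_apply, Matrix.smul_apply, Matrix.vecMulVec_apply, Pi.sub_apply,
    smul_eq_mul]
  have : ∀ b, p b * ((φ b i - meanFeature φ p i) * (φ b j - meanFeature φ p j)) =
      p b * (φ b i * φ b j) - (p b * φ b i) * meanFeature φ p j - (p b * φ b j) * meanFeature φ p i
        + p b * (meanFeature φ p i * meanFeature φ p j) := fun b => by ring
  simp only [this, Finset.sum_add_distrib, Finset.sum_sub_distrib, ← Finset.sum_mul, hp, ← h1]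
  ring

lemma cov_isHermitian : (covFeature φ p).IsHermitian := by
  ext i j
  simp only [covFeature, Matrix.conjTranspose_apply, Matrix.sum_apply, Matrix.smul_apply,
    Matrix.vecMulVec_apply, smul_eq_mul, star_trivial]
  exact Finset.sum_congr rfl fun b _ => by ring

lemma cov_posSemidef (hp : ∀ a, 0 ≤ p a) : (covFeature φ p).PosSemidef := by
  refine Matrix.PosSemidef.of_dotProduct_mulVec_nonneg (cov_isHermitian φ p) fun x => ?_
  rw [star_trivial, dot_cov]
  exact Finset.sum_nonneg fun b _ => mul_nonneg (hp b) (mul_self_nonneg _)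

variable {φ p}

/-- A direction of zero variance has the same inner product with every feature, hence is orthogonal
to all their differences; these span the whole space. -/
lemma cov_posDef (hspan : affineSpan ℝ (range φ) = ⊤) (hp : ∀ a, 0 < p a) :
    (covFeature φ p).PosDef := by
  refine Matrix.PosDef.of_dotProduct_mulVec_pos (cov_isHermitian φ p) fun x hx => ?_
  rw [star_trivial, dot_cov]
  refine lt_of_le_of_ne (Finset.sum_nonneg fun b _ => mul_nonneg (hp b).le (mul_self_nonneg _)) ?_
  intro h0
  have hz := (Finset.sum_eq_zero_iff_of_nonneg
    (fun b _ => mul_nonneg (hp b).le (mul_self_nonneg _))).1 h0.symm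
  have hb : ∀ b, φ b ⬝ᵥ x = meanFeature φ p ⬝ᵥ x := fun b => by
    have := hz b (Finset.mem_univ b)
    rw [mul_eq_zero, or_iff_right (hp b).ne', mul_self_eq_zero, sub_dotProduct] at this
    linarith
  let f : (Fin d → ℝ) →ₗ[ℝ] ℝ :=
    { toFun := fun v => v ⬝ᵥ x
      map_add' := fun u v => add_dotProduct u v x
      map_smul' := fun c v => smul_dotProduct c v x }
  have hle : vectorSpan ℝ (range φ) ≤ LinearMap.ker f := by
    rw [vectorSpan_def, Submodule.span_le]
    rintro _ ⟨_, ⟨a, rfl⟩, _, ⟨b, rfl⟩, rfl⟩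
    simp [f, sub_dotProduct, hb]
  have htop : vectorSpan ℝ (range φ) = ⊤ := by
    rw [← direction_affineSpan, hspan, AffineSubspace.direction_top]
  have hxk : x ∈ LinearMap.ker f := hle (htop ▸ Submodule.mem_top)
  exact hx (dotProduct_self_eq_zero.1 hxk)

section Inverse

variable (hV : (covFeature φ p).PosDef)
include hV

lemma cov_mulVec_inv (x : Fin d → ℝ) : covFeature φ p *ᵥ ((covFeature φ p)⁻¹ *ᵥ x) = x := by
  rw [Matrix.mulVec_mulVec, Matrix.mul_nonsing_inv _ ((Matrix.isUnit_iff_isUnit_det _).1 hV.isUnit),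
    Matrix.one_mulVec]

lemma dot_inv_comm (x y : Fin d → ℝ) :
    x ⬝ᵥ ((covFeature φ p)⁻¹ *ᵥ y) = y ⬝ᵥ ((covFeature φ p)⁻¹ *ᵥ x) := by
  nth_rewrite 1 [← cov_mulVec_inv hV x]
  nth_rewrite 2 [← cov_mulVec_inv hV y]
  rw [dotProduct_comm, dot_cov, dotProduct_comm _ ((covFeature φ p)⁻¹ *ᵥ x), dot_cov]
  exact Finset.sum_congr rfl fun b _ => by ring

lemma gram_eq (a b : Fin K) : gram φ p a b =
    (φ b - meanFeature φ p) ⬝ᵥ ((covFeature φ p)⁻¹ *ᵥ (φ a - meanFeature φ p)) :=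
  dot_inv_comm hV _ _

lemma sum_gram_sq (a : Fin K) : ∑ b, p b * gram φ p a b ^ 2 = gram φ p a a := by
  have h := dot_cov φ p ((covFeature φ p)⁻¹ *ᵥ (φ a - meanFeature φ p))
    ((covFeature φ p)⁻¹ *ᵥ (φ a - meanFeature φ p))
  rw [cov_mulVec_inv hV, dotProduct_comm] at h
  rw [gram, h]
  exact Finset.sum_congr rfl fun b _ => by rw [gram_eq hV, sq]

/-- The unclipped estimate is unbiased up to a shift common to all arms. Centering `φ b` is free
because the centered features average to zero under `p`. -/
lemma sum_gram_mul_dot (hp : ∑ a, p a = 1) (a : Fin K) (θ : Fin d → ℝ) :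
    ∑ b, p b * (gram φ p a b * (φ b ⬝ᵥ θ)) = (φ a - meanFeature φ p) ⬝ᵥ θ := by
  have h := dot_cov φ p ((covFeature φ p)⁻¹ *ᵥ (φ a - meanFeature φ p)) θ
  have h2 : ((covFeature φ p)⁻¹ *ᵥ (φ a - meanFeature φ p)) ⬝ᵥ (covFeature φ p *ᵥ θ) =
      θ ⬝ᵥ (covFeature φ p *ᵥ ((covFeature φ p)⁻¹ *ᵥ (φ a - meanFeature φ p))) := by
    rw [dot_cov, dot_cov]
    exact Finset.sum_congr rfl fun b _ => by ring
  rw [h2, cov_mulVec_inv hV, dotProduct_comm] at h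
  rw [h]
  have h3 := sum_centered φ p hp ((covFeature φ p)⁻¹ *ᵥ (φ a - meanFeature φ p))
  have : ∀ b, p b * (gram φ p a b * (φ b ⬝ᵥ θ)) =
      p b * (((φ b - meanFeature φ p) ⬝ᵥ ((covFeature φ p)⁻¹ *ᵥ (φ a - meanFeature φ p))) *
        ((φ b - meanFeature φ p) ⬝ᵥ θ)) +
      p b * ((φ b - meanFeature φ p) ⬝ᵥ ((covFeature φ p)⁻¹ *ᵥ (φ a - meanFeature φ p))) *
        (meanFeature φ p ⬝ᵥ θ) := fun b => by
    rw [gram_eq hV, sub_dotProduct (φ b) _ θ]; ring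
  simp only [this, Finset.sum_add_distrib, ← Finset.sum_mul, h3]
  ring

/-- The sum is the trace of `V⁻¹ V`. -/
lemma sum_gram_diag : ∑ a, p a * gram φ p a a = d := by
  have h : ((covFeature φ p)⁻¹ * covFeature φ p).trace = d := by
    rw [Matrix.nonsing_inv_mul _ ((Matrix.isUnit_iff_isUnit_det _).1 hV.isUnit), Matrix.trace_one,
      Fintype.card_fin]
  have key : ∀ M : Matrix (Fin d) (Fin d) ℝ, (M * covFeature φ p).trace =
      ∑ a, p a * ((φ a - meanFeature φ p) ⬝ᵥ (M *ᵥ (φ a - meanFeature φ p))) := fun M => by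
    simp only [covFeature, Matrix.mul_sum, Matrix.trace_sum, Matrix.mul_smul, Matrix.trace_smul,
      smul_eq_mul, Matrix.mul_vecMulVec, Matrix.trace_vecMulVec]
    exact Finset.sum_congr rfl fun b _ => by rw [dotProduct_comm]
  rw [← h, key]
  rfl

lemma gram_self_nonneg (hp : ∀ a, 0 ≤ p a) (a : Fin K) : 0 ≤ gram φ p a a := by
  rw [← sum_gram_sq hV]
  exact Finset.sum_nonneg fun b _ => mul_nonneg (hp b) (sq_nonneg _)

/-- Under `p`, row `a` of the Gram matrix has mean zero and second moment `g = gram φ p a a`.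
Isolating the entry at `a` and applying Cauchy–Schwarz to the others gives `(p g)² ≤ (1 - p) (g - p
g²)`, which simplifies to the claim. -/
lemma mul_gram_self_le (hp : ∀ a, 0 ≤ p a) (hp1 : ∑ a, p a = 1) (a : Fin K) :
    p a * gram φ p a a ≤ 1 - p a := by
  have hs := sum_gram_sq hV a
  have h0 := sum_centered φ p hp1 ((covFeature φ p)⁻¹ *ᵥ (φ a - meanFeature φ p))
  simp only [← gram_eq hV] at h0
  rw [← Finset.add_sum_erase _ _ (Finset.mem_univ a)] at hs h0 hp1
  set g := gram φ p a a
  have hcs := Finset.sum_sq_le_sum_mul_sum_of_sq_le_mul (Finset.univ.erase a)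
    (r := fun b => p b * gram φ p a b) (f := fun b => p b) (g := fun b => p b * gram φ p a b ^ 2)
    (fun b _ => hp b) (fun b _ => mul_nonneg (hp b) (sq_nonneg _)) (fun b _ => le_of_eq (by ring))
  have hg := gram_self_nonneg hV hp a
  have e1 : ∑ b ∈ Finset.univ.erase a, p b * gram φ p a b = -(p a * g) := by linarith
  have e2 : ∑ b ∈ Finset.univ.erase a, p b * gram φ p a b ^ 2 = g - p a * g ^ 2 := by linarith
  have e3 : ∑ b ∈ Finset.univ.erase a, p b = 1 - p a := by linarith
  rw [e1, e2, e3] at hcs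
  rcases hg.eq_or_lt with h | h
  · rw [show g = 0 from h.symm, mul_zero, ← e3]
    exact Finset.sum_nonneg fun b _ => hp b
  · have : g * (p a * g) ≤ g * (1 - p a) := by nlinarith
    exact le_of_mul_le_mul_left this h

end Inverse

/-! ### Optimal designs -/

/-- Moving mass towards one arm is, up to scaling, a rank-one update, so the determinant of the
perturbed design is explicit. -/
lemma cov_mix_vertex (p : Fin K → ℝ) (hp : ∑ a, p a = 1) (a : Fin K) (t : ℝ) :
    covFeature φ ((1 - t) • p + t • Pi.single a 1) =
      (1 - t) • (covFeature φ p +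
        Matrix.vecMulVec (t • (φ a - meanFeature φ p)) (φ a - meanFeature φ p)) := by
  have hsum : ∑ b, ((1 - t) • p + t • Pi.single a 1 : Fin K → ℝ) b = 1 := by
    simp [Finset.sum_add_distrib, ← Finset.mul_sum, hp]
  have hm : ∀ i, meanFeature φ ((1 - t) • p + t • Pi.single a 1) i =
      (1 - t) * meanFeature φ p i + t * φ a i := fun i => by
    simp [meanFeature, Finset.sum_apply, add_mul, Finset.sum_add_distrib, Finset.mul_sum, mul_assoc,
      Pi.single_apply]
  ext i j
  rw [cov_apply φ _ hsum, hm, hm, Matrix.smul_apply, Matrix.add_apply, cov_apply φ p hp,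
    Matrix.vecMulVec_apply]
  have : ∑ b, ((1 - t) • p + t • Pi.single a 1 : Fin K → ℝ) b * (φ b i * φ b j) =
      (1 - t) * ∑ b, p b * (φ b i * φ b j) + t * (φ a i * φ a j) := by
    simp [add_mul, Finset.sum_add_distrib, Finset.mul_sum, mul_assoc, Pi.single_apply]
  rw [this]
  simp only [Pi.smul_apply, Pi.sub_apply, smul_eq_mul]
  ring

lemma det_add_vecMulVec {A : Matrix (Fin d) (Fin d) ℝ} (hA : IsUnit A.det) (u v : Fin d → ℝ) :
    (A + Matrix.vecMulVec u v).det = A.det * (1 + v ⬝ᵥ (A⁻¹ *ᵥ u)) := by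
  have h := Matrix.det_add_replicateCol_mul_replicateRow (ι := Unit) hA u v
  rw [← Matrix.vecMulVec_eq] at h
  rw [h, Matrix.det_unique (n := Unit), Matrix.add_apply, Matrix.one_apply_eq, Matrix.mul_assoc,
    ← Matrix.replicateCol_mulVec, Matrix.replicateRow_mul_replicateCol_apply]

variable {p₀ : Fin K → ℝ}

/-- The uniform design already has positive determinant, so the maximal determinant is positive. -/
lemma optimal_posDef [NeZero K] (hspan : affineSpan ℝ (range φ) = ⊤)
    (h₀ : p₀ ∈ stdSimplex ℝ (Fin K))
    (hmax : IsMaxOn (fun p => (covFeature φ p).det) (stdSimplex ℝ (Fin K)) p₀) :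
    (covFeature φ p₀).PosDef := by
  have hK : (0 : ℝ) < K := Nat.cast_pos.2 (NeZero.pos K)
  have hu : (fun _ => (K : ℝ)⁻¹) ∈ stdSimplex ℝ (Fin K) :=
    ⟨fun _ => inv_nonneg.2 hK.le, by simp [hK.ne']⟩
  have h1 : 0 < (covFeature φ p₀).det :=
    (cov_posDef hspan fun _ => inv_pos.2 hK).det_pos.trans_le (hmax hu)
  exact (cov_posSemidef φ p₀ h₀.1).posDef_iff_isUnit.2
    ((Matrix.isUnit_iff_isUnit_det _).2 h1.ne'.isUnit)

/-- The Kiefer–Wolfowitz bound for a determinant-maximizing design. -/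
lemma optimal_leverage_le (hV : (covFeature φ p₀).PosDef) (h₀ : p₀ ∈ stdSimplex ℝ (Fin K))
    (hmax : IsMaxOn (fun p => (covFeature φ p).det) (stdSimplex ℝ (Fin K)) p₀) (a : Fin K) :
    (φ a - meanFeature φ p₀) ⬝ᵥ ((covFeature φ p₀)⁻¹ *ᵥ (φ a - meanFeature φ p₀)) ≤ d := by
  set x := (φ a - meanFeature φ p₀) ⬝ᵥ ((covFeature φ p₀)⁻¹ *ᵥ (φ a - meanFeature φ p₀)) with hx
  have hdet := hV.det_pos
  have hx0 : 0 ≤ x := gram_self_nonneg hV h₀.1 a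
  -- Optimality against moving mass `t` to arm `a` says `(1 - t)^d (1 + t x) ≤ 1`. Bernoulli's
  -- inequality linearizes the power, and a factor `t` cancels; `t → 0` then gives `x ≤ d`.
  have key : ∀ t ∈ Ioo (0 : ℝ) 1, x - d - d * t * x ≤ 0 := by
    rintro t ⟨ht0, ht1⟩
    have hmem : (1 - t) • p₀ + t • Pi.single a (1 : ℝ) ∈ stdSimplex ℝ (Fin K) :=
      convex_stdSimplex ℝ (Fin K) h₀ (single_mem_stdSimplex ℝ a) (by linarith) ht0.le (by ring)
    have h1 : (covFeature φ ((1 - t) • p₀ + t • Pi.single a (1 : ℝ))).det ≤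
      (covFeature φ p₀).det := hmax hmem
    rw [cov_mix_vertex p₀ h₀.2, Matrix.det_smul, Fintype.card_fin,
      det_add_vecMulVec hdet.ne'.isUnit, Matrix.mulVec_smul, dotProduct_smul, smul_eq_mul,
      ← hx] at h1
    have h2 : (1 - t) ^ d * (1 + t * x) ≤ 1 := by
      have : (covFeature φ p₀).det * ((1 - t) ^ d * (1 + t * x)) ≤ (covFeature φ p₀).det * 1 := by
        linarith
      exact le_of_mul_le_mul_left this hdet
    have h3 : 1 - d * t ≤ (1 - t) ^ d := by
      have := one_add_mul_le_pow (show (-2 : ℝ) ≤ -t by linarith) d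
      simpa [sub_eq_add_neg] using this
    have h4 : (1 - d * t) * (1 + t * x) ≤ 1 :=
      (mul_le_mul_of_nonneg_right h3 (by positivity)).trans h2
    have h5 : t * (x - d - d * t * x) ≤ t * 0 := by linarith
    exact le_of_mul_le_mul_left h5 ht0
  have hlim : Filter.Tendsto (fun t : ℝ => x - d - d * t * x) (nhdsWithin 0 (Ioi 0))
      (nhds (x - d - d * 0 * x)) :=
    (Continuous.tendsto (by fun_prop) 0).mono_left nhdsWithin_le_nhds
  have := le_of_tendsto hlim (Filter.eventually_of_mem (Ioo_mem_nhdsGT one_pos) key)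
  linarith

/-- Cauchy–Schwarz for the form `V(p₀)`, applied to `x` and `V(p₀)⁻¹ (φ a - μ₀)`; the squared length
of the latter is a leverage, at most `d`. -/
lemma sq_dot_le_of_optimal (hV : (covFeature φ p₀).PosDef) (h₀ : p₀ ∈ stdSimplex ℝ (Fin K))
    (hmax : IsMaxOn (fun p => (covFeature φ p).det) (stdSimplex ℝ (Fin K)) p₀) (a : Fin K)
    (x : Fin d → ℝ) :
    ((φ a - meanFeature φ p₀) ⬝ᵥ x) ^ 2 ≤ d * (x ⬝ᵥ (covFeature φ p₀ *ᵥ x)) := by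
  set y := (covFeature φ p₀)⁻¹ *ᵥ (φ a - meanFeature φ p₀) with hy
  have h1 : (φ a - meanFeature φ p₀) ⬝ᵥ x = x ⬝ᵥ (covFeature φ p₀ *ᵥ y) := by
    rw [hy, cov_mulVec_inv hV, dotProduct_comm]
  have h2 : y ⬝ᵥ (covFeature φ p₀ *ᵥ y) ≤ d := by
    rw [hy, cov_mulVec_inv hV, dotProduct_comm]
    exact optimal_leverage_le hV h₀ hmax a
  have h3 := (cov_posSemidef φ p₀ h₀.1).dotProduct_mulVec_nonneg x
  rw [star_trivial] at h3
  rw [h1]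
  refine le_trans ?_ (mul_le_mul_of_nonneg_right h2 h3)
  simp only [dot_cov]
  rw [mul_comm]
  exact Finset.sum_sq_le_sum_mul_sum_of_sq_le_mul _
    (fun b _ => mul_nonneg (h₀.1 b) (mul_self_nonneg _))
    (fun b _ => mul_nonneg (h₀.1 b) (mul_self_nonneg _)) (fun b _ => le_of_eq (by ring))

/-- Put `x = V(p)⁻¹ (φ a - μ)`. The second moment of `p₀` about the mean of `p` in direction `x` is
`Q + m²`, where `m` comes from the difference of the two means, and `γ (Q + m²) ≤ g`. Moreover `g =
n + m` with `n² ≤ d Q`, so `g² ≤ (d + 1)(Q + m²)`. The extra `1` is the price of the mismatched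
means. -/
lemma gram_self_le (hspan : affineSpan ℝ (range φ) = ⊤) (h₀ : p₀ ∈ stdSimplex ℝ (Fin K))
    (hmax : IsMaxOn (fun p => (covFeature φ p).det) (stdSimplex ℝ (Fin K)) p₀)
    (hp : ∀ a, 0 < p a) (hp1 : ∑ a, p a = 1) {γ : ℝ} (hγ : 0 < γ) (hle : ∀ a, γ * p₀ a ≤ p a)
    (a : Fin K) : gram φ p a a ≤ (d + 1) / γ := by
  have : NeZero K := ⟨fun h => by subst h; exact a.elim0⟩
  have hV₀ := optimal_posDef hspan h₀ hmax
  have hV := cov_posDef hspan hp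
  set x := (covFeature φ p)⁻¹ *ᵥ (φ a - meanFeature φ p) with hx
  set μ := meanFeature φ p
  set μ₀ := meanFeature φ p₀ with hμ₀
  have hg : x ⬝ᵥ (covFeature φ p *ᵥ x) = gram φ p a a := by
    rw [hx, cov_mulVec_inv hV, dotProduct_comm]; rfl
  have hga : gram φ p a a = (φ a - μ₀) ⬝ᵥ x + (μ₀ - μ) ⬝ᵥ x := by
    rw [← add_dotProduct, sub_add_sub_cancel]; rfl
  have hQ := (cov_posSemidef φ p₀ h₀.1).dotProduct_mulVec_nonneg x
  rw [star_trivial] at hQ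
  have hlow : γ * (x ⬝ᵥ (covFeature φ p₀ *ᵥ x) + ((μ₀ - μ) ⬝ᵥ x) ^ 2) ≤ gram φ p a a := by
    rw [← hg, dot_cov φ p, dot_cov φ p₀]
    have e : (∑ b, p₀ b * ((φ b - μ₀) ⬝ᵥ x * (φ b - μ₀) ⬝ᵥ x)) + ((μ₀ - μ) ⬝ᵥ x) ^ 2 =
        ∑ b, p₀ b * ((φ b - μ) ⬝ᵥ x * (φ b - μ) ⬝ᵥ x) := by
      have h0 := sum_centered φ p₀ h₀.2 x
      have : ∀ b, p₀ b * ((φ b - μ) ⬝ᵥ x * (φ b - μ) ⬝ᵥ x) =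
          p₀ b * ((φ b - μ₀) ⬝ᵥ x * (φ b - μ₀) ⬝ᵥ x) +
          2 * ((μ₀ - μ) ⬝ᵥ x) * (p₀ b * ((φ b - μ₀) ⬝ᵥ x)) + p₀ b * ((μ₀ - μ) ⬝ᵥ x) ^ 2 :=
        fun b => by
          rw [← sub_add_sub_cancel (φ b) μ₀ μ, add_dotProduct]; ring
      simp only [this, Finset.sum_add_distrib, ← Finset.mul_sum, ← Finset.sum_mul, h₀.2]
      rw [← hμ₀] at h0
      rw [h0]; ring
    rw [e, Finset.mul_sum]
    refine Finset.sum_le_sum fun b _ => ?_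
    rw [← mul_assoc]
    exact mul_le_mul_of_nonneg_right (hle b) (mul_self_nonneg _)
  have hcs := sq_dot_le_of_optimal hV₀ h₀ hmax a x
  rw [← hμ₀] at hcs
  have hd : (0 : ℝ) ≤ d := Nat.cast_nonneg d
  set Q := x ⬝ᵥ (covFeature φ p₀ *ᵥ x)
  set m := (μ₀ - μ) ⬝ᵥ x
  set n := (φ a - μ₀) ⬝ᵥ x
  set g := gram φ p a a
  have hsq : g ^ 2 ≤ (d + 1) * (Q + m ^ 2) := by
    rw [hga]
    rcases hd.eq_or_lt with h | h
    · rw [← h] at hcs ⊢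
      have : n = 0 := by nlinarith [sq_nonneg n]
      rw [this]; nlinarith
    · have : 0 ≤ d * (Q + m ^ 2) * (d + 1) - d * (n + m) ^ 2 := by
        nlinarith [sq_nonneg (n - d * m), mul_nonneg hd hQ]
      nlinarith
  have hg0 : 0 ≤ g := gram_self_nonneg hV (fun a => (hp a).le) a
  rw [le_div_iff₀ hγ]
  rcases hg0.eq_or_lt with h | h
  · rw [← h, zero_mul]; positivity
  · have : g * (g * γ) ≤ g * (d + 1) := by nlinarith
    exact le_of_mul_le_mul_left this h

/-- The `ε`-th moment of the pairwise leverages, with the gain from concentration of `p`. -/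
lemma sum_sum_gram_rpow_le (hV : (covFeature φ p).PosDef) (hp : p ∈ stdSimplex ℝ (Fin K))
    (hd : 1 ≤ d) {ε : ℝ} (h1 : 1 < ε) (h2 : ε ≤ 2) (a' : Fin K) :
    ∑ a, p a * ∑ b, p b * |gram φ p a b| ^ ε ≤
      4 * (d : ℝ) ^ (ε / 2) * (1 - p a') ^ (2 - ε) := by
  obtain ⟨hp0, hp1⟩ := hp
  set m := 1 - p a' with hm
  have hpa1 : p a' ≤ 1 := by
    rw [← hp1]; exact Finset.single_le_sum (fun b _ => hp0 b) (Finset.mem_univ a')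
  have hm0 : 0 ≤ m := by linarith
  have hm1 : m ≤ 1 := by linarith [hp0 a']
  have hd1 : (1 : ℝ) ≤ d := by exact_mod_cast hd
  have hD : (1 : ℝ) ≤ (d : ℝ) ^ (ε / 2) := Real.one_le_rpow hd1 (by linarith)
  have habs : ∀ a b, |gram φ p a b| ^ ε = (gram φ p a b ^ 2) ^ (ε / 2) := fun a b => by
    rw [← sq_abs, ← Real.rpow_natCast, ← Real.rpow_mul (abs_nonneg _)]
    congr 1; push_cast; ring
  have hE : ∑ b ∈ Finset.univ.erase a', p b = m := by
    rw [← Finset.add_sum_erase _ _ (Finset.mem_univ a')] at hp1; linarith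
  have hg0 := gram_self_nonneg hV hp0
  -- Weighted power mean with exponent `ε / 2 ≤ 1` over a subset of columns; the mass of the subset
  -- supplies a power of `m` when `a'` is left out.
  have hrow : ∀ (s : Finset (Fin K)) (a : Fin K), ∑ b ∈ s, p b * |gram φ p a b| ^ ε ≤
      (∑ b ∈ s, p b) ^ (1 - ε / 2) * gram φ p a a ^ (ε / 2) := fun s a => by
    simp only [habs]
    refine (sum_mul_rpow_le s p _ (by linarith) (by linarith) (fun b _ => hp0 b)
      (fun b _ => sq_nonneg _)).trans ?_
    have hnn : ∀ b, 0 ≤ p b * gram φ p a b ^ 2 := fun b => mul_nonneg (hp0 b) (sq_nonneg _)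
    refine mul_le_mul_of_nonneg_left (Real.rpow_le_rpow (Finset.sum_nonneg fun b _ => hnn b) ?_
      (by linarith)) (Real.rpow_nonneg (Finset.sum_nonneg fun b _ => hp0 b) _)
    rw [← sum_gram_sq hV]
    exact Finset.sum_le_sum_of_subset_of_nonneg (Finset.subset_univ s) fun b _ _ => hnn b
  have hcol : ∑ a ∈ Finset.univ.erase a', p a * gram φ p a a ^ (ε / 2) ≤
      m ^ (1 - ε / 2) * (d : ℝ) ^ (ε / 2) := by
    refine (sum_mul_rpow_le _ p _ (by linarith) (by linarith) (fun b _ => hp0 b)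
      (fun b _ => hg0 b)).trans ?_
    rw [hE]
    refine mul_le_mul_of_nonneg_left (Real.rpow_le_rpow (Finset.sum_nonneg fun b _ =>
      mul_nonneg (hp0 b) (hg0 b)) ?_ (by linarith)) (Real.rpow_nonneg hm0 _)
    rw [← sum_gram_diag hV]
    exact Finset.sum_le_sum_of_subset_of_nonneg (Finset.subset_univ _)
      fun b _ _ => mul_nonneg (hp0 b) (hg0 b)
  have hmm : m ^ (1 - ε / 2) * m ^ (1 - ε / 2) = m ^ (2 - ε) := by
    rw [← Real.mul_rpow hm0 hm0, ← sq, ← Real.rpow_natCast, ← Real.rpow_mul hm0]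
    congr 1; push_cast; ring
  have hle : m ≤ m ^ (2 - ε) := by
    rcases hm0.eq_or_lt with h | h
    · rw [← h]; exact Real.rpow_nonneg le_rfl _
    · calc m = m ^ (1 : ℝ) := (Real.rpow_one m).symm
        _ ≤ m ^ (2 - ε) := Real.rpow_le_rpow_of_exponent_ge h hm1 (by linarith)
  -- the leverage of `a'`
  have hga := mul_gram_self_le hV hp0 hp1 a'
  set g := gram φ p a' a' with hgdef
  have hgpow : p a' * g ^ (ε / 2) ≤ m ^ (ε / 2) := by
    have e1 : p a' ≤ p a' ^ (ε / 2) := by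
      rcases (hp0 a').eq_or_lt with h | h
      · rw [← h]; exact Real.rpow_nonneg le_rfl _
      · calc p a' = p a' ^ (1 : ℝ) := (Real.rpow_one _).symm
          _ ≤ _ := Real.rpow_le_rpow_of_exponent_ge h hpa1 (by linarith)
    calc p a' * g ^ (ε / 2) ≤ p a' ^ (ε / 2) * g ^ (ε / 2) :=
          mul_le_mul_of_nonneg_right e1 (Real.rpow_nonneg (hg0 a') _)
      _ = (p a' * g) ^ (ε / 2) := (Real.mul_rpow (hp0 a') (hg0 a')).symm
      _ ≤ m ^ (ε / 2) := Real.rpow_le_rpow (mul_nonneg (hp0 a') (hg0 a')) hga (by linarith)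
  have hm2 : m ^ (1 - ε / 2) * m ^ (ε / 2) ≤ m ^ (2 - ε) := by
    refine le_trans ?_ hle
    rcases hm0.eq_or_lt with h | h
    · rw [← h, Real.zero_rpow (x := ε / 2) (by linarith)]; simp
    · rw [← Real.rpow_add h]; simp
  have hmP : 0 ≤ m ^ (2 - ε) := Real.rpow_nonneg hm0 _
  have hmH : 0 ≤ m ^ (1 - ε / 2) := Real.rpow_nonneg hm0 _
  -- the diagonal term
  have hdiag : p a' * (p a' * |g| ^ ε) ≤ m ^ (2 - ε) := by
    rw [abs_of_nonneg (hg0 a')]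
    rcases (hp0 a').eq_or_lt with h | h
    · rw [← h]; simpa using hmP
    · have hpp : p a' * p a' ≤ p a' ^ ε := by
        rw [← sq, ← Real.rpow_natCast]
        exact Real.rpow_le_rpow_of_exponent_ge h hpa1 (by push_cast; exact h2)
      calc p a' * (p a' * g ^ ε) = p a' * p a' * g ^ ε := by ring
        _ ≤ p a' ^ ε * g ^ ε := mul_le_mul_of_nonneg_right hpp (Real.rpow_nonneg (hg0 a') _)
        _ = (p a' * g) ^ ε := (Real.mul_rpow (hp0 a') (hg0 a')).symm
        _ ≤ m ^ ε := Real.rpow_le_rpow (mul_nonneg (hp0 a') (hg0 a')) hga (by linarith)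
        _ ≤ m ^ (2 - ε) := by
          rcases hm0.eq_or_lt with h | h
          · rw [← h, Real.zero_rpow (by linarith)]; exact Real.rpow_nonneg le_rfl _
          · exact Real.rpow_le_rpow_of_exponent_ge h hm1 (by linarith)
  -- The double sum splits according to which indices equal `a'`: the diagonal entry, two symmetric
  -- off-diagonal pieces and the remaining block. Each is at most `d^{ε/2} m^{2-ε}`, whence the
  -- factor `4`.
  rw [← Finset.add_sum_erase _ _ (Finset.mem_univ a')]
  have hsplit : ∀ a, ∑ b, p b * |gram φ p a b| ^ ε = p a' * |gram φ p a a'| ^ ε +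
      ∑ b ∈ Finset.univ.erase a', p b * |gram φ p a b| ^ ε := fun a =>
    (Finset.add_sum_erase _ _ (Finset.mem_univ a')).symm
  have hsym : ∀ a, |gram φ p a a'| ^ ε = |gram φ p a' a| ^ ε := fun a => by rw [gram_eq hV]; rfl
  have hoff : p a' * ∑ b ∈ Finset.univ.erase a', p b * |gram φ p a' b| ^ ε ≤ m ^ (2 - ε) := by
    have := hrow (Finset.univ.erase a') a'
    rw [hE] at this
    calc _ ≤ p a' * (m ^ (1 - ε / 2) * g ^ (ε / 2)) := mul_le_mul_of_nonneg_left this (hp0 a')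
      _ = m ^ (1 - ε / 2) * (p a' * g ^ (ε / 2)) := by ring
      _ ≤ m ^ (1 - ε / 2) * m ^ (ε / 2) := mul_le_mul_of_nonneg_left hgpow hmH
      _ ≤ _ := hm2
  have hoff2 : ∑ a ∈ Finset.univ.erase a', p a * (p a' * |gram φ p a a'| ^ ε) ≤ m ^ (2 - ε) := by
    refine le_trans (le_of_eq ?_) hoff
    rw [Finset.mul_sum]
    exact Finset.sum_congr rfl fun a _ => by rw [hsym]; ring
  have hmain : ∑ a ∈ Finset.univ.erase a', p a *
      ∑ b ∈ Finset.univ.erase a', p b * |gram φ p a b| ^ ε ≤ (d : ℝ) ^ (ε / 2) * m ^ (2 - ε) := by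
    calc _ ≤ ∑ a ∈ Finset.univ.erase a', p a * (m ^ (1 - ε / 2) * gram φ p a a ^ (ε / 2)) := by
          refine Finset.sum_le_sum fun a _ => mul_le_mul_of_nonneg_left ?_ (hp0 a)
          have := hrow (Finset.univ.erase a') a
          rwa [hE] at this
      _ = m ^ (1 - ε / 2) * ∑ a ∈ Finset.univ.erase a', p a * gram φ p a a ^ (ε / 2) := by
          rw [Finset.mul_sum]; exact Finset.sum_congr rfl fun a _ => by ring
      _ ≤ m ^ (1 - ε / 2) * (m ^ (1 - ε / 2) * (d : ℝ) ^ (ε / 2)) :=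
          mul_le_mul_of_nonneg_left hcol hmH
      _ = _ := by rw [← mul_assoc, hmm, mul_comm]
  simp only [hsplit, mul_add, Finset.sum_add_distrib]
  have hDm : m ^ (2 - ε) ≤ (d : ℝ) ^ (ε / 2) * m ^ (2 - ε) := le_mul_of_one_le_left hmP hD
  linarith

end Design

/-! ### Scalar inequalities for the Tsallis regularizer -/

/-- The Bregman divergence of `x ↦ -x ^ α / α`. -/
noncomputable def tsallisBreg (α x q : ℝ) : ℝ := (q ^ α - x ^ α) / α + q ^ (α - 1) * (x - q)

/-- Weighted AM–GM, `x^α q^{1-α} ≤ α x + (1 - α) q`, multiplied by `q^{α-1}`. -/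
lemma tsallisBreg_nonneg {α x q : ℝ} (h0 : 0 < α) (h1 : α < 1) (hx : 0 ≤ x) (hq : 0 < q) :
    0 ≤ tsallisBreg α x q := by
  have h := Real.geom_mean_le_arith_mean2_weighted h0.le (sub_nonneg.2 h1.le) hx hq.le (by ring)
  have e1 : q ^ (α - 1) * q ^ (1 - α) = 1 := by
    rw [← Real.rpow_add hq]; simp
  have e2 : q ^ (α - 1) * q = q ^ α := by
    rw [← Real.rpow_add_one hq.ne']; simp
  have h3 := mul_le_mul_of_nonneg_left h (Real.rpow_nonneg hq.le (α - 1))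
  have h4 : x ^ α ≤ α * (q ^ (α - 1) * x) + (1 - α) * q ^ α := by
    calc x ^ α = x ^ α * (q ^ (α - 1) * q ^ (1 - α)) := by rw [e1, mul_one]
      _ = q ^ (α - 1) * (x ^ α * q ^ (1 - α)) := by ring
      _ ≤ _ := h3
      _ = α * (q ^ (α - 1) * x) + (1 - α) * (q ^ (α - 1) * q) := by ring
      _ = _ := by rw [e2]
  have h5 : α * tsallisBreg α x q = q ^ α - x ^ α + α * (q ^ (α - 1) * x) - α * (q ^ (α - 1) * q) := by
    unfold tsallisBreg; field_simp; ring
  rw [e2] at h5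
  nlinarith

/-- For `α ≥ 1/2` the power `y^α` lies between `√y` and `y`, so AM–GM bounds it by `(2α - 1) y + (2
- 2α) √y`. What remains of the divergence is a perfect square in `√y`. -/
lemma tsallisBreg_lower {α x q : ℝ} (h0 : 1 / 2 ≤ α) (h1 : α < 1) (hx : 0 ≤ x) (hq : 0 < q) :
    (1 - α) * q ^ α * (Real.sqrt (x / q) - 1) ^ 2 ≤ tsallisBreg α x q := by
  have hα : 0 < α := by linarith
  set y := x / q with hy
  have hy0 : 0 ≤ y := div_nonneg hx hq.le
  have hxy : x = y * q := by rw [hy, div_mul_cancel₀ _ hq.ne']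
  set s := Real.sqrt y with hs
  have hss : s ^ 2 = y := Real.sq_sqrt hy0
  have hs0 : 0 ≤ s := Real.sqrt_nonneg y
  have hyα : y ^ α ≤ (2 * α - 1) * y + (2 - 2 * α) * s := by
    have := Real.geom_mean_le_arith_mean2_weighted (w₁ := 2 * α - 1) (w₂ := 2 - 2 * α)
      (by linarith) (by linarith) hy0 hs0 (by ring)
    refine le_trans (le_of_eq ?_) this
    rw [hs, Real.sqrt_eq_rpow, ← Real.rpow_mul hy0, ← Real.rpow_add' hy0 (by linarith)]
    congr 1; ring
  have e2 : q ^ (α - 1) * q = q ^ α := by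
    rw [← Real.rpow_add_one hq.ne']; simp
  have hqα : 0 < q ^ α := Real.rpow_pos_of_pos hq α
  have e : tsallisBreg α x q = q ^ α * ((1 - y ^ α) / α + (y - 1)) := by
    unfold tsallisBreg
    rw [hxy, Real.mul_rpow hy0 hq.le, ← e2]; ring
  rw [e, mul_comm (1 - α), mul_assoc]
  refine mul_le_mul_of_nonneg_left ?_ hqα.le
  have h2 : (1 - ((2 * α - 1) * y + (2 - 2 * α) * s)) / α ≤ (1 - y ^ α) / α := by gcongr
  have h3 : (1 - ((2 * α - 1) * y + (2 - 2 * α) * s)) / α + (y - 1) =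
      (1 - α) * (s - 1) ^ 2 / α := by
    rw [← hss]; field_simp; ring
  have h4 : (1 - α) * (s - 1) ^ 2 ≤ (1 - α) * (s - 1) ^ 2 / α := by
    rw [le_div_iff₀ hα]
    have : 0 ≤ (1 - α) * (s - 1) ^ 2 := mul_nonneg (by linarith) (sq_nonneg _)
    nlinarith
  linarith

lemma tsallisBreg_pos {α x q : ℝ} (h0 : 1 / 2 ≤ α) (h1 : α < 1) (hx : 0 ≤ x) (hq : 0 < q)
    (hne : x ≠ q) : 0 < tsallisBreg α x q := by
  refine lt_of_lt_of_le ?_ (tsallisBreg_lower h0 h1 hx hq)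
  have h : Real.sqrt (x / q) - 1 ≠ 0 := fun h => hne <| by
    rw [sub_eq_zero, Real.sqrt_eq_one] at h
    exact (div_eq_one_iff_eq hq.ne').1 h
  have := Real.rpow_pos_of_pos hq α
  have h2 : 0 < 1 - α := by linarith
  positivity

/-- Stability of one coordinate of the regularized leader. -/
lemma coord_stability {α β x q G : ℝ} (h0 : 1 / 2 ≤ α) (h1 : α < 1) (hβ : 0 < β) (hx : 0 ≤ x)
    (hq : 0 < q) (hG : |G| ≤ (1 - α) * β * q ^ (α - 1) / 2) :
    G * (q - x) ≤ β * tsallisBreg α x q + 2 * (q ^ (2 - α) * G ^ 2) / (β * (1 - α)) := by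
  have hη : 0 < 1 - α := by linarith
  set c := (1 - α) * β * q ^ (α - 1) with hc
  have hqm : 0 < q ^ (α - 1) := Real.rpow_pos_of_pos hq _
  have hcpos : 0 < c := by positivity
  set τ := G / c with hτ
  have hGτ : G = c * τ := by rw [hτ, mul_div_cancel₀ _ hcpos.ne']
  have hτ1 : |τ| ≤ 1 / 2 := by
    rw [hτ, abs_div, abs_of_pos hcpos, div_le_iff₀ hcpos]; linarith
  set s := Real.sqrt (x / q)
  have hss : s ^ 2 = x / q := Real.sq_sqrt (div_nonneg hx hq.le)
  have hxs : x = s ^ 2 * q := by rw [hss, div_mul_cancel₀ _ hq.ne']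
  have e2 : q ^ (α - 1) * q = q ^ α := by
    rw [← Real.rpow_add_one hq.ne']; simp
  have e3 : q ^ (2 - α) * q ^ (α - 1) = q := by
    rw [← Real.rpow_add hq]; ring_nf; simp
  have hlow := mul_le_mul_of_nonneg_left (tsallisBreg_lower h0 h1 hx hq) hβ.le
  have hlast : 2 * (q ^ (2 - α) * G ^ 2) / (β * (1 - α)) = c * q * (2 * τ ^ 2) := by
    rw [hGτ]
    have : q ^ (2 - α) * (c * τ) ^ 2 = (q ^ (2 - α) * q ^ (α - 1)) * ((1 - α) * β) * c * τ ^ 2 := by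
      rw [hc]; ring
    rw [this, e3]; field_simp
  have hfirst : G * (q - x) = c * q * (τ * (1 - s ^ 2)) := by
    rw [hGτ]; linear_combination (-(c * τ)) * hxs
  have hmid : β * ((1 - α) * q ^ α * (s - 1) ^ 2) = c * q * (s - 1) ^ 2 := by
    rw [hc, ← e2]; ring
  rw [hmid] at hlow
  rw [hlast, hfirst]
  -- Here `1 - s² = -(s - 1)² - 2 (s - 1)`. Half of the square pays for the first term since `τ ≥
  -- -1/2`, the other half completes the square for the second.
  have hkey : τ * (1 - s ^ 2) ≤ (s - 1) ^ 2 + 2 * τ ^ 2 := by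
    have := (abs_le.1 hτ1).1
    nlinarith [sq_nonneg (s - 1 + 2 * τ), sq_nonneg (s - 1),
      mul_nonneg (sq_nonneg (s - 1)) (show 0 ≤ τ + 1 / 2 by linarith)]
  have := mul_le_mul_of_nonneg_left hkey (mul_pos hcpos hq).le
  linarith

/-- The function `x^α - x` is concave and vanishes at `0` and `1`; this compares the slopes of its
chords from `0`. -/
lemma rpow_sub_self_le_of_ge {α x q : ℝ} (h1 : α < 1) (hq : 0 < q) (hqx : q ≤ x) :
    q * (x ^ α - x) ≤ x * (q ^ α - q) := by
  have hx : 0 < x := hq.trans_le hqx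
  have e1 : x ^ α = x * x ^ (α - 1) := by rw [mul_comm, ← Real.rpow_add_one hx.ne']; simp
  have e2 : q ^ α = q * q ^ (α - 1) := by rw [mul_comm, ← Real.rpow_add_one hq.ne']; simp
  have h : x ^ (α - 1) ≤ q ^ (α - 1) := Real.rpow_le_rpow_of_nonpos hq hqx (by linarith)
  rw [e1, e2]
  nlinarith [mul_le_mul_of_nonneg_left h (mul_pos hx hq).le]

/-- The mirror image: slopes of chords to `1`. It combines the tangent at `q`, evaluated at `x` and
at `1`. -/
lemma rpow_sub_self_le_of_le {α x q : ℝ} (h0 : 0 < α) (h1 : α < 1) (hx : 0 ≤ x) (hq : 0 < q)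
    (hxq : x ≤ q) (hq1 : q ≤ 1) : (1 - q) * (x ^ α - x) ≤ (1 - x) * (q ^ α - q) := by
  have b1 := tsallisBreg_nonneg h0 h1 hx hq
  have b2 := tsallisBreg_nonneg h0 h1 zero_le_one hq
  unfold tsallisBreg at b1 b2
  rw [Real.one_rpow] at b2
  set m := q ^ (α - 1)
  have b1' : x ^ α ≤ q ^ α + α * (m * (x - q)) := by
    have : 0 ≤ α * ((q ^ α - x ^ α) / α + m * (x - q)) := mul_nonneg h0.le b1
    rw [mul_add, mul_div_cancel₀ _ h0.ne'] at this; linarith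
  have b2' : 1 ≤ q ^ α + α * (m * (1 - q)) := by
    have : 0 ≤ α * ((q ^ α - 1) / α + m * (1 - q)) := mul_nonneg h0.le b2
    rw [mul_add, mul_div_cancel₀ _ h0.ne'] at this; linarith
  nlinarith [mul_le_mul_of_nonneg_left b1' (sub_nonneg.2 hq1),
    mul_le_mul_of_nonneg_left b2' (sub_nonneg.2 hxq)]

lemma rpow_sub_self_nonneg {α q : ℝ} (h1 : α < 1) (hq : 0 ≤ q) (h0 : 0 < α) (hq1 : q ≤ 1) :
    0 ≤ q ^ α - q := by
  rcases hq.eq_or_lt with h | h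
  · rw [← h, Real.zero_rpow h0.ne']; simp
  · have := Real.rpow_le_rpow_of_exponent_ge h hq1 h1.le
    rw [Real.rpow_one] at this; linarith

/-- A coordinate's entropy at most doubles when both its probability and the complementary
probability at most double. -/
lemma rpow_sub_self_le_two_mul {α x q : ℝ} (h0 : 0 < α) (h1 : α < 1) (hx : 0 ≤ x) (hq : 0 < q)
    (hq1 : q < 1) (hxq : x ≤ 2 * q) (hxq' : 1 - x ≤ 2 * (1 - q)) :
    x ^ α - x ≤ 2 * (q ^ α - q) := by
  have hk := rpow_sub_self_nonneg h1 hq.le h0 hq1.le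
  rcases le_total q x with h | h
  · have := rpow_sub_self_le_of_ge h1 hq h
    refine le_of_mul_le_mul_left (this.trans ?_) hq
    nlinarith
  · have := rpow_sub_self_le_of_le h0 h1 hx hq h hq1.le
    refine le_of_mul_le_mul_left (this.trans ?_) (sub_pos.2 hq1)
    nlinarith

/-- Bernoulli's inequality. It converts the doubling of a probability into a relative drop of `η /
2` in the gradient of the regularizer. -/
lemma half_rpow_le {η : ℝ} (h0 : 0 ≤ η) (h1 : η ≤ 1) : (1 / 2 : ℝ) ^ η ≤ 1 - η / 2 := by
  have := _root_.rpow_one_add_le_one_add_mul_self (s := -(1 / 2)) (by norm_num) h0 h1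
  norm_num at this
  norm_num
  linarith

/-! ### The regularized leader -/

namespace Params

variable {K d : ℕ} {P : Params K d} {c₁ c₂ : ℝ} {T : ℕ}

lemma continuous_tsallis {α : ℝ} (h : 0 < α) : Continuous (tsallis α : (Fin K → ℝ) → ℝ) := by
  unfold tsallis
  refine continuous_const.mul (continuous_finsetSum _ fun a _ => ?_)
  exact ((continuous_apply a).rpow_const fun _ => Or.inr h.le).sub (continuous_apply a)

section Basic

variable (hP : P.Admissible c₁ c₂ T)
include hP

lemma Admissible.neZero : NeZero K := ⟨by have := hP.two_le_K; omega⟩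

lemma Admissible.η_pos : 0 < 1 - P.α := sub_pos.2 hP.α_lt_one

lemma Admissible.η_le : 1 - P.α ≤ 1 / 2 := by linarith [hP.half_le_α]

lemma Admissible.α_pos : 0 < P.α := by linarith [hP.half_le_α]

lemma Admissible.αbar_pos : 0 < P.αbar := mul_pos (sub_pos.2 hP.one_lt_ε) hP.η_pos

lemma Admissible.αbar_le : P.αbar ≤ 1 / 2 := by
  unfold αbar
  nlinarith [hP.η_le, hP.η_pos, hP.one_lt_ε, hP.ε_le_two]

lemma Admissible.d_pos : (1 : ℝ) ≤ d := by exact_mod_cast hP.one_le_d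

lemma Admissible.βbar_pos : 0 < P.βbar := by
  refine lt_of_lt_of_le ?_ hP.βbar_ge
  have h1 := hP.η_pos
  have h2 : (0 : ℝ) < d := by linarith [hP.d_pos]
  have h3 : 0 < max (P.σ ^ (3 / P.ε)) P.σ := lt_max_of_lt_right hP.σ_pos
  have h4 := Real.rpow_pos_of_pos hP.β₁_pos (1 - P.ε)
  have h5 := Real.rpow_pos_of_pos h2 P.ε
  positivity

lemma continuous_objective :
    Continuous (fun x : State K × (Fin K → ℝ) => P.objective x.1 x.2) := by
  unfold objective
  have h1 := continuous_tsallis (K := K) hP.α_pos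
  have h2 := continuous_tsallis (K := K) hP.αbar_pos
  have h3 : Continuous fun x : State K × (Fin K → ℝ) => x.1.1 ⬝ᵥ x.2 := by
    unfold dotProduct; fun_prop
  have h4 := h1.comp (continuous_snd (X := State K))
  have h5 := h2.comp (continuous_snd (X := State K))
  exact (h3.add ((continuous_snd.comp continuous_fst).mul h4)).add (continuous_const.mul h5)

lemma q_spec (S : State K) :
    P.q S ∈ stdSimplex ℝ (Fin K) ∧ IsMinOn (P.objective S) (stdSimplex ℝ (Fin K)) (P.q S) := by
  have := hP.neZero
  have hc : Continuous (P.objective S) :=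
    (continuous_objective hP).comp (continuous_const.prodMk continuous_id)
  obtain ⟨x, hx, hmin⟩ := (isCompact_stdSimplex ℝ (Fin K)).exists_isMinOn
    ⟨_, single_mem_stdSimplex ℝ (0 : Fin K)⟩ hc.continuousOn
  exact Classical.epsilon_spec (p := fun x => x ∈ stdSimplex ℝ (Fin K) ∧
    IsMinOn (P.objective S) (stdSimplex ℝ (Fin K)) x) ⟨x, hx, hmin⟩

end Basic

/-- One summand of the objective. -/
noncomputable def coordObj (P : Params K d) (S : State K) (a : Fin K) (x : ℝ) : ℝ :=
  S.1 a * x + S.2 * (-(1 / P.α) * (x ^ P.α - x)) + P.βbar * (-(1 / P.αbar) * (x ^ P.αbar - x))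

/-- The derivative of one summand of the objective. -/
noncomputable def coordGrad (P : Params K d) (S : State K) (a : Fin K) (x : ℝ) : ℝ :=
  S.1 a - S.2 * (x ^ (P.α - 1) - 1 / P.α) - P.βbar * (x ^ (P.αbar - 1) - 1 / P.αbar)

lemma objective_eq_sum (S : State K) (x : Fin K → ℝ) :
    P.objective S x = ∑ a, P.coordObj S a (x a) := by
  simp only [objective, coordObj, tsallis, dotProduct, Finset.sum_add_distrib, ← Finset.mul_sum]

lemma shift_mem {q : Fin K → ℝ} (hq : q ∈ stdSimplex ℝ (Fin K)) {a b : Fin K} (hab : a ≠ b) {t : ℝ}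
    (h1 : 0 ≤ q a + t) (h2 : 0 ≤ q b - t) :
    q + t • (Pi.single a 1 - Pi.single b 1) ∈ stdSimplex ℝ (Fin K) := by
  refine ⟨fun c => ?_, ?_⟩
  · rcases eq_or_ne c a with rfl | hca
    · simpa [hab] using h1
    · rcases eq_or_ne c b with rfl | hcb
      · simpa [hca, sub_eq_add_neg] using h2
      · simpa [hca, hcb] using hq.1 c
  · simp [Finset.sum_add_distrib, ← Finset.mul_sum, hq.2]

lemma objective_shift (S : State K) (q : Fin K → ℝ) {a b : Fin K} (hab : a ≠ b) (t : ℝ) :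
    P.objective S (q + t • (Pi.single a 1 - Pi.single b 1)) - P.objective S q =
      (P.coordObj S a (q a + t) - P.coordObj S a (q a)) +
      (P.coordObj S b (q b - t) - P.coordObj S b (q b)) := by
  rw [objective_eq_sum, objective_eq_sum, ← Finset.sum_sub_distrib]
  rw [Finset.sum_eq_add_of_mem a b (Finset.mem_univ _) (Finset.mem_univ _) hab]
  · simp [hab, hab.symm, sub_eq_add_neg]
  · intro c _ hc
    simp [hc.1, hc.2]

section Foc

variable (hP : P.Admissible c₁ c₂ T)
include hP

/-- Affine terms have no Bregman divergence, so the remainder consists of the divergences of the two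
powers. -/
lemma coordObj_sub (S : State K) (a : Fin K) (x q : ℝ) :
    P.coordObj S a x - P.coordObj S a q = P.coordGrad S a q * (x - q) +
      (S.2 * tsallisBreg P.α x q + P.βbar * tsallisBreg P.αbar x q) := by
  have := hP.α_pos.ne'
  have := hP.αbar_pos.ne'
  unfold coordObj coordGrad tsallisBreg
  ring

lemma coordGrad_le_coordObj_sub {S : State K} (hS : 0 < S.2) (a : Fin K) {x q : ℝ} (hx : 0 ≤ x)
    (hq : 0 < q) : P.coordGrad S a q * (x - q) ≤ P.coordObj S a x - P.coordObj S a q := by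
  rw [coordObj_sub hP]
  have h1 := mul_nonneg hS.le (tsallisBreg_nonneg hP.α_pos hP.α_lt_one hx hq)
  have h2 := mul_nonneg hP.βbar_pos.le
    (tsallisBreg_nonneg hP.αbar_pos (by linarith [hP.αbar_le]) hx hq)
  linarith

lemma hasDerivAt_coordObj (S : State K) (a : Fin K) {x : ℝ} (hx : 0 < x) :
    HasDerivAt (P.coordObj S a) (P.coordGrad S a x) x := by
  have h1 := (Real.hasDerivAt_rpow_const (p := P.α) (Or.inl hx.ne'))
  have h2 := (Real.hasDerivAt_rpow_const (p := P.αbar) (Or.inl hx.ne'))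
  have := hP.α_pos.ne'
  have := hP.αbar_pos.ne'
  have h := (((hasDerivAt_id x).const_mul (S.1 a)).add
    (((h1.sub (hasDerivAt_id x)).const_mul (-(1 / P.α))).const_mul S.2)).add
    (((h2.sub (hasDerivAt_id x)).const_mul (-(1 / P.αbar))).const_mul P.βbar)
  refine h.congr_deriv ?_
  unfold coordGrad
  field_simp
  ring

/-- The slope of the regularizer is `-∞` at zero, so moving a little mass to an arm of probability
zero would decrease the objective. -/
lemma q_pos {S : State K} (hS : 0 < S.2) (a : Fin K) : 0 < P.q S a := by
  obtain ⟨hq, hmin⟩ := q_spec hP S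
  set q := P.q S
  by_contra hneg
  have hqa : q a = 0 := le_antisymm (not_lt.1 hneg) (hq.1 a)
  obtain ⟨b, hb⟩ : ∃ b, 0 < q b := by
    by_contra! h
    have : ∑ c, q c ≤ 0 := Finset.sum_nonpos fun c _ => h c
    linarith [hq.2]
  have hab : a ≠ b := fun h => by rw [← h, hqa] at hb; exact lt_irrefl _ hb
  -- the directional slope is nonnegative
  have key : ∀ t ∈ Ioo 0 (q b / 2), P.coordGrad S b (q b / 2) ≤ P.coordGrad S a t := by
    rintro t ⟨ht0, ht1⟩
    have hm := hmin (shift_mem hq hab (t := t) (by linarith) (by linarith))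
    have hd := objective_shift (P := P) S q hab t
    have hm' : P.objective S q ≤ P.objective S (q + t • (Pi.single a 1 - Pi.single b 1)) := hm
    rw [hqa, zero_add] at hd
    have e1 := coordGrad_le_coordObj_sub hP hS a le_rfl ht0
    have e2 := coordGrad_le_coordObj_sub hP hS b hb.le (show 0 < q b - t by linarith)
    have e3 : 0 ≤ t * (P.coordGrad S a t - P.coordGrad S b (q b - t)) := by linarith
    have e4 := nonneg_of_mul_nonneg_right e3 ht0
    have e5 : P.coordGrad S b (q b / 2) ≤ P.coordGrad S b (q b - t) := by
      unfold coordGrad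
      have f1 : (q b - t) ^ (P.α - 1) ≤ (q b / 2) ^ (P.α - 1) :=
        Real.rpow_le_rpow_of_nonpos (by linarith) (by linarith) (by linarith [hP.α_lt_one])
      have f2 : (q b - t) ^ (P.αbar - 1) ≤ (q b / 2) ^ (P.αbar - 1) :=
        Real.rpow_le_rpow_of_nonpos (by linarith) (by linarith) (by linarith [hP.αbar_le])
      have := mul_le_mul_of_nonneg_left f1 hS.le
      have := mul_le_mul_of_nonneg_left f2 hP.βbar_pos.le
      linarith
    linarith
  have hlim := tendsto_rpow_neg_nhdsGT_zero (y := P.α - 1) (by linarith [hP.α_lt_one])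
  set M := (S.1 a + S.2 * (1 / P.α) + P.βbar * (1 / P.αbar) - P.coordGrad S b (q b / 2)) / S.2
  obtain ⟨t, ht, htm⟩ := ((hlim.eventually (Filter.eventually_gt_atTop M)).and
    (Filter.eventually_of_mem (Ioo_mem_nhdsGT (half_pos hb)) fun _ h => h)).exists
  have hk := key t htm
  have h1 : 0 ≤ P.βbar * t ^ (P.αbar - 1) :=
    mul_nonneg hP.βbar_pos.le (Real.rpow_nonneg htm.1.le _)
  rw [div_lt_iff₀ hS] at ht
  unfold coordGrad at hk ht
  linarith

/-- Since the leader is interior, mass can be exchanged between two arms in either direction; the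
common value is the Lagrange multiplier of the simplex. -/
lemma coordGrad_eq {S : State K} (hS : 0 < S.2) (a b : Fin K) :
    P.coordGrad S a (P.q S a) = P.coordGrad S b (P.q S b) := by
  rcases eq_or_ne a b with rfl | hab
  · rfl
  obtain ⟨hq, hmin⟩ := q_spec hP S
  have hqa := q_pos hP hS a
  have hqb := q_pos hP hS b
  set q := P.q S
  let f : ℝ → ℝ := fun t => P.coordObj S a (q a + t) + P.coordObj S b (q b - t)
  have hf : HasDerivAt f (P.coordGrad S a (q a) - P.coordGrad S b (q b)) 0 := by
    have h1 : HasDerivAt (fun t => P.coordObj S a (q a + t)) (P.coordGrad S a (q a)) 0 := by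
      have h := hasDerivAt_coordObj hP S a (x := q a + 0) (by simpa using hqa)
      simpa using h.comp_const_add (q a) 0
    have h2 : HasDerivAt (fun t => P.coordObj S b (q b - t)) (-P.coordGrad S b (q b)) 0 := by
      have h := hasDerivAt_coordObj hP S b (x := q b - 0) (by simpa using hqb)
      simpa using h.comp_const_sub (q b) 0
    exact (h1.add h2).congr_deriv (sub_eq_add_neg _ _).symm
  have hloc : IsLocalMin f 0 := by
    have hmem : Ioo (-q a) (q b) ∈ nhds (0 : ℝ) := Ioo_mem_nhds (by linarith) hqb
    refine Filter.eventually_of_mem hmem fun t ht => ?_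
    have hm : P.objective S q ≤ P.objective S (q + t • (Pi.single a 1 - Pi.single b 1)) :=
      hmin (shift_mem hq hab (by linarith [ht.1]) (by linarith [ht.2]))
    have hd := objective_shift (P := P) S q hab t
    simp only [f, add_zero, sub_zero]
    linarith
  linarith [hloc.hasDerivAt_eq_zero hf]

/-- The first-order term is the common gradient times `∑ (x a - q a) = 0`. -/
lemma objective_sub_q {S : State K} (hS : 0 < S.2) {x : Fin K → ℝ}
    (hx : x ∈ stdSimplex ℝ (Fin K)) : P.objective S x - P.objective S (P.q S) =
      ∑ a, (S.2 * tsallisBreg P.α (x a) (P.q S a) +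
        P.βbar * tsallisBreg P.αbar (x a) (P.q S a)) := by
  have := hP.neZero
  rw [objective_eq_sum, objective_eq_sum, ← Finset.sum_sub_distrib]
  simp only [coordObj_sub hP, coordGrad_eq hP hS _ (0 : Fin K), Finset.sum_add_distrib,
    ← Finset.mul_sum, Finset.sum_sub_distrib, hx.2, (q_spec hP S).1.2]
  ring

/-- Uniqueness, from strict positivity of the divergence. It is needed because the leader is defined
by choice. -/
lemma eq_q_of_isMinOn {S : State K} (hS : 0 < S.2) {x : Fin K → ℝ}
    (hx : x ∈ stdSimplex ℝ (Fin K)) (hle : P.objective S x ≤ P.objective S (P.q S)) :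
    x = P.q S := by
  have h := objective_sub_q hP hS hx
  have hb : ∀ a, 0 ≤ P.βbar * tsallisBreg P.αbar (x a) (P.q S a) := fun a =>
    mul_nonneg hP.βbar_pos.le (tsallisBreg_nonneg hP.αbar_pos (by linarith [hP.αbar_le]) (hx.1 a)
      (q_pos hP hS a))
  have hα : ∀ a, 0 ≤ S.2 * tsallisBreg P.α (x a) (P.q S a) := fun a =>
    mul_nonneg hS.le (tsallisBreg_nonneg hP.α_pos hP.α_lt_one (hx.1 a) (q_pos hP hS a))
  have hz := (Finset.sum_eq_zero_iff_of_nonneg fun a _ => add_nonneg (hα a) (hb a)).1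
    (le_antisymm (by linarith) (Finset.sum_nonneg fun a _ => add_nonneg (hα a) (hb a)))
  funext a
  by_contra hne
  have := mul_pos hS (tsallisBreg_pos hP.half_le_α hP.α_lt_one (hx.1 a) (q_pos hP hS a) hne)
  linarith [hz a (Finset.mem_univ a), hb a]

/-- On the compact simplex, every cluster point of the leaders of nearby states minimizes the
limiting objective, hence is its unique leader. The measurability of the algorithm rests on this. -/
lemma continuousAt_q {S : State K} (hS : 0 < S.2) : ContinuousAt P.q S := by
  refine (isCompact_stdSimplex ℝ (Fin K)).tendsto_nhds_of_unique_mapClusterPt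
    (Filter.Eventually.of_forall fun S' => (q_spec hP S').1) fun x hx hcl => ?_
  refine eq_q_of_isMinOn hP hS hx ?_
  obtain ⟨U, hU, hlim⟩ := mapClusterPt_iff_ultrafilter.1 hcl
  have hid : Filter.Tendsto (fun S' : State K => S') (U : Filter (State K)) (nhds S) :=
    Filter.tendsto_id'.2 hU
  have hp1 := hid.prodMk_nhds hlim
  have hp2 := hid.prodMk_nhds (tendsto_const_nhds (x := P.q S))
  have h1 := ((continuous_objective hP).tendsto (S, x)).comp hp1
  have h2 := ((continuous_objective hP).tendsto (S, P.q S)).comp hp2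
  exact le_of_tendsto_of_tendsto' h1 h2 fun S' => (q_spec hP S').2 (q_spec hP S).1

end Foc

end Params

/-! ### The modified sup norm `qStar` -/

section QStar

variable {K : ℕ} {q : Fin K → ℝ}

lemma apply_le_norm (q : Fin K → ℝ) (a : Fin K) : q a ≤ ‖q‖ :=
  (le_abs_self _).trans (norm_le_pi_norm q a)

lemma exists_apply_eq_norm [NeZero K] (hq : q ∈ stdSimplex ℝ (Fin K)) : ∃ a, q a = ‖q‖ := by
  obtain ⟨a, -, ha⟩ := Finset.exists_max_image Finset.univ q ⟨0, Finset.mem_univ _⟩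
  refine ⟨a, le_antisymm (apply_le_norm q a) ?_⟩
  refine (pi_norm_le_iff_of_nonneg (hq.1 a)).2 fun b => ?_
  rw [Real.norm_eq_abs, abs_of_nonneg (hq.1 b)]
  exact ha b (Finset.mem_univ b)

lemma apply_le_one (hq : q ∈ stdSimplex ℝ (Fin K)) (a : Fin K) : q a ≤ 1 := by
  rw [← hq.2]; exact Finset.single_le_sum (fun b _ => hq.1 b) (Finset.mem_univ a)

lemma norm_le_one [NeZero K] (hq : q ∈ stdSimplex ℝ (Fin K)) : ‖q‖ ≤ 1 := by
  obtain ⟨a, ha⟩ := exists_apply_eq_norm hq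
  rw [← ha]; exact apply_le_one hq a

lemma add_le_one (hq : q ∈ stdSimplex ℝ (Fin K)) {a b : Fin K} (hab : a ≠ b) : q a + q b ≤ 1 := by
  rw [← hq.2, ← Finset.sum_pair hab]
  exact Finset.sum_le_sum_of_subset_of_nonneg (Finset.subset_univ _) fun c _ _ => hq.1 c

lemma apply_lt_one (hK : 2 ≤ K) (hq : q ∈ stdSimplex ℝ (Fin K)) (hpos : ∀ a, 0 < q a) (a : Fin K) :
    q a < 1 := by
  have : Nontrivial (Fin K) := Fin.nontrivial_iff_two_le.2 hK
  obtain ⟨b, hb⟩ := exists_ne a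
  linarith [add_le_one hq hb, hpos b]

lemma qStar_le_half : qStar q ≤ 1 / 2 := by
  unfold qStar
  rcases le_total ‖q‖ (1 / 2) with h | h
  · exact (min_le_left _ _).trans h
  · exact (min_le_right _ _).trans (by linarith)

lemma qStar_pos (hK : 2 ≤ K) (hq : q ∈ stdSimplex ℝ (Fin K)) (hpos : ∀ a, 0 < q a) :
    0 < qStar q := by
  have : NeZero K := ⟨by omega⟩
  obtain ⟨a, ha⟩ := exists_apply_eq_norm hq
  exact lt_min (ha ▸ hpos a) (by rw [← ha, sub_pos]; exact apply_lt_one hK hq hpos a)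

/-- Either every coordinate is at most `qStar q`, or there is a dominating coordinate. -/
lemma qStar_cases (hK : 2 ≤ K) (hq : q ∈ stdSimplex ℝ (Fin K)) :
    (qStar q = ‖q‖ ∧ ‖q‖ ≤ 1 / 2) ∨
      ∃ a', 1 / 2 < q a' ∧ qStar q = 1 - q a' ∧ ∀ a, a ≠ a' → q a ≤ qStar q := by
  have : NeZero K := ⟨by omega⟩
  obtain ⟨a', ha'⟩ := exists_apply_eq_norm hq
  rcases le_or_gt ‖q‖ (1 / 2) with h | h
  · exact Or.inl ⟨min_eq_left (by linarith), h⟩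
  · refine Or.inr ⟨a', ha' ▸ h, ?_, fun a ha => ?_⟩
    · rw [ha']; exact min_eq_right (by linarith)
    · rw [qStar, min_eq_right (by linarith), ← ha']
      linarith [add_le_one hq ha]

lemma tsallis_neg_eq (α : ℝ) (q : Fin K → ℝ) :
    -tsallis α q = (1 / α) * ∑ a, (q a ^ α - q a) := by
  unfold tsallis; ring

lemma entropy_nonneg {α : ℝ} (h0 : 0 < α) (h1 : α < 1) (hq : q ∈ stdSimplex ℝ (Fin K)) :
    0 ≤ -tsallis α q := by
  rw [tsallis_neg_eq]
  exact mul_nonneg (by positivity) (Finset.sum_nonneg fun a _ =>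
    rpow_sub_self_nonneg h1 (hq.1 a) h0 (apply_le_one hq a))

/-- The entropy is at least `m^α - m`. Without a dominating arm the largest coordinate shows this;
otherwise the other arms carry total mass `m` in pieces of size at most `m`, and `x^{α-1}` is
decreasing. Then `m ≤ 1/2` turns `m^α - m` into a multiple of `m^α`. -/
lemma qStar_rpow_le_entropy {α : ℝ} (hK : 2 ≤ K) (h0 : 0 < α) (h1 : α < 1)
    (hq : q ∈ stdSimplex ℝ (Fin K)) (hpos : ∀ a, 0 < q a) :
    (1 - α) / 2 * qStar q ^ α ≤ -tsallis α q := by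
  have : NeZero K := ⟨by omega⟩
  set m := qStar q with hm
  have hm0 : 0 < m := qStar_pos hK hq hpos
  have hk : ∀ a, 0 ≤ q a ^ α - q a := fun a =>
    rpow_sub_self_nonneg h1 (hq.1 a) h0 (apply_le_one hq a)
  have hmul : ∀ x : ℝ, 0 < x → x ^ α = x * x ^ (α - 1) := fun x hx => by
    rw [mul_comm, ← Real.rpow_add_one hx.ne']; simp
  have hsum : m ^ α - m ≤ ∑ a, (q a ^ α - q a) := by
    rcases qStar_cases hK hq with ⟨h, -⟩ | ⟨a', -, h, hle⟩
    · obtain ⟨a, ha⟩ := exists_apply_eq_norm hq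
      rw [hm, h, ← ha]
      exact Finset.single_le_sum (f := fun a => q a ^ α - q a) (fun b _ => hk b) (Finset.mem_univ a)
    · rw [← Finset.add_sum_erase _ _ (Finset.mem_univ a')]
      have hs : ∑ a ∈ Finset.univ.erase a', q a = m := by
        have := hq.2
        rw [← Finset.add_sum_erase _ _ (Finset.mem_univ a')] at this
        linarith
      have : m ^ α - m ≤ ∑ a ∈ Finset.univ.erase a', (q a ^ α - q a) := by
        have e : m ^ α - m = ∑ a ∈ Finset.univ.erase a', (q a * m ^ (α - 1) - q a) := by
          rw [Finset.sum_sub_distrib, ← Finset.sum_mul, hs, ← hmul m hm0]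
        rw [e]
        refine Finset.sum_le_sum fun a ha => sub_le_sub_right ?_ _
        rw [hmul _ (hpos a)]
        exact mul_le_mul_of_nonneg_left (Real.rpow_le_rpow_of_nonpos (hpos a)
          (hle a (Finset.ne_of_mem_erase ha)) (by linarith)) (hpos a).le
      linarith [hk a']
  have h3 : m ^ (1 - α) ≤ 1 - (1 - α) / 2 :=
    (Real.rpow_le_rpow hm0.le qStar_le_half (by linarith)).trans
      (half_rpow_le (by linarith) (by linarith))
  have h4 : m = m ^ α * m ^ (1 - α) := by rw [← Real.rpow_add hm0]; simp
  have h5 : 0 < m ^ α := Real.rpow_pos_of_pos hm0 _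
  have h6 : (1 - α) / 2 * m ^ α ≤ m ^ α - m := by
    nth_rewrite 3 [h4]; nlinarith
  rw [tsallis_neg_eq]
  calc _ ≤ ∑ a, (q a ^ α - q a) := h6.trans hsum
    _ = 1 * ∑ a, (q a ^ α - q a) := (one_mul _).symm
    _ ≤ _ := mul_le_mul_of_nonneg_right (by rw [le_div_iff₀ h0]; linarith)
      (Finset.sum_nonneg fun a _ => hk a)

/-- Only the small coordinates need control. A dominating coordinate exceeds `1/2` and so cannot
more than double, and its complement is the sum of the small ones. -/
lemma entropy_le_two_mul {α : ℝ} (hK : 2 ≤ K) (h0 : 0 < α) (h1 : α < 1)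
    (hq : q ∈ stdSimplex ℝ (Fin K)) (hpos : ∀ a, 0 < q a) {q' : Fin K → ℝ}
    (hq' : q' ∈ stdSimplex ℝ (Fin K)) (hle : ∀ a, q a ≤ qStar q → q' a ≤ 2 * q a) :
    -tsallis α q' ≤ 2 * -tsallis α q := by
  rw [tsallis_neg_eq, tsallis_neg_eq, mul_left_comm]
  refine mul_le_mul_of_nonneg_left ?_ (by positivity)
  rw [Finset.mul_sum]
  have hlt := apply_lt_one hK hq hpos
  have hdom : ∀ a, q' a ≤ 2 * q a ∧ 1 - q' a ≤ 2 * (1 - q a) := by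
    rcases qStar_cases hK hq with ⟨h, hh⟩ | ⟨a', hbig, h, hsm⟩
    · intro a
      have h3 := apply_le_norm q a
      exact ⟨hle a (h ▸ h3), by linarith [hq'.1 a]⟩
    · intro a
      rcases eq_or_ne a a' with rfl | hne
      · refine ⟨by linarith [apply_le_one hq' a], ?_⟩
        have e1 := hq.2
        have e2 := hq'.2
        rw [← Finset.add_sum_erase _ _ (Finset.mem_univ a)] at e1 e2
        have : ∑ b ∈ Finset.univ.erase a, q' b ≤ ∑ b ∈ Finset.univ.erase a, 2 * q b :=
          Finset.sum_le_sum fun b hb => hle b (hsm b (Finset.ne_of_mem_erase hb))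
        rw [← Finset.mul_sum] at this
        linarith
      · have h3 := hsm a hne
        have h4 : qStar q ≤ 1 / 2 := qStar_le_half
        exact ⟨hle a h3, by linarith [hq'.1 a]⟩
  exact Finset.sum_le_sum fun a _ => rpow_sub_self_le_two_mul h0 h1 (hq'.1 a) (hpos a) (hlt a)
    (hdom a).1 (hdom a).2

/-- Shifting the losses by the loss of the dominating arm. -/
lemma exists_shift {η s : ℝ} (hη : 0 ≤ η) (hK : 2 ≤ K)
    (hq : q ∈ stdSimplex ℝ (Fin K)) (hpos : ∀ a, 0 < q a) {g : Fin K → ℝ}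
    (hg : ∀ a, |g a| ≤ s * qStar q ^ (-η)) :
    ∃ c, (∀ a, |g a - c| ≤ 2 * s * q a ^ (-η)) ∧
      ∑ a, q a ^ (1 + η) * (g a - c) ^ 2 ≤ 2 * (qStar q ^ η * ∑ a, q a * g a ^ 2) := by
  have : NeZero K := ⟨by omega⟩
  set m := qStar q with hm
  have hm0 : 0 < m := qStar_pos hK hq hpos
  have hmη : 0 < m ^ (-η) := Real.rpow_pos_of_pos hm0 _
  have hs : 0 ≤ s := by
    by_contra! h
    have := (abs_nonneg _).trans (hg 0)
    nlinarith
  have hneg : ∀ a, q a ≤ m → m ^ (-η) ≤ q a ^ (-η) := fun a ha =>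
    Real.rpow_le_rpow_of_nonpos (hpos a) ha (by linarith)
  have hqη : ∀ a, q a ≤ m → q a ^ (1 + η) ≤ m ^ η * q a := fun a ha => by
    rw [Real.rpow_add (hpos a), Real.rpow_one, mul_comm]
    exact mul_le_mul_of_nonneg_right (Real.rpow_le_rpow (hpos a).le ha hη) (hpos a).le
  rcases qStar_cases hK hq with ⟨h, -⟩ | ⟨a', hbig, h, hsm⟩
  · have hall : ∀ a, q a ≤ m := fun a => by rw [hm, h]; exact apply_le_norm q a
    refine ⟨0, fun a => ?_, ?_⟩
    · rw [sub_zero]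
      have h3 := mul_le_mul_of_nonneg_left (hneg a (hall a)) hs
      have h4 := mul_nonneg hs (Real.rpow_nonneg (hpos a).le (-η))
      linarith [hg a]
    · simp only [sub_zero]
      have hnn : 0 ≤ m ^ η * ∑ a, q a * g a ^ 2 := mul_nonneg (Real.rpow_nonneg hm0.le _)
        (Finset.sum_nonneg fun a _ => mul_nonneg (hpos a).le (sq_nonneg _))
      refine le_trans ?_ (by linarith : m ^ η * ∑ a, q a * g a ^ 2 ≤ _)
      rw [Finset.mul_sum]
      refine Finset.sum_le_sum fun a _ => ?_
      rw [← mul_assoc]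
      exact mul_le_mul_of_nonneg_right (hqη a (hall a)) (sq_nonneg _)
  · refine ⟨g a', fun a => ?_, ?_⟩
    · rcases eq_or_ne a a' with rfl | hne
      · rw [sub_self, abs_zero]
        have := Real.rpow_nonneg (hpos a).le (-η)
        positivity
      · have h3 := mul_le_mul_of_nonneg_left (hneg a (hsm a hne)) hs
        have h4 := abs_sub (g a) (g a')
        linarith [hg a, hg a']
    · have hsum : ∑ a ∈ Finset.univ.erase a', q a = m := by
        have := hq.2
        rw [← Finset.add_sum_erase _ _ (Finset.mem_univ a')] at this
        linarith
      rw [← Finset.add_sum_erase _ _ (Finset.mem_univ a'),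
        ← Finset.add_sum_erase _ (fun a => q a * g a ^ 2) (Finset.mem_univ a'), sub_self]
      have h1 : ∑ a ∈ Finset.univ.erase a', q a ^ (1 + η) * (g a - g a') ^ 2 ≤
          ∑ a ∈ Finset.univ.erase a', m ^ η * (2 * (q a * g a ^ 2) + q a * (2 * g a' ^ 2)) := by
        refine Finset.sum_le_sum fun a ha => ?_
        refine (mul_le_mul_of_nonneg_right (hqη a (hsm a (Finset.ne_of_mem_erase ha)))
          (sq_nonneg _)).trans ?_
        rw [mul_assoc]
        refine mul_le_mul_of_nonneg_left ?_ (Real.rpow_nonneg hm0.le _)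
        nlinarith [mul_nonneg (hpos a).le (sq_nonneg (g a + g a'))]
      rw [← Finset.mul_sum, Finset.sum_add_distrib, ← Finset.mul_sum, ← Finset.sum_mul, hsum] at h1
      -- The other arms together carry mass `m ≤ 1/2 < q a'`, so the squared loss of the dominating
      -- arm spread over them is paid for by its own term in `∑ q g²`.
      have h2 : m * g a' ^ 2 ≤ q a' * g a' ^ 2 :=
        mul_le_mul_of_nonneg_right (by linarith) (sq_nonneg _)
      have h3 := mul_le_mul_of_nonneg_left h2 (Real.rpow_nonneg hm0.le η)
      nlinarith

end QStar

/-! ### One step of follow-the-regularized-leader. -/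

namespace Params

variable {K d : ℕ} {P : Params K d} {c₁ c₂ : ℝ} {T : ℕ} (hP : P.Admissible c₁ c₂ T)
include hP

lemma Admissible.qStar_pos {S : State K} (hS : 0 < S.2) : 0 < qStar (P.q S) :=
  HTBandit.qStar_pos hP.two_le_K (q_spec hP S).1 (q_pos hP hS)

lemma s_pos {S : State K} (hS : 0 < S.2) : 0 < P.s S := by
  have h1 := hP.η_pos
  have h2 := Real.rpow_pos_of_pos (hP.qStar_pos hS) (P.α - 1)
  unfold s
  positivity

lemma h_pos {S : State K} (hS : 0 < S.2) : 0 < P.h S := by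
  refine lt_of_lt_of_le ?_ (qStar_rpow_le_entropy hP.two_le_K hP.α_pos hP.α_lt_one (q_spec hP S).1
    (q_pos hP hS))
  have h1 := hP.η_pos
  have h2 := Real.rpow_pos_of_pos (hP.qStar_pos hS) P.α
  positivity

/-- A small change of the losses and of the learning rate increases no small probability by more
than a factor of two. -/
lemma q_le_two_mul {S S' : State K} (hS : 0 < S.2) {e : ℝ} (he : 0 ≤ e) (hS' : S'.2 = S.2 + e)
    (hg : ∀ a, |S'.1 a - S.1 a| ≤ 2 * P.s S)
    (hle : e ≤ P.βbar * qStar (P.q S) ^ (P.αbar - P.α) / 4) (a : Fin K)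
    (ha : P.q S a ≤ qStar (P.q S)) : P.q S' a ≤ 2 * P.q S a := by
  by_contra! hlt
  have hS'0 : 0 < S'.2 := by linarith
  have hq := q_pos hP hS
  have hq' := q_pos hP hS'0
  obtain ⟨b, hb⟩ : ∃ b, P.q S' b < P.q S b := by
    by_contra! h
    have : ∑ c, P.q S c < ∑ c, P.q S' c :=
      Finset.sum_lt_sum (fun c _ => h c) ⟨a, Finset.mem_univ a, by linarith [hq a]⟩
    rw [(q_spec hP S).1.2, (q_spec hP S').1.2] at this
    exact lt_irrefl _ this
  -- The two stationarity conditions are compared at `a`, whose probability more than doubled, and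
  -- at `b`, whose probability fell. The regularizer terms then move apart by more than the losses
  -- and the learning rate can compensate.
  have f1 := coordGrad_eq hP hS a b
  have f2 := coordGrad_eq hP hS'0 a b
  unfold coordGrad at f1 f2
  rw [hS'] at f2
  have hη := hP.η_pos
  have hα1 : P.α - 1 ≤ 0 := by linarith
  have hb1 : P.αbar - 1 ≤ 0 := by linarith [hP.αbar_le]
  have g1 : P.q S b ^ (P.α - 1) ≤ P.q S' b ^ (P.α - 1) :=
    Real.rpow_le_rpow_of_nonpos (hq' b) hb.le hα1
  have g2 : P.q S b ^ (P.αbar - 1) ≤ P.q S' b ^ (P.αbar - 1) :=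
    Real.rpow_le_rpow_of_nonpos (hq' b) hb.le hb1
  set x := P.q S a
  set m := qStar (P.q S)
  have hx : 0 < x := hq a
  have hm : 0 < m := hP.qStar_pos hS
  have two_pow : ∀ ρ : ℝ, (2 * x) ^ (-ρ) = (1 / 2) ^ ρ * x ^ (-ρ) := fun ρ => by
    rw [Real.mul_rpow (by norm_num) hx.le, one_div, Real.inv_rpow (by norm_num),
      Real.rpow_neg (by norm_num)]
  have g3 : P.q S' a ^ (P.α - 1) ≤ (1 - (1 - P.α) / 2) * x ^ (P.α - 1) := by
    refine (Real.rpow_le_rpow_of_nonpos (by positivity) hlt.le hα1).trans ?_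
    rw [← neg_sub 1 P.α, two_pow]
    exact mul_le_mul_of_nonneg_right (half_rpow_le hη.le (by linarith [hP.η_le]))
      (Real.rpow_nonneg hx.le _)
  have g4 : P.q S' a ^ (P.αbar - 1) ≤ 3 / 4 * x ^ (P.αbar - 1) := by
    refine (Real.rpow_le_rpow_of_nonpos (by positivity) hlt.le hb1).trans ?_
    rw [← neg_sub 1 P.αbar, two_pow]
    refine mul_le_mul_of_nonneg_right ((half_rpow_le (by linarith) (by linarith [hP.αbar_pos])).trans
      (by linarith [hP.αbar_le])) (Real.rpow_nonneg hx.le _)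
  have hX : 0 < x ^ (P.α - 1) := Real.rpow_pos_of_pos hx _
  have hY : 0 < x ^ (P.αbar - 1) := Real.rpow_pos_of_pos hx _
  -- The auxiliary regularizer absorbs the change of learning rate: `ᾱ < α`, so the bound on `e` at
  -- `q_*` only improves at the smaller probability `x`.
  have g5 : e * x ^ (P.α - 1) ≤ P.βbar * x ^ (P.αbar - 1) / 4 := by
    have h1 : m ^ (P.αbar - P.α) ≤ x ^ (P.αbar - P.α) :=
      Real.rpow_le_rpow_of_nonpos hx ha (by linarith [hP.αbar_le, hP.half_le_α])
    have h2 : x ^ (P.αbar - P.α) * x ^ (P.α - 1) = x ^ (P.αbar - 1) := by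
      rw [← Real.rpow_add hx]; ring_nf
    calc e * x ^ (P.α - 1) ≤ (P.βbar * x ^ (P.αbar - P.α) / 4) * x ^ (P.α - 1) := by
          refine mul_le_mul_of_nonneg_right (hle.trans ?_) hX.le
          have := mul_le_mul_of_nonneg_left h1 hP.βbar_pos.le
          linarith
      _ = _ := by rw [← h2]; ring
  -- The factor `1/8` in the clipping level is used here: the losses of `a` and `b` change by at
  -- most `2 s` each, and `4 s` is within the gradient drop of the main regularizer.
  have g6 : 4 * P.s S ≤ (1 - P.α) / 2 * S.2 * x ^ (P.α - 1) := by
    have h1 : m ^ (P.α - 1) ≤ x ^ (P.α - 1) := Real.rpow_le_rpow_of_nonpos hx ha hα1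
    have := mul_le_mul_of_nonneg_left h1 (mul_pos hη hS).le
    unfold s
    linarith
  have g7 := abs_le.1 (hg a)
  have g8 := abs_le.1 (hg b)
  have k1 := mul_le_mul_of_nonneg_left g1 hS.le
  have k2 := mul_le_mul_of_nonneg_left g2 hP.βbar_pos.le
  have k3 := mul_le_mul_of_nonneg_left g3 hS.le
  have k4 := mul_le_mul_of_nonneg_left g4 hP.βbar_pos.le
  have k5 := mul_le_mul_of_nonneg_left g3 he
  have k6 : 0 ≤ e * P.q S' b ^ (P.α - 1) := mul_nonneg he (Real.rpow_nonneg (hq' b).le _)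
  have k7 := mul_pos hP.βbar_pos hY
  have k8 : 0 ≤ (1 - P.α) / 2 * (e * x ^ (P.α - 1)) := by positivity
  have k9 : e * ((1 - (1 - P.α) / 2) * x ^ (P.α - 1)) =
    e * x ^ (P.α - 1) - (1 - P.α) / 2 * (e * x ^ (P.α - 1)) := by ring
  have k10 : S.2 * ((1 - (1 - P.α) / 2) * x ^ (P.α - 1)) =
    S.2 * x ^ (P.α - 1) - (1 - P.α) / 2 * S.2 * x ^ (P.α - 1) := by ring
  have k11 : P.βbar * (x ^ (P.αbar - 1)) = P.βbar * x ^ (P.αbar - 1) := rfl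
  nlinarith

/-- One step of follow-the-regularized-leader with an increasing learning rate. -/
lemma objective_step {S S' : State K} (hS : 0 < S.2) {e : ℝ} (he : 0 ≤ e) (hS' : S'.2 = S.2 + e)
    (hg : ∀ a, |S'.1 a - S.1 a| ≤ 2 * P.s S)
    (hle : e ≤ P.βbar * qStar (P.q S) ^ (P.αbar - P.α) / 4) :
    ∑ a, P.q S a * (S'.1 a - S.1 a) - 1 / (2 * P.s S) * ∑ a, P.q S a * (S'.1 a - S.1 a) ^ 2 -
      2 * (e * P.h S) ≤ P.objective S' (P.q S') - P.objective S (P.q S) := by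
  have hS'0 : 0 < S'.2 := by linarith
  have hqs := (q_spec hP S).1
  have hqs' := (q_spec hP S').1
  have hpos := q_pos hP hS
  -- The change of the learning rate is charged at the new leader; doubling moves the charge to the
  -- old one and produces the factor `2`.
  have hdouble : P.h S' ≤ 2 * P.h S :=
    entropy_le_two_mul hP.two_le_K hP.α_pos hP.α_lt_one hqs hpos hqs'
      (q_le_two_mul hP hS he hS' hg hle)
  have hη := hP.η_pos
  set m := qStar (P.q S) with hm
  have hm0 : 0 < m := hP.qStar_pos hS
  set g : Fin K → ℝ := fun a => S'.1 a - S.1 a with hgdef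
  have hs := s_pos hP hS
  have hsdef : P.s S = (1 - P.α) * S.2 * m ^ (P.α - 1) / 8 := rfl
  -- Both leaders have total mass one, so subtracting a constant from all losses does not affect the
  -- comparison.
  obtain ⟨c, hc1, hc2⟩ := exists_shift (η := 1 - P.α) (s := (1 - P.α) * S.2 / 4) (g := g) hη.le
    hP.two_le_K hqs hpos (fun a => (hg a).trans (le_of_eq (by rw [hsdef, neg_sub]; ring)))
  -- stability
  have hstab : ∑ a, (g a - c) * (P.q S a - P.q S' a) ≤
      ∑ a, S.2 * tsallisBreg P.α (P.q S' a) (P.q S a) +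
        1 / (2 * P.s S) * ∑ a, P.q S a * g a ^ 2 := by
    have h1 : ∀ a, (g a - c) * (P.q S a - P.q S' a) ≤
        S.2 * tsallisBreg P.α (P.q S' a) (P.q S a) +
          2 / (S.2 * (1 - P.α)) * (P.q S a ^ (1 + (1 - P.α)) * (g a - c) ^ 2) := fun a => by
      have := coord_stability hP.half_le_α hP.α_lt_one hS (hqs'.1 a) (hpos a) (G := g a - c)
        ((hc1 a).trans (le_of_eq (by rw [neg_sub]; ring)))
      refine this.trans (le_of_eq ?_)
      rw [show 1 + (1 - P.α) = 2 - P.α by ring]; ring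
    refine (Finset.sum_le_sum fun a _ => h1 a).trans ?_
    rw [Finset.sum_add_distrib]
    refine add_le_add_right ?_ _
    rw [← Finset.mul_sum]
    rw [← hm] at hc2
    have h2 : (0 : ℝ) ≤ 2 / (S.2 * (1 - P.α)) := by positivity
    refine (mul_le_mul_of_nonneg_left hc2 h2).trans (le_of_eq ?_)
    have h3 : m ^ (P.α - 1) * m ^ (1 - P.α) = 1 := by rw [← Real.rpow_add hm0]; simp
    have h4 : 0 < m ^ (P.α - 1) := Real.rpow_pos_of_pos hm0 _
    rw [eq_comm, ← mul_assoc, ← mul_assoc]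
    refine congrArg (· * _) ?_
    rw [hsdef, div_eq_iff (by positivity)]
    field_simp
    linear_combination (-8) * h3
  have hobj := objective_sub_q hP hS hqs'
  have hbar : ∀ a, 0 ≤ P.βbar * tsallisBreg P.αbar (P.q S' a) (P.q S a) := fun a =>
    mul_nonneg hP.βbar_pos.le (tsallisBreg_nonneg hP.αbar_pos (by linarith [hP.αbar_le])
      (hqs'.1 a) (hpos a))
  rw [Finset.sum_add_distrib] at hobj
  have hbar' := Finset.sum_nonneg fun a (_ : a ∈ Finset.univ) => hbar a
  have hshift : ∑ a, (g a - c) * (P.q S a - P.q S' a) =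
      ∑ a, P.q S a * g a - ∑ a, P.q S' a * g a := by
    have : ∀ a, (g a - c) * (P.q S a - P.q S' a) =
        P.q S a * g a - P.q S' a * g a - c * P.q S a + c * P.q S' a := fun a => by ring
    simp only [this, Finset.sum_add_distrib, Finset.sum_sub_distrib, ← Finset.mul_sum, hqs.2,
      hqs'.2]
    ring
  have hdiff : P.objective S' (P.q S') - P.objective S (P.q S') =
      ∑ a, P.q S' a * g a - e * P.h S' := by
    simp only [objective, dotProduct, hS', h, hgdef, mul_sub, Finset.sum_sub_distrib, mul_comm]
    ring
  have := mul_le_mul_of_nonneg_left hdouble he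
  linarith

end Params

lemma sum_gram_rpow_le {K d : ℕ} {φ : Fin K → Fin d → ℝ} {p : Fin K → ℝ}
    (hV : (covFeature φ p).PosDef) (hp : p ∈ stdSimplex ℝ (Fin K)) {ε : ℝ} (h1 : 1 < ε)
    (h2 : ε ≤ 2) (a : Fin K) :
    ∑ b, p b * |gram φ p a b| ^ ε ≤ gram φ p a a ^ (ε / 2) := by
  have habs : ∀ b, |gram φ p a b| ^ ε = (gram φ p a b ^ 2) ^ (ε / 2) := fun b => by
    rw [← sq_abs, ← Real.rpow_natCast, ← Real.rpow_mul (abs_nonneg _)]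
    congr 1; push_cast; ring
  simp only [habs]
  refine (sum_mul_rpow_le Finset.univ p _ (by linarith) (by linarith) (fun b _ => hp.1 b)
    (fun b _ => sq_nonneg _)).trans ?_
  rw [hp.2, Real.one_rpow, one_mul, sum_gram_sq hV]

/-! ### The cost of one round: exploration, bonuses and the change of potential. -/

namespace Params

variable {K d : ℕ} {P : Params K d} {c₁ c₂ : ℝ} {T : ℕ}

/-- The stability and exploration cost `β^{1-ε} z + β^{-2} w` of one round. -/
noncomputable def cost (P : Params K d) (S : State K) : ℝ :=
  S.2 ^ (1 - P.ε) * P.z S + P.w S / S.2 ^ 2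

/-- The shifted loss estimate of one round. -/
noncomputable def increment (P : Params K d) (S : State K) (o : Fin K × ℝ) (a : Fin K) : ℝ :=
  P.clippedEst S o a - P.bonus S a

/-- The potential with respect to the comparator `a`. -/
noncomputable def potential (P : Params K d) (a : Fin K) (S : State K) : ℝ :=
  S.1 a - P.objective S (P.q S)

/-- A bound on `z_t` that does not depend on `p_t`. -/
noncomputable def zBound (P : Params K d) (S : State K) : ℝ :=
  (1 - P.α) ^ (1 - P.ε) * P.σ * qStar (P.q S) ^ P.αbar * (d : ℝ) ^ (P.ε / 2)

variable (hP : P.Admissible c₁ c₂ T)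
include hP

section State

variable {S : State K} (hS : 0 < S.2)
include hS

lemma γ_pos : 0 < P.γ S := by
  have h1 := hP.η_pos
  have h2 := Real.rpow_pos_of_pos (hP.qStar_pos hS) (2 * (1 - P.α))
  have h3 := Real.rpow_pos_of_pos hP.σ_pos (2 / P.ε)
  have h4 : (0 : ℝ) < d := by linarith [hP.d_pos]
  unfold γ
  positivity

/-- The powers of `β`, `1 - α` and `q_*` cancel and `256 / 8² = 4` remains. As `d + 1 ≤ 4 d`, the
leverage bound `(d + 1) / γ` becomes `s² / σ^{2/ε}`. -/
lemma γ_mul_s_sq : P.γ S * P.s S ^ 2 = 4 * P.σ ^ (2 / P.ε) * d := by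
  have h1 := hP.η_pos
  have hm := hP.qStar_pos hS
  have h2 : qStar (P.q S) ^ (2 * (1 - P.α)) * (qStar (P.q S) ^ (P.α - 1)) ^ 2 = 1 := by
    rw [← Real.rpow_natCast (_ ^ (P.α - 1)), ← Real.rpow_mul hm.le, ← Real.rpow_add hm]
    push_cast; ring_nf; simp
  have e : P.γ S * P.s S ^ 2 = 4 * P.σ ^ (2 / P.ε) * d *
      (qStar (P.q S) ^ (2 * (1 - P.α)) * (qStar (P.q S) ^ (P.α - 1)) ^ 2) := by
    unfold γ s
    field_simp
    ring
  rw [e, h2, mul_one]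

variable (hγ : P.γ S ≤ 1 / 2)
include hγ

lemma p_mem : P.p S ∈ stdSimplex ℝ (Fin K) :=
  convex_stdSimplex ℝ (Fin K) (q_spec hP S).1 hP.p₀_mem (by linarith) (γ_pos hP hS).le (by ring)

lemma q_le_two_mul_p (a : Fin K) : P.q S a ≤ 2 * P.p S a := by
  have h1 : P.p S a = (1 - P.γ S) * P.q S a + P.γ S * P.p₀ a := rfl
  have h2 := mul_nonneg (γ_pos hP hS).le (hP.p₀_mem.1 a)
  have h3 := q_pos hP hS a
  nlinarith

lemma p_pos (a : Fin K) : 0 < P.p S a := by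
  linarith [q_le_two_mul_p hP hS hγ a, q_pos hP hS a]

lemma cov_p_posDef : (covFeature P.φ (P.p S)).PosDef := cov_posDef hP.span (p_pos hP hS hγ)

lemma bonus_nonneg (a : Fin K) : 0 ≤ P.bonus S a :=
  mul_nonneg (mul_nonneg hP.σ_pos.le (Finset.sum_nonneg fun b _ =>
    mul_nonneg (p_pos hP hS hγ b).le (Real.rpow_nonneg (abs_nonneg _) _)))
    (Real.rpow_nonneg (s_pos hP hS).le _)

/-- By the power mean inequality the `ε`-moment of a row is at most `g^{ε/2}`, where `g` is the
leverage of `a`. Exploration gives `σ g^{ε/2} ≤ s^ε`, and the factor `s^{1-ε}` leaves `s`. -/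
lemma bonus_le_s (a : Fin K) : P.bonus S a ≤ P.s S := by
  have hs := s_pos hP hS
  have hγ0 := γ_pos hP hS
  have hV := cov_p_posDef hP hS hγ
  have hp := p_mem hP hS hγ
  have hσ := hP.σ_pos
  have hd := hP.d_pos
  have hε := hP.one_lt_ε
  have hg : gram P.φ (P.p S) a a ≤ P.s S ^ 2 / P.σ ^ (2 / P.ε) := by
    refine (gram_self_le hP.span hP.p₀_mem hP.p₀_max (p_pos hP hS hγ) hp.2 hγ0 (fun b => ?_)
      a).trans ?_
    · have h1 : P.p S b = (1 - P.γ S) * P.q S b + P.γ S * P.p₀ b := rfl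
      have := mul_nonneg (by linarith : (0 : ℝ) ≤ 1 - P.γ S) (q_pos hP hS b).le
      linarith
    · have h1 := γ_mul_s_sq hP hS
      have h2 := Real.rpow_pos_of_pos hσ (2 / P.ε)
      rw [div_le_div_iff₀ hγ0 h2, mul_comm (_ ^ 2), h1]
      nlinarith
  have hrow := sum_gram_rpow_le hV hp hε hP.ε_le_two a
  have hg' : gram P.φ (P.p S) a a ^ (P.ε / 2) ≤ P.s S ^ P.ε / P.σ := by
    refine (Real.rpow_le_rpow (gram_self_nonneg hV hp.1 a) hg (by linarith)).trans (le_of_eq ?_)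
    rw [Real.div_rpow (sq_nonneg _) (Real.rpow_nonneg hσ.le _), ← Real.rpow_natCast,
      ← Real.rpow_mul hs.le, ← Real.rpow_mul hσ.le]
    congr 1
    · congr 1; push_cast; ring
    · rw [show 2 / P.ε * (P.ε / 2) = 1 by field_simp, Real.rpow_one]
  have h3 := mul_le_mul_of_nonneg_left (hrow.trans hg') hσ.le
  rw [mul_div_cancel₀ _ hσ.ne'] at h3
  calc P.bonus S a ≤ P.s S ^ P.ε * P.s S ^ (1 - P.ε) :=
        mul_le_mul_of_nonneg_right h3 (Real.rpow_nonneg hs.le _)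
    _ = P.s S := by rw [← Real.rpow_add hs]; simp

lemma one_sub_norm_p_mem : 0 ≤ 1 - ‖P.p S‖ ∧ 1 - ‖P.p S‖ ≤ 1 := by
  have := hP.neZero
  exact ⟨sub_nonneg.2 (norm_le_one (p_mem hP hS hγ)), by linarith [norm_nonneg (P.p S)]⟩

lemma z_nonneg : 0 ≤ P.z S := by
  have h1 := Real.rpow_nonneg hP.η_pos.le (1 - P.ε)
  have h2 := Real.rpow_nonneg (hP.qStar_pos hS).le ((P.ε - 1) * (1 - P.α))
  have h3 := Real.rpow_nonneg (one_sub_norm_p_mem hP hS hγ).1 (2 - P.ε)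
  have h4 := hP.σ_pos
  unfold z
  positivity

lemma z_le_zBound : P.z S ≤ P.zBound S := by
  have h1 := Real.rpow_nonneg hP.η_pos.le (1 - P.ε)
  have h2 := Real.rpow_nonneg (hP.qStar_pos hS).le P.αbar
  have h3 := one_sub_norm_p_mem hP hS hγ
  have h4 := hP.σ_pos
  have h5 : (1 - ‖P.p S‖) ^ (2 - P.ε) ≤ 1 := Real.rpow_le_one h3.1 h3.2 (by linarith [hP.ε_le_two])
  have h6 : P.z S = P.zBound S * (1 - ‖P.p S‖) ^ (2 - P.ε) := rfl
  have h7 : 0 ≤ P.zBound S := by unfold zBound; positivity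
  rw [h6]
  exact mul_le_of_le_one_right h7 h5

omit hγ in
lemma w_nonneg : 0 ≤ P.w S := by
  have h1 := hP.η_pos
  have h2 := Real.rpow_nonneg (hP.qStar_pos hS).le (2 * (1 - P.α))
  have h3 := Real.rpow_nonneg hP.σ_pos.le (3 / P.ε)
  unfold w
  positivity

omit hγ in
-- The `w`-part of the cost is the price of exploration: probability `γ` times a typical loss
-- `σ^{1/ε}`.
lemma w_div_eq : P.w S / S.2 ^ 2 = P.σ ^ (1 / P.ε) * P.γ S / 256 := by
  have h1 := hP.η_pos
  have h2 : P.σ ^ (3 / P.ε) = P.σ ^ (1 / P.ε) * P.σ ^ (2 / P.ε) := by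
    rw [← Real.rpow_add hP.σ_pos]; ring_nf
  unfold w γ
  rw [h2]
  field_simp

lemma cost_nonneg : 0 ≤ P.cost S :=
  add_nonneg (mul_nonneg (Real.rpow_nonneg hS.le _) (z_nonneg hP hS hγ))
    (div_nonneg (w_nonneg hP hS) (sq_nonneg _))

/-- As `γ ≤ 1` and `(ε - 1) / 2 ≤ 1`, one has `γ ≤ γ^{(ε-1)/2}`, and this power depends on `β`, `1 -
α` and `q_*` exactly as the stability bound does. -/
lemma w_div_le : P.w S / S.2 ^ 2 ≤ S.2 ^ (1 - P.ε) * P.zBound S := by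
  have hη := hP.η_pos
  have hm := hP.qStar_pos hS
  have hσ := hP.σ_pos
  have hd := hP.d_pos
  have hd0 : (0 : ℝ) < d := by linarith
  have hε1 := hP.one_lt_ε
  have hε2 := hP.ε_le_two
  have hγ0 := γ_pos hP hS
  set r := P.ε - 1 with hr
  have hγle : P.γ S ≤ P.γ S ^ (r / 2) := by
    calc P.γ S = P.γ S ^ (1 : ℝ) := (Real.rpow_one _).symm
      _ ≤ _ := Real.rpow_le_rpow_of_exponent_ge hγ0 (by linarith) (by linarith)
  have hγeq : P.γ S ^ (r / 2) = 16 ^ r * (1 - P.α) ^ (-r) * P.σ ^ (r / P.ε) * (d : ℝ) ^ (r / 2) *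
      S.2 ^ (-r) * qStar (P.q S) ^ P.αbar := by
    have hσ2 := Real.rpow_nonneg hσ.le (2 / P.ε)
    have hm2 := Real.rpow_nonneg hm.le (2 * (1 - P.α))
    have h16 : (256 : ℝ) ^ (r / 2) = 16 ^ r := by
      rw [show (256 : ℝ) = 16 ^ (2 : ℝ) by norm_num, ← Real.rpow_mul (by norm_num)]
      congr 1; ring
    have hsq : ∀ x : ℝ, 0 < x → (x ^ 2) ^ (r / 2) = x ^ r := fun x hx => by
      rw [← Real.rpow_natCast, ← Real.rpow_mul hx.le]; congr 1; push_cast; ring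
    unfold γ
    rw [Real.mul_rpow (by positivity) hm2, Real.div_rpow (by positivity) (by positivity),
      Real.mul_rpow (by positivity) hd0.le, Real.mul_rpow (by positivity) hσ2,
      Real.div_rpow (by positivity) (by positivity), h16, hsq _ hη, hsq _ hS, ← Real.rpow_mul hσ.le,
      ← Real.rpow_mul hm.le, Real.rpow_neg hη.le, Real.rpow_neg hS.le,
      show 2 / P.ε * (r / 2) = r / P.ε by ring, show 2 * (1 - P.α) * (r / 2) = P.αbar by
        unfold αbar; ring]
    field_simp
  have hσσ : P.σ ^ (1 / P.ε) * P.σ ^ (r / P.ε) = P.σ := by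
    rw [← Real.rpow_add hσ, ← add_div, hr, show 1 + (P.ε - 1) = P.ε by ring,
      div_self (by linarith), Real.rpow_one]
  have h16 : (16 : ℝ) ^ r ≤ 16 := by
    calc (16 : ℝ) ^ r ≤ 16 ^ (1 : ℝ) := Real.rpow_le_rpow_of_exponent_le (by norm_num) (by linarith)
      _ = 16 := Real.rpow_one _
  have hdd : (d : ℝ) ^ (r / 2) ≤ (d : ℝ) ^ (P.ε / 2) :=
    Real.rpow_le_rpow_of_exponent_le hd (by linarith)
  have hpos1 := Real.rpow_pos_of_pos hη (-r)
  have hpos2 := Real.rpow_pos_of_pos hS (-r)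
  have hpos3 := Real.rpow_pos_of_pos hm P.αbar
  have hpos4 := Real.rpow_pos_of_pos hσ (1 / P.ε)
  have hpos5 := Real.rpow_pos_of_pos hd0 (r / 2)
  rw [w_div_eq hP hS]
  unfold zBound
  rw [show 1 - P.ε = -r by rw [hr]; ring]
  calc P.σ ^ (1 / P.ε) * P.γ S / 256 ≤ P.σ ^ (1 / P.ε) * P.γ S ^ (r / 2) / 256 := by gcongr
    _ = (16 ^ r / 256) * ((1 - P.α) ^ (-r) * (P.σ ^ (1 / P.ε) * P.σ ^ (r / P.ε)) * S.2 ^ (-r) *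
          qStar (P.q S) ^ P.αbar * (d : ℝ) ^ (r / 2)) := by rw [hγeq]; ring
    _ = (16 ^ r / 256) * ((1 - P.α) ^ (-r) * P.σ * S.2 ^ (-r) *
          qStar (P.q S) ^ P.αbar * (d : ℝ) ^ (r / 2)) := by rw [hσσ]
    _ ≤ 1 * ((1 - P.α) ^ (-r) * P.σ * S.2 ^ (-r) *
          qStar (P.q S) ^ P.αbar * (d : ℝ) ^ (P.ε / 2)) := by
        gcongr
        linarith
    _ = _ := by ring

lemma cost_le : P.cost S ≤ 2 * (S.2 ^ (1 - P.ε) * P.zBound S) := by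
  have h1 := w_div_le hP hS hγ
  have h2 := mul_le_mul_of_nonneg_left (z_le_zBound hP hS hγ) (Real.rpow_nonneg hS.le (1 - P.ε))
  unfold cost
  linarith

/-- The threshold on `β̄` enters here. The cost carries `q_*^ᾱ` and the entropy is at least `(1 -
α)/2 · q_*^α`. Of the three factors `(1 - α)⁻¹` in the threshold, two cover `(1 - α)^{1-ε}` and one
comes from the entropy. -/
lemma cost_div_h_le (hβ : P.β₁ ≤ S.2) :
    1 / P.h S * P.cost S ≤ P.βbar * qStar (P.q S) ^ (P.αbar - P.α) / 4 := by
  have hη := hP.η_pos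
  have hm := hP.qStar_pos hS
  have hσ := hP.σ_pos
  have hd := hP.d_pos
  have hd0 : (0 : ℝ) < d := by linarith
  have hε1 := hP.one_lt_ε
  have hε2 := hP.ε_le_two
  have hh := h_pos hP hS
  have hlow : (1 - P.α) / 2 * qStar (P.q S) ^ P.α ≤ P.h S :=
    qStar_rpow_le_entropy hP.two_le_K hP.α_pos hP.α_lt_one (q_spec hP S).1 (q_pos hP hS)
  set m := qStar (P.q S)
  have hmα := Real.rpow_pos_of_pos hm P.α
  have hmd := Real.rpow_pos_of_pos hm (P.αbar - P.α)
  have hsplit : m ^ P.αbar = m ^ (P.αbar - P.α) * m ^ P.α := by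
    rw [← Real.rpow_add hm]; ring_nf
  have hηp : (1 - P.α) ^ (1 - P.ε) ≤ (1 - P.α)⁻¹ ^ 2 := by
    calc (1 - P.α) ^ (1 - P.ε) ≤ (1 - P.α) ^ (-2 : ℝ) :=
          Real.rpow_le_rpow_of_exponent_ge hη (by linarith [hP.η_le]) (by linarith)
      _ = _ := by rw [Real.rpow_neg hη.le, inv_pow]; norm_num
  have hβp : S.2 ^ (1 - P.ε) ≤ P.β₁ ^ (1 - P.ε) :=
    Real.rpow_le_rpow_of_nonpos hP.β₁_pos hβ (by linarith)
  have hdp : (d : ℝ) ^ (P.ε / 2) ≤ (d : ℝ) ^ P.ε :=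
    Real.rpow_le_rpow_of_exponent_le hd (by linarith)
  have hβ1 := Real.rpow_pos_of_pos hP.β₁_pos (1 - P.ε)
  have hβ2 := Real.rpow_pos_of_pos hS (1 - P.ε)
  have hdpos := Real.rpow_pos_of_pos hd0 (P.ε / 2)
  have hmax : P.σ ≤ max (P.σ ^ (3 / P.ε)) P.σ := le_max_right _ _
  have hbar : 64 * (1 - P.α)⁻¹ ^ 3 * (d : ℝ) ^ P.ε * P.β₁ ^ (1 - P.ε) * P.σ ≤ P.βbar := by
    refine le_trans ?_ hP.βbar_ge
    rw [div_eq_mul_inv, inv_pow]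
    gcongr
  have hηi : 0 < (1 - P.α)⁻¹ := inv_pos.2 hη
  have hcost : P.cost S ≤ 2 * (P.β₁ ^ (1 - P.ε) * ((1 - P.α)⁻¹ ^ 2 * P.σ *
      (m ^ (P.αbar - P.α) * m ^ P.α) * (d : ℝ) ^ P.ε)) := by
    refine (cost_le hP hS hγ).trans ?_
    have : P.zBound S ≤ (1 - P.α)⁻¹ ^ 2 * P.σ * (m ^ (P.αbar - P.α) * m ^ P.α) * (d : ℝ) ^ P.ε := by
      unfold zBound
      rw [← hsplit]
      have := Real.rpow_pos_of_pos hm P.αbar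
      gcongr
    have h0 : 0 ≤ P.zBound S := (z_nonneg hP hS hγ).trans (z_le_zBound hP hS hγ)
    gcongr
  rw [one_div_mul_eq_div, div_le_iff₀ hh]
  refine hcost.trans ?_
  have h1 : P.βbar * m ^ (P.αbar - P.α) / 4 * ((1 - P.α) / 2 * m ^ P.α) ≤
      P.βbar * m ^ (P.αbar - P.α) / 4 * P.h S :=
    mul_le_mul_of_nonneg_left hlow (by have := hP.βbar_pos; positivity)
  refine le_trans ?_ h1
  have h2 := mul_le_mul_of_nonneg_right hbar
    (show 0 ≤ m ^ (P.αbar - P.α) / 4 * ((1 - P.α) / 2 * m ^ P.α) by positivity)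
  have h3 : 64 * (1 - P.α)⁻¹ ^ 3 * (d : ℝ) ^ P.ε * P.β₁ ^ (1 - P.ε) * P.σ *
      (m ^ (P.αbar - P.α) / 4 * ((1 - P.α) / 2 * m ^ P.α)) =
      8 * (P.β₁ ^ (1 - P.ε) * ((1 - P.α)⁻¹ ^ 2 * P.σ *
      (m ^ (P.αbar - P.α) * m ^ P.α) * (d : ℝ) ^ P.ε)) := by
    field_simp
    ring
  have h4 : 0 ≤ P.β₁ ^ (1 - P.ε) * ((1 - P.α)⁻¹ ^ 2 * P.σ *
      (m ^ (P.αbar - P.α) * m ^ P.α) * (d : ℝ) ^ P.ε) := by positivity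
  linarith

/-- After `q ≤ 2 p`, the leverage moment bound is applied at the most likely arm of `p`. The
constant is `64 = 2 · 8 · 4`, the `8` coming from the clipping level. -/
lemma sum_q_bonus_le : ∑ a, P.q S a * P.bonus S a ≤ 64 * (S.2 ^ (1 - P.ε) * P.z S) := by
  have := hP.neZero
  have hη := hP.η_pos
  have hm := hP.qStar_pos hS
  have hσ := hP.σ_pos
  have hε1 := hP.one_lt_ε
  have hε2 := hP.ε_le_two
  have hs := s_pos hP hS
  have hp := p_mem hP hS hγ
  obtain ⟨a', ha'⟩ := exists_apply_eq_norm hp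
  have hV := cov_p_posDef hP hS hγ
  have hmain := sum_sum_gram_rpow_le hV hp hP.one_le_d hε1 hε2 a'
  rw [ha'] at hmain
  have hsp := Real.rpow_nonneg hs.le (1 - P.ε)
  have h1 : ∑ a, P.q S a * P.bonus S a ≤ 2 * P.σ * P.s S ^ (1 - P.ε) *
      ∑ a, P.p S a * ∑ b, P.p S b * |gram P.φ (P.p S) a b| ^ P.ε := by
    rw [Finset.mul_sum]
    refine Finset.sum_le_sum fun a _ => ?_
    refine (mul_le_mul_of_nonneg_right (q_le_two_mul_p hP hS hγ a)
      (bonus_nonneg hP hS hγ a)).trans (le_of_eq ?_)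
    unfold bonus; ring
  have h2 : P.s S ^ (1 - P.ε) ≤ 8 * ((1 - P.α) ^ (1 - P.ε) * S.2 ^ (1 - P.ε) *
      qStar (P.q S) ^ ((P.ε - 1) * (1 - P.α))) := by
    have h8 : ((8 : ℝ)⁻¹) ^ (1 - P.ε) ≤ 8 := by
      rw [Real.inv_rpow (by norm_num), ← Real.rpow_neg (by norm_num)]
      calc (8 : ℝ) ^ (-(1 - P.ε)) ≤ 8 ^ (1 : ℝ) :=
            Real.rpow_le_rpow_of_exponent_le (by norm_num) (by linarith)
        _ = 8 := Real.rpow_one _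
    have hm' := Real.rpow_nonneg hm.le (P.α - 1)
    unfold s
    rw [div_eq_mul_inv, Real.mul_rpow (by positivity) (by norm_num),
      Real.mul_rpow (by positivity) hm', Real.mul_rpow hη.le hS.le, ← Real.rpow_mul hm.le,
      show (P.α - 1) * (1 - P.ε) = (P.ε - 1) * (1 - P.α) by ring, mul_comm]
    have := Real.rpow_nonneg hm.le ((P.ε - 1) * (1 - P.α))
    gcongr
  refine h1.trans ?_
  have h3 : 0 ≤ 4 * (d : ℝ) ^ (P.ε / 2) * (1 - ‖P.p S‖) ^ (2 - P.ε) := by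
    have := Real.rpow_nonneg (one_sub_norm_p_mem hP hS hγ).1 (2 - P.ε)
    positivity
  calc _ ≤ 2 * P.σ * P.s S ^ (1 - P.ε) *
        (4 * (d : ℝ) ^ (P.ε / 2) * (1 - ‖P.p S‖) ^ (2 - P.ε)) := by gcongr
    _ ≤ 2 * P.σ * (8 * ((1 - P.α) ^ (1 - P.ε) * S.2 ^ (1 - P.ε) *
        qStar (P.q S) ^ ((P.ε - 1) * (1 - P.α)))) *
        (4 * (d : ℝ) ^ (P.ε / 2) * (1 - ‖P.p S‖) ^ (2 - P.ε)) := by gcongr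
    _ = _ := by unfold z; ring

omit hγ in
lemma abs_clippedEst_le (o : Fin K × ℝ) (a : Fin K) : |P.clippedEst S o a| ≤ P.s S := by
  unfold clippedEst
  split_ifs with h
  · exact h
  · rw [abs_zero]; exact (s_pos hP hS).le

lemma abs_increment_le (o : Fin K × ℝ) (a : Fin K) : |P.increment S o a| ≤ 2 * P.s S := by
  have h1 := abs_clippedEst_le hP hS o a
  have h2 := abs_sub (P.clippedEst S o a) (P.bonus S a)
  rw [abs_of_nonneg (bonus_nonneg hP hS hγ a)] at h2
  unfold increment
  linarith [bonus_le_s hP hS hγ a]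

omit hγ hS in
lemma objective_vertex (a : Fin K) : P.objective S (Pi.single a 1) = S.1 a := by
  have h : ∀ α : ℝ, 0 < α → tsallis α (Pi.single a 1 : Fin K → ℝ) = 0 := fun α hα => by
    unfold tsallis
    rw [Finset.sum_eq_zero, mul_zero]
    intro b _
    rcases eq_or_ne b a with rfl | hb
    · simp
    · simp [hb, Real.zero_rpow hα.ne']
  unfold objective
  rw [h _ hP.α_pos, h _ hP.αbar_pos]
  simp

omit hγ hS in
-- The leader does at least as well as the vertex `a`, where both entropies vanish. Hence the final
-- potential can be dropped from the regret bound.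
lemma potential_nonneg (a : Fin K) : 0 ≤ P.potential a S := by
  have h : P.objective S (P.q S) ≤ P.objective S (Pi.single a 1) :=
    (q_spec hP S).2 (single_mem_stdSimplex ℝ a)
  rw [objective_vertex hP] at h
  exact sub_nonneg.2 h

/-- The learning rate increment times the entropy is exactly the cost, by the update rule. -/
lemma potential_next (hβ : P.β₁ ≤ S.2) (o : Fin K × ℝ) (a : Fin K) :
    P.potential a (P.next S o) ≤ P.potential a S + (P.increment S o a -
      ∑ b, P.q S b * P.increment S o b +
      1 / (2 * P.s S) * ∑ b, P.q S b * P.increment S o b ^ 2 + 2 * P.cost S) := by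
  have hinc : ∀ b, (P.next S o).1 b - S.1 b = P.increment S o b := fun b => by
    simp [next, increment]
  have hh := h_pos hP hS
  have hc := cost_nonneg hP hS hγ
  have he : 0 ≤ 1 / P.h S * P.cost S := by positivity
  have := objective_step hP hS (S' := P.next S o) he rfl
    (fun b => by rw [hinc]; exact abs_increment_le hP hS hγ o b) (cost_div_h_le hP hS hγ hβ)
  simp only [hinc] at this
  have e : 1 / P.h S * P.cost S * P.h S = P.cost S := by field_simp
  rw [e] at this
  have h2 := hinc a
  unfold potential
  linarith

end State

omit hP in
lemma potential_state₁ (a : Fin K) :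
    P.potential a P.state₁ = P.β₁ * P.h₁ + P.βbar * P.hbar := by
  simp [potential, objective, state₁, h₁, h, hbar]
  ring

end Params

/-! ### Clipping -/

/-- Clipping a number at level `s`. -/
noncomputable def clip (s x : ℝ) : ℝ := if |x| ≤ s then x else 0

lemma measurable_clip (s : ℝ) : Measurable (clip s) :=
  Measurable.ite (measurableSet_le measurable_norm measurable_const) measurable_id measurable_const

lemma abs_clip_le {s : ℝ} (hs : 0 ≤ s) (x : ℝ) : |clip s x| ≤ s := by
  unfold clip
  split_ifs with h
  · exact h
  · rwa [abs_zero]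

/-- Where nothing is clipped, `|x|^{2-ε} ≤ s^{2-ε}`; the missing second moment is replaced by the
`ε`-th. -/
lemma clip_sq_le {s x ε : ℝ} (hs : 0 < s) (h1 : 1 < ε) (h2 : ε ≤ 2) :
    clip s x ^ 2 ≤ s ^ (2 - ε) * |x| ^ ε := by
  unfold clip
  split_ifs with h
  · rcases (abs_nonneg x).eq_or_lt with h0 | h0
    · rw [← sq_abs, ← h0, Real.zero_rpow (by linarith)]; simp
    · calc x ^ 2 = |x| ^ (2 - ε) * |x| ^ ε := by
            rw [← Real.rpow_add h0, ← sq_abs, ← Real.rpow_natCast]; congr 1; push_cast; ring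
        _ ≤ _ := mul_le_mul_of_nonneg_right (Real.rpow_le_rpow h0.le h (by linarith))
            (Real.rpow_nonneg h0.le _)
  · have := Real.rpow_nonneg hs.le (2 - ε)
    have := Real.rpow_nonneg (abs_nonneg x) ε
    simpa using (by positivity)

/-- The difference is nonzero only where `|x| > s`, and there `1 ≤ (|x| / s)^{ε-1}`. -/
lemma abs_sub_clip_le {s x ε : ℝ} (hs : 0 < s) (h1 : 1 < ε) :
    |x - clip s x| ≤ s ^ (1 - ε) * |x| ^ ε := by
  unfold clip
  split_ifs with h
  · have := Real.rpow_nonneg hs.le (1 - ε)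
    have := Real.rpow_nonneg (abs_nonneg x) ε
    simpa using (by positivity)
  · push Not at h
    have h0 : 0 < |x| := hs.trans h
    rw [sub_zero]
    calc |x| = |x| ^ (1 - ε) * |x| ^ ε := by rw [← Real.rpow_add h0]; simp
      _ ≤ _ := mul_le_mul_of_nonneg_right (Real.rpow_le_rpow_of_nonpos hs h.le (by linarith))
        (Real.rpow_nonneg h0.le _)

/-! ### Heavy-tailed loss distributions -/

section Loss

variable {Ω : Type*} [MeasurableSpace Ω] {ν : Measure Ω} [IsProbabilityMeasure ν] {ε σ : ℝ}
  {Y : Ω → ℝ} (hY : Measurable Y) (hε : 1 < ε) (hσ : 0 < σ)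
  (hm : ∫⁻ y, ENNReal.ofReal (|Y y| ^ ε) ∂ν ≤ ENNReal.ofReal σ)

omit [IsProbabilityMeasure ν] in
include hY hm in
lemma integrable_abs_rpow : Integrable (fun y => |Y y| ^ ε) ν := by
  refine ⟨(hY.abs.pow_const ε).aestronglyMeasurable, ?_⟩
  rw [hasFiniteIntegral_iff_ofReal (Filter.Eventually.of_forall fun y =>
    Real.rpow_nonneg (abs_nonneg _) _)]
  exact hm.trans_lt ENNReal.ofReal_lt_top

omit [IsProbabilityMeasure ν] in
include hY hσ hm in
lemma integral_abs_rpow_le : ∫ y, |Y y| ^ ε ∂ν ≤ σ := by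
  rw [integral_eq_lintegral_of_nonneg_ae (Filter.Eventually.of_forall fun y =>
    Real.rpow_nonneg (abs_nonneg _) _) (hY.abs.pow_const ε).aestronglyMeasurable]
  exact ENNReal.toReal_le_of_le_ofReal hσ.le hm

/-- Clipping at `σ^{1/ε}`, the natural scale of the losses, makes both parts have mean at most
`σ^{1/ε}`. -/
lemma abs_le_of_rpow (hε : 1 < ε) (hσ : 0 < σ) (x : ℝ) :
    |x| ≤ σ ^ (1 / ε) + (σ ^ (1 / ε)) ^ (1 - ε) * |x| ^ ε := by
  have hs := Real.rpow_pos_of_pos hσ (1 / ε)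
  have h1 := abs_clip_le hs.le x
  have h2 := abs_sub_clip_le (x := x) hs hε
  have h3 := abs_add_le (clip (σ ^ (1 / ε)) x) (x - clip (σ ^ (1 / ε)) x)
  rw [add_sub_cancel] at h3
  linarith

include hY hε hσ hm in
lemma integrable_of_moment : Integrable Y ν := by
  refine Integrable.mono' ((integrable_const (σ ^ (1 / ε))).add ((integrable_abs_rpow hY hm).const_mul
    ((σ ^ (1 / ε)) ^ (1 - ε)))) hY.aestronglyMeasurable
    (Filter.Eventually.of_forall fun y => abs_le_of_rpow hε hσ _)

include hY hε hσ hm in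
lemma integral_abs_le : ∫ y, |Y y| ∂ν ≤ 2 * σ ^ (1 / ε) := by
  have hi := integrable_abs_rpow hY hm
  have hs := Real.rpow_pos_of_pos hσ (1 / ε)
  calc ∫ y, |Y y| ∂ν ≤ ∫ y, (σ ^ (1 / ε) + (σ ^ (1 / ε)) ^ (1 - ε) * |Y y| ^ ε) ∂ν :=
        integral_mono (integrable_of_moment hY hε hσ hm).abs
          ((integrable_const _).add (hi.const_mul _)) fun y => abs_le_of_rpow hε hσ _
    _ = σ ^ (1 / ε) + (σ ^ (1 / ε)) ^ (1 - ε) * ∫ y, |Y y| ^ ε ∂ν := by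
        rw [integral_add (integrable_const _) (hi.const_mul _), integral_const_mul]; simp
    _ ≤ σ ^ (1 / ε) + (σ ^ (1 / ε)) ^ (1 - ε) * (σ ^ (1 / ε)) ^ ε := by
        have h1 : (σ ^ (1 / ε)) ^ ε = σ := by
          rw [← Real.rpow_mul hσ.le, one_div_mul_cancel (by linarith), Real.rpow_one]
        rw [h1]
        gcongr
        exact integral_abs_rpow_le hY hσ hm
    _ = _ := by rw [← Real.rpow_add hs]; simp; ring

omit [IsProbabilityMeasure ν] in
lemma integral_linear_combination {A B C D E : Ω → ℝ} (hA : Integrable A ν) (hB : Integrable B ν)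
    (hC : Integrable C ν) (hD : Integrable D ν) (hE : Integrable E ν) (k : ℝ) :
    ∫ y, (A y - B y + (C y - D y + k * E y)) ∂ν =
      ∫ y, A y ∂ν - ∫ y, B y ∂ν + (∫ y, C y ∂ν - ∫ y, D y ∂ν + k * ∫ y, E y ∂ν) := by
  have h1 : Integrable (fun y => A y - B y) ν := hA.sub hB
  have h2 : Integrable (fun y => C y - D y) ν := hC.sub hD
  have h3 : Integrable (fun y => C y - D y + k * E y) ν := h2.add (hE.const_mul k)
  rw [integral_add h1 h3, integral_add h2 (hE.const_mul k), integral_sub hA hB, integral_sub hC hD,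
    integral_const_mul]

lemma integrable_clip {s : ℝ} (hs : 0 ≤ s) (hY : Measurable Y) (c : ℝ) :
    Integrable (fun y => clip s (c * Y y)) ν :=
  Integrable.of_bound ((measurable_clip s).comp (hY.const_mul c)).aestronglyMeasurable s
    (Filter.Eventually.of_forall fun _ => abs_clip_le hs _)

lemma integrable_clip_sq {s : ℝ} (hs : 0 ≤ s) (hY : Measurable Y) (c : ℝ) :
    Integrable (fun y => clip s (c * Y y) ^ 2) ν :=
  Integrable.of_bound (((measurable_clip s).comp (hY.const_mul c)).pow_const 2).aestronglyMeasurable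
    (s ^ 2) (Filter.Eventually.of_forall fun _ => by
      rw [norm_pow]; exact pow_le_pow_left₀ (norm_nonneg _) (abs_clip_le hs _) 2)

include hY hε hσ hm in
lemma integral_clip_sq_le {s : ℝ} (hs : 0 < s) (h2 : ε ≤ 2) (c : ℝ) :
    ∫ y, clip s (c * Y y) ^ 2 ∂ν ≤ s ^ (2 - ε) * (|c| ^ ε * σ) := by
  calc ∫ y, clip s (c * Y y) ^ 2 ∂ν ≤ ∫ y, s ^ (2 - ε) * |c| ^ ε * |Y y| ^ ε ∂ν := by
        refine integral_mono (integrable_clip_sq hs.le hY c)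
          ((integrable_abs_rpow hY hm).const_mul _) fun y => ?_
        refine (clip_sq_le hs hε h2).trans (le_of_eq ?_)
        rw [abs_mul, Real.mul_rpow (abs_nonneg _) (abs_nonneg _), mul_assoc]
    _ = s ^ (2 - ε) * |c| ^ ε * ∫ y, |Y y| ^ ε ∂ν := integral_const_mul _ _
    _ ≤ s ^ (2 - ε) * |c| ^ ε * σ := mul_le_mul_of_nonneg_left (integral_abs_rpow_le hY hσ hm)
        (mul_nonneg (Real.rpow_nonneg hs.le _) (Real.rpow_nonneg (abs_nonneg _) _))
    _ = _ := mul_assoc _ _ _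

include hY hε hσ hm in
lemma abs_integral_sub_clip_le {s : ℝ} (hs : 0 < s) (c : ℝ) :
    |c * ∫ y, Y y ∂ν - ∫ y, clip s (c * Y y) ∂ν| ≤ s ^ (1 - ε) * (|c| ^ ε * σ) := by
  have hi := integrable_of_moment hY hε hσ hm
  rw [← integral_const_mul, ← integral_sub (hi.const_mul c) (integrable_clip hs.le hY c)]
  calc _ ≤ ∫ y, |c * Y y - clip s (c * Y y)| ∂ν := abs_integral_le_integral_abs
    _ ≤ ∫ y, s ^ (1 - ε) * |c| ^ ε * |Y y| ^ ε ∂ν := by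
        refine integral_mono ((hi.const_mul c).sub (integrable_clip hs.le hY c)).abs
          ((integrable_abs_rpow hY hm).const_mul _) fun y => ?_
        refine (abs_sub_clip_le hs hε).trans (le_of_eq ?_)
        rw [abs_mul, Real.mul_rpow (abs_nonneg _) (abs_nonneg _), mul_assoc]
    _ = s ^ (1 - ε) * |c| ^ ε * ∫ y, |Y y| ^ ε ∂ν := integral_const_mul _ _
    _ ≤ s ^ (1 - ε) * |c| ^ ε * σ := mul_le_mul_of_nonneg_left (integral_abs_rpow_le hY hσ hm)
        (mul_nonneg (Real.rpow_nonneg hs.le _) (Real.rpow_nonneg (abs_nonneg _) _))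
    _ = _ := mul_assoc _ _ _

end Loss

/-! ### The expected regret of one round -/

namespace Params

variable {K d : ℕ} {P : Params K d} {c₁ c₂ : ℝ} {T : ℕ} (hP : P.Admissible c₁ c₂ T)
include hP

/-- The conditional expectation of the instantaneous regret is controlled by the change of the
linearized potential. -/
lemma expected_round_le {S : State K} (hS : 0 < S.2) (hγ : P.γ S ≤ 1 / 2)
    (ν : Measure (Fin K → ℝ)) [IsProbabilityMeasure ν] (θ : Fin d → ℝ)
    (hmean : ∀ a, ∫ y, y a ∂ν = P.φ a ⬝ᵥ θ)
    (hmom : ∀ a, ∫⁻ y, ENNReal.ofReal (|y a| ^ P.ε) ∂ν ≤ ENNReal.ofReal P.σ) (a' : Fin K) :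
    (∀ b, Integrable (fun y => y b - y a' + (P.increment S (b, y b) a' -
      ∑ a, P.q S a * P.increment S (b, y b) a +
      1 / (2 * P.s S) * ∑ a, P.q S a * P.increment S (b, y b) a ^ 2)) ν) ∧
    ∑ b, P.p S b * ∫ y, (y b - y a' + (P.increment S (b, y b) a' -
      ∑ a, P.q S a * P.increment S (b, y b) a +
      1 / (2 * P.s S) * ∑ a, P.q S a * P.increment S (b, y b) a ^ 2)) ∂ν ≤ 1024 * P.cost S := by
  have hσ := hP.σ_pos
  have hε1 := hP.one_lt_ε
  have hε2 := hP.ε_le_two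
  have hs := s_pos hP hS
  have hpm := p_mem hP hS hγ
  have hqm := (q_spec hP S).1
  have hqpos := q_pos hP hS
  have hV := cov_p_posDef hP hS hγ
  have hb0 := bonus_nonneg hP hS hγ
  have hbs := bonus_le_s hP hS hγ
  set p := P.p S with hp
  set q := P.q S
  set s := P.s S with hsdef
  set G := gram P.φ p with hG
  set m : Fin K → ℝ := fun a => P.φ a ⬝ᵥ θ with hmdef
  have hmeas : ∀ a, Measurable fun y : Fin K → ℝ => y a := fun a => measurable_pi_apply a
  have hint : ∀ a, Integrable (fun y : Fin K → ℝ => y a) ν := fun a =>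
    integrable_of_moment (hmeas a) hε1 hσ (hmom a)
  set C : Fin K → Fin K → ℝ := fun a b => ∫ y, clip s (G a b * y b) ∂ν with hC
  set D : Fin K → Fin K → ℝ := fun a b => ∫ y, clip s (G a b * y b) ^ 2 ∂ν with hD
  have hinc : ∀ (a b : Fin K) (y : Fin K → ℝ), P.increment S (b, y b) a =
      clip s (G a b * y b) - P.bonus S a := fun a b y => rfl
  have hiC : ∀ a b, Integrable (fun y : Fin K → ℝ => clip s (G a b * y b)) ν := fun a b =>
    integrable_clip hs.le (hmeas b) _
  have hiD : ∀ a b, Integrable (fun y : Fin K → ℝ => clip s (G a b * y b) ^ 2) ν := fun a b =>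
    integrable_clip_sq hs.le (hmeas b) _
  -- integration of one summand
  have hsq : ∀ a b, Integrable (fun y : Fin K → ℝ => P.increment S (b, y b) a ^ 2) ν ∧
      ∫ y, P.increment S (b, y b) a ^ 2 ∂ν ≤ 2 * D a b + 2 * P.bonus S a ^ 2 := fun a b => by
    have hi1 : Integrable (fun y : Fin K → ℝ => P.increment S (b, y b) a ^ 2) ν := by
      have : (fun y : Fin K → ℝ => P.increment S (b, y b) a ^ 2) = fun y =>
          clip s (G a b * y b) ^ 2 - 2 * P.bonus S a * clip s (G a b * y b) + P.bonus S a ^ 2 := by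
        funext y; rw [hinc]; ring
      rw [this]
      exact ((hiD a b).sub ((hiC a b).const_mul _)).add (integrable_const _)
    refine ⟨hi1, ?_⟩
    have h2 : 2 * D a b + 2 * P.bonus S a ^ 2 =
        ∫ y : Fin K → ℝ, (2 * clip s (G a b * y b) ^ 2 + 2 * P.bonus S a ^ 2) ∂ν := by
      rw [integral_add ((hiD a b).const_mul 2) (integrable_const _), integral_const_mul]; simp [hD]
    rw [h2]
    refine integral_mono hi1 (((hiD a b).const_mul 2).add (integrable_const _)) fun y => ?_
    simp only [hinc]
    nlinarith [sq_nonneg (clip s (G a b * y b) + P.bonus S a)]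
  have hlin : ∀ a b, Integrable (fun y : Fin K → ℝ => P.increment S (b, y b) a) ν ∧
      ∫ y, P.increment S (b, y b) a ∂ν = C a b - P.bonus S a := fun a b => by
    simp only [hinc]
    refine ⟨(hiC a b).sub (integrable_const _), ?_⟩
    rw [integral_sub (hiC a b) (integrable_const _)]; simp [hC]
  have i1 : ∀ b, Integrable (fun y : Fin K → ℝ => ∑ a, q a * P.increment S (b, y b) a) ν := fun b =>
    integrable_finsetSum _ fun a _ => (hlin a b).1.const_mul _
  have i2 : ∀ b, Integrable (fun y : Fin K → ℝ => ∑ a, q a * P.increment S (b, y b) a ^ 2) ν :=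
    fun b => integrable_finsetSum _ fun a _ => (hsq a b).1.const_mul _
  refine ⟨fun b => ((hint b).sub (hint a')).add (((hlin a' b).1.sub (i1 b)).add
    ((i2 b).const_mul _)), ?_⟩
  have hround : ∀ b, ∫ y, (y b - y a' + (P.increment S (b, y b) a' -
      ∑ a, q a * P.increment S (b, y b) a +
      1 / (2 * s) * ∑ a, q a * P.increment S (b, y b) a ^ 2)) ∂ν ≤
      m b - m a' + ((C a' b - P.bonus S a') - ∑ a, q a * (C a b - P.bonus S a) +
        1 / (2 * s) * ∑ a, q a * (2 * D a b + 2 * P.bonus S a ^ 2)) := fun b => by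
    rw [integral_linear_combination (hint b) (hint a') (hlin a' b).1 (i1 b) (i2 b),
      integral_finsetSum _ fun a _ => (hlin a b).1.const_mul _,
      integral_finsetSum _ fun a _ => (hsq a b).1.const_mul _, hmean, hmean, (hlin a' b).2]
    simp only [integral_const_mul, (hlin _ b).2]
    gcongr with a _
    · exact (hqpos a).le
    · exact (hsq a b).2
  refine (Finset.sum_le_sum fun b _ => mul_le_mul_of_nonneg_left (hround b) (hpm.1 b)).trans ?_
  -- averages over the pulled arm
  have hbonus : ∀ a, ∑ b, p b * (|G a b| ^ P.ε * P.σ) = P.bonus S a * s ^ (P.ε - 1) := fun a => by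
    have h1 : P.bonus S a = P.σ * (∑ b, p b * |G a b| ^ P.ε) * s ^ (1 - P.ε) := rfl
    have h2 : s ^ (1 - P.ε) * s ^ (P.ε - 1) = 1 := by rw [← Real.rpow_add hs]; simp
    rw [h1, mul_assoc, h2, mul_one, Finset.mul_sum]
    exact Finset.sum_congr rfl fun b _ => by ring
  -- Up to the common shift `⟨μ(p), θ⟩` the only bias is that of clipping, and the bonus is its
  -- upper bound.
  have hbias : ∀ a, |(m a - meanFeature P.φ p ⬝ᵥ θ) - ∑ b, p b * C a b| ≤ P.bonus S a :=
      fun a => by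
    have h1 := sum_gram_mul_dot hV hpm.2 a θ
    rw [sub_dotProduct] at h1
    have h1' : m a - meanFeature P.φ p ⬝ᵥ θ = ∑ b, p b * (G a b * m b) := h1.symm
    rw [h1', ← Finset.sum_sub_distrib]
    refine (Finset.abs_sum_le_sum_abs _ _).trans ?_
    have h2 : ∀ b, |p b * (G a b * m b) - p b * C a b| ≤
        s ^ (1 - P.ε) * (p b * (|G a b| ^ P.ε * P.σ)) := fun b => by
      rw [← mul_sub, abs_mul, abs_of_nonneg (hpm.1 b)]
      have := abs_integral_sub_clip_le (hmeas b) hε1 hσ (hmom b) hs (G a b)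
      rw [hmean] at this
      calc _ ≤ p b * (s ^ (1 - P.ε) * (|G a b| ^ P.ε * P.σ)) :=
            mul_le_mul_of_nonneg_left this (hpm.1 b)
        _ = _ := by ring
    refine (Finset.sum_le_sum fun b _ => h2 b).trans (le_of_eq ?_)
    rw [← Finset.mul_sum, hbonus, mul_left_comm, ← Real.rpow_add hs]; simp
  -- The second moment of the clipped estimate is bounded by the same sum as the bias, with one more
  -- factor `s`; thus the bonus controls the variance as well.
  have hvar : ∀ a, ∑ b, p b * D a b ≤ s * P.bonus S a := fun a => by
    have h2 : ∀ b, p b * D a b ≤ s ^ (2 - P.ε) * (p b * (|G a b| ^ P.ε * P.σ)) := fun b => by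
      have := integral_clip_sq_le (hmeas b) hε1 hσ (hmom b) hs hε2 (G a b)
      calc _ ≤ p b * (s ^ (2 - P.ε) * (|G a b| ^ P.ε * P.σ)) :=
            mul_le_mul_of_nonneg_left this (hpm.1 b)
        _ = _ := by ring
    refine (Finset.sum_le_sum fun b _ => h2 b).trans (le_of_eq ?_)
    rw [← Finset.mul_sum, hbonus, mul_left_comm, ← Real.rpow_add hs, mul_comm]
    ring_nf; simp [mul_comm]
  have hmabs : ∀ a, |m a| ≤ 2 * P.σ ^ (1 / P.ε) := fun a => by
    have h1 := integral_abs_le (hmeas a) hε1 hσ (hmom a)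
    have h2 : |∫ y : Fin K → ℝ, y a ∂ν| ≤ ∫ y : Fin K → ℝ, |y a| ∂ν :=
      abs_integral_le_integral_abs
    rw [hmean] at h2
    exact h2.trans h1
  -- exploration
  have hγ0 := γ_pos hP hS
  have hexpl : ∑ b, p b * m b ≤ ∑ a, q a * m a + 4 * P.γ S * P.σ ^ (1 / P.ε) := by
    have e : ∑ b, p b * m b = ∑ a, q a * m a +
        P.γ S * (∑ a, P.p₀ a * m a - ∑ a, q a * m a) := by
      rw [← Finset.sum_sub_distrib, Finset.mul_sum, ← Finset.sum_add_distrib]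
      refine Finset.sum_congr rfl fun a _ => ?_
      have : p a = (1 - P.γ S) * q a + P.γ S * P.p₀ a := rfl
      rw [this]; ring
    have h1 : ∑ a, P.p₀ a * m a ≤ 2 * P.σ ^ (1 / P.ε) := by
      calc _ ≤ ∑ a, P.p₀ a * (2 * P.σ ^ (1 / P.ε)) := Finset.sum_le_sum fun a _ =>
            mul_le_mul_of_nonneg_left (abs_le.1 (hmabs a)).2 (hP.p₀_mem.1 a)
        _ = _ := by rw [← Finset.sum_mul, hP.p₀_mem.2, one_mul]
    have h2 : -(2 * P.σ ^ (1 / P.ε)) ≤ ∑ a, q a * m a := by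
      calc _ = ∑ a, q a * -(2 * P.σ ^ (1 / P.ε)) := by rw [← Finset.sum_mul, hqm.2, one_mul]
        _ ≤ _ := Finset.sum_le_sum fun a _ =>
            mul_le_mul_of_nonneg_left (abs_le.1 (hmabs a)).1 (hqm.1 a)
    rw [e]
    nlinarith
  have hw := w_div_eq hP hS
  have hqb := sum_q_bonus_le hP hS hγ
  have hz := mul_nonneg (Real.rpow_nonneg hS.le (1 - P.ε)) (z_nonneg hP hS hγ)
  -- rearrangement
  have hswap : ∀ F : Fin K → Fin K → ℝ, ∑ b, p b * ∑ a, q a * F a b =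
      ∑ a, q a * ∑ b, p b * F a b := fun F => by
    simp only [Finset.mul_sum]
    rw [Finset.sum_comm]
    exact Finset.sum_congr rfl fun a _ => Finset.sum_congr rfl fun b _ => by ring
  have hconst : ∀ c : ℝ, ∑ b, p b * c = c := fun c => by rw [← Finset.sum_mul, hpm.2, one_mul]
  have hexpand : ∑ b, p b * (m b - m a' + ((C a' b - P.bonus S a') -
      ∑ a, q a * (C a b - P.bonus S a) +
        1 / (2 * s) * ∑ a, q a * (2 * D a b + 2 * P.bonus S a ^ 2))) =
      ∑ b, p b * m b - m a' + (∑ b, p b * C a' b - P.bonus S a') -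
        ∑ a, q a * (∑ b, p b * C a b - P.bonus S a) +
        1 / (2 * s) * ∑ a, q a * (2 * ∑ b, p b * D a b + 2 * P.bonus S a ^ 2) := by
    have e1 : ∀ b, p b * (m b - m a' + ((C a' b - P.bonus S a') -
        ∑ a, q a * (C a b - P.bonus S a) +
        1 / (2 * s) * ∑ a, q a * (2 * D a b + 2 * P.bonus S a ^ 2))) =
        p b * m b - p b * m a' + (p b * C a' b - p b * P.bonus S a') -
        p b * ∑ a, q a * (C a b - P.bonus S a) +
        1 / (2 * s) * (p b * ∑ a, q a * (2 * D a b + 2 * P.bonus S a ^ 2)) := fun b => by ring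
    have e2 : ∀ a, ∑ b, p b * (C a b - P.bonus S a) = ∑ b, p b * C a b - P.bonus S a := fun a => by
      simp only [mul_sub, Finset.sum_sub_distrib, hconst]
    have e3 : ∀ a, ∑ b, p b * (2 * D a b + 2 * P.bonus S a ^ 2) =
        2 * ∑ b, p b * D a b + 2 * P.bonus S a ^ 2 := fun a => by
      simp only [mul_add, Finset.sum_add_distrib, hconst, mul_left_comm _ (2 : ℝ),
        ← Finset.mul_sum]
    simp only [e1, Finset.sum_add_distrib, Finset.sum_sub_distrib, hconst, ← Finset.mul_sum, hswap,
      e2, e3]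
  rw [hexpand]
  have hvarsum : 1 / (2 * s) * ∑ a, q a * (2 * ∑ b, p b * D a b + 2 * P.bonus S a ^ 2) ≤
      2 * ∑ a, q a * P.bonus S a := by
    have h1 : ∑ a, q a * (2 * ∑ b, p b * D a b + 2 * P.bonus S a ^ 2) ≤
        ∑ a, q a * (4 * s * P.bonus S a) := by
      refine Finset.sum_le_sum fun a _ => mul_le_mul_of_nonneg_left ?_ (hqm.1 a)
      nlinarith [hvar a, mul_le_mul_of_nonneg_right (hbs a) (hb0 a)]
    have h2 : ∑ a, q a * (4 * s * P.bonus S a) = 4 * s * ∑ a, q a * P.bonus S a := by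
      rw [Finset.mul_sum]; exact Finset.sum_congr rfl fun a _ => by ring
    rw [h2] at h1
    calc _ ≤ 1 / (2 * s) * (4 * s * ∑ a, q a * P.bonus S a) :=
          mul_le_mul_of_nonneg_left h1 (by positivity)
      _ = _ := by field_simp; ring
  have hbiassum : ∑ a, q a * m a - meanFeature P.φ p ⬝ᵥ θ -
      ∑ a, q a * (∑ b, p b * C a b - P.bonus S a) ≤ 2 * ∑ a, q a * P.bonus S a := by
    have : ∑ a, q a * m a - meanFeature P.φ p ⬝ᵥ θ -
        ∑ a, q a * (∑ b, p b * C a b - P.bonus S a) =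
        ∑ a, q a * ((m a - meanFeature P.φ p ⬝ᵥ θ) - ∑ b, p b * C a b + P.bonus S a) := by
      simp only [mul_add, mul_sub, Finset.sum_add_distrib, Finset.sum_sub_distrib, ← Finset.sum_mul,
        hqm.2]
      ring
    rw [this, Finset.mul_sum]
    refine Finset.sum_le_sum fun a _ => ?_
    have h1 := mul_le_mul_of_nonneg_left (abs_le.1 (hbias a)).2 (hqm.1 a)
    rw [mul_add]; linarith
  -- For the comparator the bonus cancels the bias with the right sign. What remains is `4 ∑ q b ≤
  -- 256 β^{1-ε} z` from bias and variance, and `4 γ σ^{1/ε} = 1024 w / β²` from exploration.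
  have hbiasa := (abs_le.1 (hbias a')).1
  unfold cost
  linarith

end Params

lemma continuous_meanFeature {K d : ℕ} (φ : Fin K → Fin d → ℝ) : Continuous (meanFeature φ) := by
  unfold meanFeature
  exact continuous_finsetSum _ fun a _ => (continuous_apply a).smul continuous_const

lemma continuous_covFeature {K d : ℕ} (φ : Fin K → Fin d → ℝ) : Continuous (covFeature φ) := by
  have hm := continuous_meanFeature φ
  refine continuous_finsetSum _ fun a _ => (continuous_apply a).smul ?_
  exact (continuous_const.sub hm).matrix_vecMulVec (continuous_const.sub hm)

/-- Inversion is discontinuous at singular matrices, but the inverse is the adjugate divided by the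
determinant, which is measurable everywhere. -/
lemma measurable_gram {K d : ℕ} (φ : Fin K → Fin d → ℝ) (a b : Fin K) :
    Measurable fun p => gram φ p a b := by
  have hm := continuous_meanFeature φ
  have hc := continuous_covFeature φ
  have e : (fun p => gram φ p a b) = fun p => ((covFeature φ p).det)⁻¹ *
      ((φ a - meanFeature φ p) ⬝ᵥ ((covFeature φ p).adjugate *ᵥ (φ b - meanFeature φ p))) := by
    funext p
    rw [gram, Matrix.inv_def, Ring.inverse_eq_inv', Matrix.smul_mulVec, dotProduct_smul,
      smul_eq_mul]
  rw [e]
  refine hc.matrix_det.measurable.inv.mul (Continuous.measurable ?_)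
  exact (continuous_const.sub hm).dotProduct
    (hc.matrix_adjugate.matrix_mulVec (continuous_const.sub hm))

namespace Params

variable {K d : ℕ} {P : Params K d} {c₁ c₂ : ℝ} {T : ℕ} (hP : P.Admissible c₁ c₂ T)
include hP

/-! ### Continuity in the state -/

lemma continuousOn_q : ContinuousOn P.q {S : State K | 0 < S.2} := fun _ hS =>
  (continuousAt_q hP hS).continuousWithinAt

lemma continuousOn_qStar : ContinuousOn (fun S : State K => qStar (P.q S)) {S | 0 < S.2} := by
  have := (continuousOn_q hP).norm
  unfold qStar
  exact this.inf (continuousOn_const.sub this)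

lemma continuousOn_qStar_rpow (ρ : ℝ) :
    ContinuousOn (fun S : State K => qStar (P.q S) ^ ρ) {S | 0 < S.2} :=
  (continuousOn_qStar hP).rpow_const fun _ hS => Or.inl (hP.qStar_pos hS).ne'

omit hP in
lemma continuousOn_rate : ContinuousOn (fun S : State K => S.2) {S : State K | 0 < S.2} :=
  continuous_snd.continuousOn

lemma continuousOn_γ : ContinuousOn P.γ {S | 0 < S.2} := by
  unfold γ
  refine ContinuousOn.mul (ContinuousOn.div continuousOn_const (continuousOn_rate.pow 2) ?_)
    (continuousOn_qStar_rpow hP _)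
  intro S (hS : 0 < S.2)
  positivity

lemma continuousOn_s : ContinuousOn P.s {S | 0 < S.2} := by
  unfold s
  exact ((continuousOn_const.mul continuousOn_rate).mul (continuousOn_qStar_rpow hP _)).div_const _

lemma continuousOn_p : ContinuousOn P.p {S | 0 < S.2} := by
  unfold p
  exact ((continuousOn_const.sub (continuousOn_γ hP)).smul (continuousOn_q hP)).add
    ((continuousOn_γ hP).smul continuousOn_const)

lemma continuousOn_h : ContinuousOn P.h {S | 0 < S.2} := by
  unfold h
  exact ((continuous_tsallis hP.α_pos).comp_continuousOn (continuousOn_q hP)).neg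

lemma continuousOn_z : ContinuousOn P.z {S | 0 < S.2} := by
  unfold z
  refine ((continuousOn_const.mul (continuousOn_qStar_rpow hP _)).mul continuousOn_const).mul ?_
  exact (continuousOn_const.sub (continuousOn_p hP).norm).rpow_const fun S _ =>
    Or.inr (by linarith [hP.ε_le_two])

lemma continuousOn_w : ContinuousOn P.w {S | 0 < S.2} := by
  unfold w
  exact continuousOn_const.mul (continuousOn_qStar_rpow hP _)

lemma continuousOn_cost : ContinuousOn P.cost {S | 0 < S.2} := by
  unfold cost
  refine ((continuousOn_rate.rpow_const fun S hS => Or.inl (ne_of_gt hS)).mul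
    (continuousOn_z hP)).add ((continuousOn_w hP).div (continuousOn_rate.pow 2) ?_)
  intro S (hS : 0 < S.2)
  positivity

lemma continuousOn_rate_increment :
    ContinuousOn (fun S => 1 / P.h S * P.cost S) {S | 0 < S.2} :=
  (continuousOn_const.div (continuousOn_h hP) fun _ hS => (h_pos hP hS).ne').mul
    (continuousOn_cost hP)

lemma continuousOn_potential (a : Fin K) : ContinuousOn (P.potential a) {S | 0 < S.2} := by
  unfold potential
  refine ContinuousOn.sub (Continuous.continuousOn ?_)
    ((continuous_objective hP).comp_continuousOn (continuousOn_id.prodMk (continuousOn_q hP)))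
  exact (continuous_apply a).comp continuous_fst

/-! ### Invariants of the state sequence -/

lemma β₁_le_state {t : ℕ} (ht : t ≤ T) (o : Obs K t) : P.β₁ ≤ (P.state t o).2 := by
  induction t with
  | zero => exact le_rfl
  | succ t ih =>
    have h1 := ih (by omega) fun i => o i.castSucc
    have hS : 0 < (P.state t fun i => o i.castSucc).2 := hP.β₁_pos.trans_le h1
    have h2 := cost_nonneg hP hS (hP.γ_le_half t (by omega) _)
    have h3 := h_pos hP hS
    have h4 : 0 ≤ 1 / P.h (P.state t fun i => o i.castSucc) *
      P.cost (P.state t fun i => o i.castSucc) := by positivity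
    have h5 : (P.state (t + 1) o).2 = (P.state t fun i => o i.castSucc).2 +
      1 / P.h (P.state t fun i => o i.castSucc) * P.cost (P.state t fun i => o i.castSucc) := rfl
    linarith

lemma state_pos {t : ℕ} (ht : t ≤ T) (o : Obs K t) : 0 < (P.state t o).2 :=
  hP.β₁_pos.trans_le (β₁_le_state hP ht o)

omit hP in
lemma isCompact_box (β R : ℝ) :
    IsCompact (Metric.closedBall (0 : Fin K → ℝ) R ×ˢ Icc β R : Set (State K)) :=
  (isCompact_closedBall _ _).prod isCompact_Icc

lemma exists_bound_on_box {f : State K → ℝ} (hf : ContinuousOn f {S | 0 < S.2}) (R : ℝ) :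
    ∃ M, 0 ≤ M ∧ ∀ S : State K, ‖S.1‖ ≤ R → P.β₁ ≤ S.2 → S.2 ≤ R → |f S| ≤ M := by
  obtain ⟨M, hM⟩ := (isCompact_box P.β₁ R).exists_bound_of_continuousOn
    (hf.mono fun S hS => hP.β₁_pos.trans_le hS.2.1)
  exact ⟨max M 0, le_max_right _ _, fun S h1 h2 h3 =>
    (hM S ⟨mem_closedBall_zero_iff.2 h1, h2, h3⟩).trans (le_max_left _ _)⟩

/-- In one round the estimates move by at most `2 s` and the rate by cost over entropy, which are
continuous and hence bounded on the compact box reached so far. Clipping makes the bound uniform in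
the observed losses, so continuous functions of the state are integrable. -/
lemma exists_state_bound {t : ℕ} (ht : t ≤ T) :
    ∃ R, ∀ o : Obs K t, ‖(P.state t o).1‖ ≤ R ∧ (P.state t o).2 ≤ R := by
  induction t with
  | zero =>
    refine ⟨P.β₁, fun o => ⟨?_, le_rfl⟩⟩
    show ‖(0 : Fin K → ℝ)‖ ≤ P.β₁
    rw [norm_zero]; exact hP.β₁_pos.le
  | succ t ih =>
    obtain ⟨R, hR⟩ := ih (by omega)
    obtain ⟨M₁, h0₁, hM₁⟩ := exists_bound_on_box hP (continuousOn_s hP) R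
    obtain ⟨M₂, h0₂, hM₂⟩ := exists_bound_on_box hP (continuousOn_rate_increment hP) R
    refine ⟨R + 2 * M₁ + M₂, fun o => ?_⟩
    obtain ⟨hR1, hR2⟩ := hR fun i => o i.castSucc
    set S := P.state t fun i => o i.castSucc
    have hβ := β₁_le_state hP (by omega : t ≤ T) fun i => o i.castSucc
    have hS := state_pos hP (by omega : t ≤ T) fun i => o i.castSucc
    have hγ := hP.γ_le_half t (by omega) fun i => o i.castSucc
    have hs := (le_abs_self _).trans (hM₁ S hR1 hβ hR2)
    have hr := (le_abs_self _).trans (hM₂ S hR1 hβ hR2)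
    have e1 : P.state (t + 1) o = P.next S (o (Fin.last t)) := rfl
    constructor
    · have hR0 : 0 ≤ R := (norm_nonneg _).trans hR1
      refine (pi_norm_le_iff_of_nonneg (by positivity)).2 fun a => ?_
      have h1 : (P.state (t + 1) o).1 a = S.1 a + P.increment S (o (Fin.last t)) a := rfl
      have h2 := abs_increment_le hP hS hγ (o (Fin.last t)) a
      have h3 : ‖S.1 a‖ ≤ R := (norm_le_pi_norm _ a).trans hR1
      rw [h1]
      refine (norm_add_le _ _).trans ?_
      have h4 : ‖P.increment S (o (Fin.last t)) a‖ ≤ 2 * P.s S := h2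
      linarith
    · have h1 : (P.state (t + 1) o).2 = S.2 + 1 / P.h S * P.cost S := rfl
      rw [h1]
      linarith

lemma exists_bound {t : ℕ} (ht : t ≤ T) {f : State K → ℝ} (hf : ContinuousOn f {S | 0 < S.2}) :
    ∃ M, 0 ≤ M ∧ ∀ o : Obs K t, |f (P.state t o)| ≤ M := by
  obtain ⟨R, hR⟩ := exists_state_bound hP ht
  obtain ⟨M, h0, hM⟩ := exists_bound_on_box hP hf R
  exact ⟨M, h0, fun o => hM _ (hR o).1 (β₁_le_state hP ht o) (hR o).2⟩

/-! ### Measurability -/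

section Measurability

variable {X : Type*} [MeasurableSpace X] {S : X → State K} (hSm : Measurable S)
  (hSpos : ∀ x, 0 < (S x).2)

omit hP in
include hSm hSpos in
lemma measurable_comp_state {Y : Type*} [TopologicalSpace Y] [MeasurableSpace Y] [BorelSpace Y]
    {f : State K → Y} (hf : ContinuousOn f {S | 0 < S.2}) : Measurable fun x => f (S x) :=
  (continuousOn_iff_continuous_domRestrict.1 hf).measurable.comp
    (hSm.subtype_mk (h := fun x => hSpos x))

include hSm hSpos in
lemma measurable_bonus (a : Fin K) : Measurable fun x => P.bonus (S x) a := by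
  have hp := measurable_comp_state hSm hSpos (continuousOn_p hP)
  have hs := measurable_comp_state hSm hSpos (continuousOn_s hP)
  unfold bonus
  refine (measurable_const.mul (Finset.measurable_sum _ fun b _ => ?_)).mul (hs.pow_const _)
  exact ((measurable_pi_apply b).comp hp).mul
    (((measurable_gram P.φ a b).comp hp).abs.pow_const _)

include hSm hSpos in
lemma measurable_next {o : X → Fin K × ℝ} (ho : Measurable o) :
    Measurable fun x => P.next (S x) (o x) := by
  have hp := measurable_comp_state hSm hSpos (continuousOn_p hP)
  have hs := measurable_comp_state hSm hSpos (continuousOn_s hP)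
  have hr := measurable_comp_state hSm hSpos (continuousOn_rate_increment hP)
  have hest : ∀ a, Measurable fun x => P.lossEst (S x) (o x) a := fun a => by
    have h1 : Measurable fun y : Fin K × (Fin K → ℝ) => gram P.φ y.2 a y.1 :=
      measurable_from_prod_countable_right fun b => measurable_gram P.φ a b
    exact (h1.comp ((measurable_fst.comp ho).prodMk hp)).mul (measurable_snd.comp ho)
  have hclip : ∀ a, Measurable fun x => P.clippedEst (S x) (o x) a := fun a =>
    Measurable.ite (measurableSet_le (hest a).abs hs) (hest a) measurable_const
  have h1 : Measurable fun x => (P.next (S x) (o x)).1 := measurable_pi_lambda _ fun a =>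
    ((measurable_pi_apply a).comp (measurable_fst.comp hSm)).add
      ((hclip a).sub (measurable_bonus hP hSm hSpos a))
  have h2 : Measurable fun x => (P.next (S x) (o x)).2 := (measurable_snd.comp hSm).add hr
  exact h1.prodMk h2

end Measurability

lemma measurable_state {t : ℕ} (ht : t ≤ T) : Measurable fun o : Obs K t => P.state t o := by
  induction t with
  | zero => exact measurable_const
  | succ t ih =>
    have hinit : Measurable fun o : Obs K (t + 1) => (fun i => o i.castSucc : Obs K t) :=
      measurable_pi_lambda _ fun i => measurable_pi_apply _
    exact measurable_next hP ((ih (by omega)).comp hinit)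
      (fun o => state_pos hP (by omega) _) (measurable_pi_apply (Fin.last t))

lemma measurable_comp_state' {t : ℕ} (ht : t ≤ T) {f : State K → ℝ}
    (hf : ContinuousOn f {S | 0 < S.2}) : Measurable fun o : Obs K t => f (P.state t o) :=
  measurable_comp_state (measurable_state hP ht) (state_pos hP ht) hf

/-! ### Accumulated quantities -/

end Params

/-- The sum of a function of the state over the first `t` rounds. -/
noncomputable def Params.cumulative {K d : ℕ} (P : Params K d) (f : Params.State K → ℝ) :
    (t : ℕ) → Obs K t → ℝ
  | 0, _ => 0
  | t + 1, o => P.cumulative f t (fun i => o i.castSucc) + f (P.state t fun i => o i.castSucc)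

namespace Params

variable {K d : ℕ} {P : Params K d} {c₁ c₂ : ℝ} {T : ℕ} (hP : P.Admissible c₁ c₂ T)
include hP

lemma measurable_cumulative {t : ℕ} (ht : t ≤ T) {f : State K → ℝ}
    (hf : ContinuousOn f {S | 0 < S.2}) : Measurable (P.cumulative f t) := by
  induction t with
  | zero => exact measurable_const
  | succ t ih =>
    have hinit : Measurable fun o : Obs K (t + 1) => (fun i => o i.castSucc : Obs K t) :=
      measurable_pi_lambda _ fun i => measurable_pi_apply _
    exact ((ih (by omega)).comp hinit).add
      ((measurable_comp_state' hP (by omega : t ≤ T) hf).comp hinit)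

lemma exists_cumulative_bound {t : ℕ} (ht : t ≤ T) {f : State K → ℝ}
    (hf : ContinuousOn f {S | 0 < S.2}) : ∃ M, 0 ≤ M ∧ ∀ o, |P.cumulative f t o| ≤ M := by
  induction t with
  | zero => exact ⟨0, le_rfl, fun o => by simp [cumulative]⟩
  | succ t ih =>
    obtain ⟨M₁, h₁, hM₁⟩ := ih (by omega)
    obtain ⟨M₂, h₂, hM₂⟩ := exists_bound hP (by omega : t ≤ T) hf
    refine ⟨M₁ + M₂, by positivity, fun o => ?_⟩
    exact (abs_add_le _ _).trans (add_le_add (hM₁ _) (hM₂ _))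

end Params

universe u

/-! ### Integration along the interaction -/

lemma observe_snoc {K n : ℕ} (h : Fin n → Round K) (r : Round K) :
    (observe (Fin.snoc h r : Fin (n + 1) → Round K)) (Fin.last n) = (r.1, r.2 r.1) ∧
    (fun i : Fin n => observe (Fin.snoc h r : Fin (n + 1) → Round K) i.castSucc) = observe h := by
  constructor
  · simp [observe]
  · funext i; simp [observe]

section Integration

variable {K d : ℕ} {φ : Fin K → Fin d → ℝ} {ε σ : ℝ}

lemma integrable_prod_of_forall {Ω : Type*} [MeasurableSpace Ω] {μ : Measure (Fin K)}
    [IsFiniteMeasure μ] {ν : Measure Ω} [SFinite ν] {f : Fin K × Ω → ℝ} (hf : Measurable f)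
    (h : ∀ b, Integrable (fun y => f (b, y)) ν) : Integrable f (μ.prod ν) :=
  (integrable_prod_iff hf.aestronglyMeasurable).2
    ⟨Filter.Eventually.of_forall h, Integrable.of_finite⟩

lemma stepKernel_apply (env : Environment.{u} φ ε σ) (π : Policy K) (n : ℕ)
    (x : env.Seed × (Fin n → Round K)) :
    stepKernel env π n x = ((π.act n) (observe x.2)).prod (env.loss n x) := by
  rw [stepKernel, Kernel.prod_apply, Kernel.comap_apply]

lemma integral_stepKernel (env : Environment.{u} φ ε σ) (π : Policy K) (n : ℕ)
    (x : env.Seed × (Fin n → Round K)) {f : Round K → ℝ} (hf : Measurable f)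
    (h : ∀ b, Integrable (fun y => f (b, y)) (env.loss n x)) :
    Integrable f (stepKernel env π n x) ∧ ∫ r, f r ∂(stepKernel env π n x) =
      ∑ b, (π.act n (observe x.2)).real {b} * ∫ y, f (b, y) ∂(env.loss n x) := by
  rw [stepKernel_apply]
  have hi := integrable_prod_of_forall (μ := π.act n (observe x.2)) hf h
  refine ⟨hi, ?_⟩
  rw [integral_prod f hi, integral_fintype Integrable.of_finite]
  rfl

/-- A process whose increments have uniformly bounded mean absolute value and nonpositive
conditional expectation has nonincreasing expectation. -/
lemma integral_trajLaw_succ_le (env : Environment.{u} φ ε σ) (π : Policy K) (n : ℕ)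
    {X : env.Seed × (Fin n → Round K) → ℝ} {X' : env.Seed × (Fin (n + 1) → Round K) → ℝ}
    (hX : Measurable X) (hX' : Measurable X') (hint : Integrable X (trajLaw env π n))
    {inc : env.Seed × (Fin n → Round K) → Round K → ℝ}
    (hinc : ∀ x r, X' (x.1, Fin.snoc x.2 r) = X x + inc x r)
    (hi : ∀ x b, Integrable (fun y => inc x (b, y)) (env.loss n x)) {B : ℝ}
    (hB : ∀ x b, ∫ y, |inc x (b, y)| ∂(env.loss n x) ≤ B)
    (hle : ∀ x, ∑ b, (π.act n (observe x.2)).real {b} * ∫ y, inc x (b, y) ∂(env.loss n x) ≤ 0) :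
    Integrable X' (trajLaw env π (n + 1)) ∧
      ∫ ω, X' ω ∂(trajLaw env π (n + 1)) ≤ ∫ ω, X ω ∂(trajLaw env π n) := by
  set μ := trajLaw env π n
  set κ := stepKernel env π n
  let F : (env.Seed × (Fin n → Round K)) × Round K → ℝ := fun y => inc y.1 y.2
  have hF : Measurable F := by
    have : F = fun y => X' (y.1.1, Fin.snoc y.1.2 y.2) - X y.1 := by
      funext y; rw [hinc]; ring
    rw [this]
    exact (hX'.comp measurable_snoc).sub (hX.comp measurable_fst)
  have hFx : ∀ x, Measurable fun r => inc x r := fun x => hF.comp measurable_prodMk_left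
  have hstep := fun x => integral_stepKernel env π n x (hFx x) (hi x)
  have hstep_abs := fun x => integral_stepKernel env π n x (f := fun r => |inc x r|) (hFx x).abs
    (fun b => (hi x b).abs)
  have hFint : Integrable F (μ ⊗ₘ κ) := by
    rw [Measure.integrable_compProd_iff hF.aestronglyMeasurable]
    refine ⟨Filter.Eventually.of_forall fun x => (hstep x).1, ?_⟩
    refine Integrable.of_bound (hF.norm.stronglyMeasurable.integral_kernel_prod_right'
      (κ := κ)).aestronglyMeasurable B (Filter.Eventually.of_forall fun x => ?_)
    rw [Real.norm_of_nonneg (integral_nonneg fun _ => norm_nonneg _)]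
    have h1 : ∫ r, ‖F (x, r)‖ ∂(κ x) = _ := (hstep_abs x).2
    rw [h1]
    calc _ ≤ ∑ b, (π.act n (observe x.2)).real {b} * B := Finset.sum_le_sum fun b _ =>
          mul_le_mul_of_nonneg_left (hB x b) measureReal_nonneg
      _ = B := by
        rw [← Finset.sum_mul, sum_measureReal_singleton]
        simp
  have hXint : Integrable (fun y : (env.Seed × (Fin n → Round K)) × Round K => X y.1) (μ ⊗ₘ κ) := by
    have h1 : Integrable X ((μ ⊗ₘ κ).map Prod.fst) := by
      rw [← Measure.fst, Measure.fst_compProd]; exact hint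
    exact (integrable_map_measure hX.aestronglyMeasurable measurable_fst.aemeasurable).1 h1
  have hXval : ∫ y, X y.1 ∂(μ ⊗ₘ κ) = ∫ x, X x ∂μ := by
    have h1 : ∫ x, X x ∂((μ ⊗ₘ κ).map Prod.fst) = ∫ y, X y.1 ∂(μ ⊗ₘ κ) :=
      integral_map measurable_fst.aemeasurable hX.aestronglyMeasurable
    rw [← h1, ← Measure.fst, Measure.fst_compProd]
  have hsum : (fun y : (env.Seed × (Fin n → Round K)) × Round K =>
      X' (y.1.1, Fin.snoc y.1.2 y.2)) = fun y => X y.1 + F y := by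
    funext y; exact hinc _ _
  constructor
  · show Integrable X' ((μ ⊗ₘ κ).map _)
    rw [integrable_map_measure hX'.aestronglyMeasurable measurable_snoc.aemeasurable]
    show Integrable (fun y : (env.Seed × (Fin n → Round K)) × Round K =>
      X' (y.1.1, Fin.snoc y.1.2 y.2)) _
    rw [hsum]
    exact hXint.add hFint
  · show ∫ ω, X' ω ∂((μ ⊗ₘ κ).map _) ≤ _
    rw [integral_map measurable_snoc.aemeasurable hX'.aestronglyMeasurable, hsum,
      integral_add hXint hFint, hXval, Measure.integral_compProd hFint]
    have : ∫ x, ∫ r, F (x, r) ∂(κ x) ∂μ ≤ 0 := integral_nonpos fun x => by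
      have h1 : ∫ r, F (x, r) ∂(κ x) = _ := (hstep x).2
      show ∫ r, F (x, r) ∂(κ x) ≤ 0
      rw [h1]; exact hle x
    linarith

end Integration

/-! ### Expected regret and expected gaps -/

section Expectation

variable {K d : ℕ} {P : Params K d} {c₁ c₂ : ℝ} {T : ℕ} (hP : P.Admissible c₁ c₂ T)
  (env : Environment.{u} P.φ P.ε P.σ) {π : Policy K} (hπ : P.Runs π T)

/-- The regret with respect to the arm `a` along a trajectory. -/
def pathRegret {S : Type u} (a : Fin K) (n : ℕ) (ω : S × (Fin n → Round K)) : ℝ :=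
  ∑ t : Fin n, (ω.2 t).2 (ω.2 t).1 - ∑ t : Fin n, (ω.2 t).2 a

lemma measurable_eval_self : Measurable fun r : Round K => r.2 r.1 :=
  measurable_from_prod_countable_right fun a => measurable_pi_apply a

lemma measurable_pathRegret {S : Type u} [MeasurableSpace S] (a : Fin K) (n : ℕ) :
    Measurable (pathRegret (S := S) a n) := by
  have hr : ∀ t : Fin n, Measurable fun ω : S × (Fin n → Round K) => ω.2 t := fun t =>
    (measurable_pi_apply t).comp measurable_snd
  refine (Finset.measurable_sum _ fun t _ => measurable_eval_self.comp (hr t)).sub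
    (Finset.measurable_sum _ fun t _ => ?_)
  exact (measurable_pi_apply a).comp (measurable_snd.comp (hr t))

lemma pathRegret_snoc {S : Type u} (a : Fin K) (n : ℕ) (ω : S × (Fin n → Round K)) (r : Round K) :
    pathRegret a (n + 1) (ω.1, (Fin.snoc ω.2 r : Fin (n + 1) → Round K)) =
      pathRegret a n ω + (r.2 r.1 - r.2 a) := by
  simp only [pathRegret, Fin.sum_univ_castSucc, Fin.snoc_castSucc, Fin.snoc_last]
  ring

lemma cumulative_snoc (f : Params.State K → ℝ) (n : ℕ) (h : Fin n → Round K) (r : Round K) :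
    P.cumulative f (n + 1) (observe (Fin.snoc h r : Fin (n + 1) → Round K)) =
      P.cumulative f n (observe h) + f (P.state n (observe h)) := by
  rw [Params.cumulative, (observe_snoc h r).2]

lemma state_snoc (n : ℕ) (h : Fin n → Round K) (r : Round K) :
    P.state (n + 1) (observe (Fin.snoc h r : Fin (n + 1) → Round K)) =
      P.next (P.state n (observe h)) (r.1, r.2 r.1) := by
  rw [Params.state, (observe_snoc h r).2, (observe_snoc h r).1]

include hP in
lemma integrable_loss (n : ℕ) (x : env.Seed × (Fin n → Round K)) (a : Fin K) :
    Integrable (fun y : Fin K → ℝ => y a) (env.loss n x) :=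
  integrable_of_moment (measurable_pi_apply a) hP.one_lt_ε hP.σ_pos (env.moment_le n x a)

include hP in
lemma integral_abs_loss_le (n : ℕ) (x : env.Seed × (Fin n → Round K)) (a : Fin K) :
    ∫ y, |y a| ∂(env.loss n x) ≤ 2 * P.σ ^ (1 / P.ε) :=
  integral_abs_le (measurable_pi_apply a) hP.one_lt_ε hP.σ_pos (env.moment_le n x a)

include hP in
lemma integrable_of_continuousOn {n : ℕ} (hn : n ≤ T) {f : Params.State K → ℝ}
    (hf : ContinuousOn f {S | 0 < S.2}) :
    Integrable (fun ω => f (P.state n (observe ω.2))) (trajLaw env π n) := by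
  obtain ⟨M, -, hM⟩ := Params.exists_bound hP hn hf
  exact Integrable.of_bound ((Params.measurable_comp_state' hP hn hf).comp
    (measurable_observe.comp measurable_snd)).aestronglyMeasurable M
    (Filter.Eventually.of_forall fun ω => hM _)

include hP in
lemma integrable_cumulative {n : ℕ} (hn : n ≤ T) {f : Params.State K → ℝ}
    (hf : ContinuousOn f {S | 0 < S.2}) :
    Integrable (fun ω => P.cumulative f n (observe ω.2)) (trajLaw env π n) := by
  obtain ⟨M, -, hM⟩ := Params.exists_cumulative_bound hP hn hf
  exact Integrable.of_bound ((Params.measurable_cumulative hP hn hf).comp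
    (measurable_observe.comp measurable_snd)).aestronglyMeasurable M
    (Filter.Eventually.of_forall fun ω => hM _)

include hP hπ in
-- The process regret plus potential minus `1026` accumulated costs is a supermartingale: `1024`
-- costs come from `expected_round_le` and `2` from `potential_next`.
lemma expected_potential_le (a : Fin K) {n : ℕ} (hn : n ≤ T) :
    Integrable (fun ω => pathRegret a n ω + P.potential a (P.state n (observe ω.2)) -
        1026 * P.cumulative P.cost n (observe ω.2)) (trajLaw env π n) ∧
      ∫ ω, (pathRegret a n ω + P.potential a (P.state n (observe ω.2)) -
        1026 * P.cumulative P.cost n (observe ω.2)) ∂(trajLaw env π n) ≤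
      P.β₁ * P.h₁ + P.βbar * P.hbar := by
  have hmeas : ∀ n ≤ T, Measurable fun ω : env.Seed × (Fin n → Round K) =>
      pathRegret a n ω + P.potential a (P.state n (observe ω.2)) -
        1026 * P.cumulative P.cost n (observe ω.2) := fun n hn =>
    ((measurable_pathRegret a n).add ((Params.measurable_comp_state' hP hn
      (Params.continuousOn_potential hP a)).comp (measurable_observe.comp measurable_snd))).sub
      (((Params.measurable_cumulative hP hn (Params.continuousOn_cost hP)).comp
        (measurable_observe.comp measurable_snd)).const_mul _)
  induction n with
  | zero =>
    have h0 : ∀ ω : env.Seed × (Fin 0 → Round K), pathRegret a 0 ω +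
        P.potential a (P.state 0 (observe ω.2)) - 1026 * P.cumulative P.cost 0 (observe ω.2) =
        P.β₁ * P.h₁ + P.βbar * P.hbar := fun ω => by
      have := Params.potential_state₁ (P := P) a
      simp only [Params.state₁] at this
      simp [pathRegret, Params.state, Params.cumulative, this]
    simp only [h0]
    exact ⟨integrable_const _, by simp⟩
  | succ n ih =>
    obtain ⟨hint, hle⟩ := ih (by omega)
    obtain ⟨M₁, hM₁0, hM₁⟩ := Params.exists_bound hP (by omega : n ≤ T)
      (Params.continuousOn_potential hP a)
    obtain ⟨M₂, hM₂0, hM₂⟩ := Params.exists_bound hP hn (Params.continuousOn_potential hP a)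
    obtain ⟨M₃, hM₃0, hM₃⟩ := Params.exists_bound hP (by omega : n ≤ T)
      (Params.continuousOn_cost hP)
    let inc : env.Seed × (Fin n → Round K) → Round K → ℝ := fun x r =>
      (r.2 r.1 - r.2 a) + (P.potential a (P.next (P.state n (observe x.2)) (r.1, r.2 r.1)) -
        P.potential a (P.state n (observe x.2)) - 1026 * P.cost (P.state n (observe x.2)))
    have hbd : ∀ x : env.Seed × (Fin n → Round K), ∀ b (y : Fin K → ℝ),
        |P.potential a (P.next (P.state n (observe x.2)) (b, y b)) -
        P.potential a (P.state n (observe x.2)) - 1026 * P.cost (P.state n (observe x.2))| ≤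
        M₂ + M₁ + 1026 * M₃ := fun x b y => by
      have e := state_snoc (P := P) n x.2 (b, y)
      have h1 := hM₁ (observe x.2)
      have h2 := hM₂ (observe (Fin.snoc x.2 (b, y) : Fin (n + 1) → Round K))
      have h3 := hM₃ (observe x.2)
      rw [e] at h2
      refine (abs_sub _ _).trans (add_le_add ((abs_sub _ _).trans (add_le_add h2 h1)) ?_)
      rw [abs_mul, abs_of_pos (by norm_num : (0 : ℝ) < 1026)]
      exact mul_le_mul_of_nonneg_left h3 (by norm_num)
    have hSpos : ∀ x : env.Seed × (Fin n → Round K), 0 < (P.state n (observe x.2)).2 := fun x =>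
      Params.state_pos hP (by omega) _
    have hpotm : ∀ x : env.Seed × (Fin n → Round K), ∀ b, Measurable fun y : Fin K → ℝ =>
        P.potential a (P.next (P.state n (observe x.2)) (b, y b)) := fun x b => by
      have h1 : Measurable fun y : Fin K → ℝ => P.next (P.state n (observe x.2)) (b, y b) :=
        Params.measurable_next hP (S := fun _ => P.state n (observe x.2)) measurable_const
          (fun _ => hSpos x) (measurable_const.prodMk (measurable_pi_apply b))
      refine Params.measurable_comp_state h1 (fun y => ?_) (Params.continuousOn_potential hP a)
      have := Params.state_pos hP hn (observe (Fin.snoc x.2 (b, y) : Fin (n + 1) → Round K))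
      rwa [state_snoc] at this
    have hrest : ∀ x : env.Seed × (Fin n → Round K), ∀ b, Integrable (fun y : Fin K → ℝ =>
        P.potential a (P.next (P.state n (observe x.2)) (b, y b)) -
        P.potential a (P.state n (observe x.2)) - 1026 * P.cost (P.state n (observe x.2)))
        (env.loss n x) := fun x b =>
      Integrable.of_bound (((hpotm x b).sub_const _).sub_const _).aestronglyMeasurable _
        (Filter.Eventually.of_forall fun y => hbd x b y)
    have hinci : ∀ x b, Integrable (fun y => inc x (b, y)) (env.loss n x) := fun x b =>
      ((integrable_loss hP env n x b).sub (integrable_loss hP env n x a)).add (hrest x b)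
    -- The losses are unbounded, but two of them have mean absolute value at most `2 σ^{1/ε}` each;
    -- everything else in the increment is uniformly bounded.
    have hkey := integral_trajLaw_succ_le env π n (hmeas n (by omega)) (hmeas (n + 1) hn) hint
      (inc := inc) (fun x r => ?_) hinci (B := 4 * P.σ ^ (1 / P.ε) + (M₂ + M₁ + 1026 * M₃))
      (fun x b => ?_) (fun x => ?_)
    · exact ⟨hkey.1, hkey.2.trans hle⟩
    · simp only [pathRegret_snoc, cumulative_snoc, state_snoc, inc]
      ring
    · have ib := (integrable_loss hP env n x b).abs
      have ia := (integrable_loss hP env n x a).abs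
      calc ∫ y, |inc x (b, y)| ∂(env.loss n x) ≤
          ∫ y : Fin K → ℝ, (|y b| + |y a| + (M₂ + M₁ + 1026 * M₃)) ∂(env.loss n x) := by
            refine integral_mono (hinci x b).abs ((ib.add ia).add (integrable_const _)) fun y => ?_
            exact (abs_add_le _ _).trans (add_le_add (abs_sub _ _) (hbd x b y))
        _ = ∫ y : Fin K → ℝ, |y b| ∂(env.loss n x) + ∫ y : Fin K → ℝ, |y a| ∂(env.loss n x) +
            (M₂ + M₁ + 1026 * M₃) := by
            have iab : Integrable (fun y : Fin K → ℝ => |y b| + |y a|) (env.loss n x) := ib.add ia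
            rw [integral_add iab (integrable_const _), integral_add ib ia]; simp
        _ ≤ _ := by
            linarith [integral_abs_loss_le hP env n x b, integral_abs_loss_le hP env n x a]
    · have hγ := hP.γ_le_half n (by omega) (observe x.2)
      have hβ := Params.β₁_le_state hP (by omega : n ≤ T) (observe x.2)
      obtain ⟨hi, hr⟩ := Params.expected_round_le hP (hSpos x) hγ (env.loss n x) (env.θ n x)
        (env.mean_eq n x) (env.moment_le n x) a
      have hp1 : ∑ b, P.p (P.state n (observe x.2)) b = 1 := (Params.p_mem hP (hSpos x) hγ).2
      have hlaw := hπ n (by omega) (observe x.2)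
      have hx := hSpos x
      have hinci' := hinci x
      simp only [inc] at hinci' ⊢
      clear_value inc
      generalize P.state n (observe x.2) = S at hγ hβ hi hr hp1 hlaw hx hinci' ⊢
      have hb : ∀ b, ∫ y : Fin K → ℝ, (y b - y a + (P.potential a (P.next S (b, y b)) -
          P.potential a S - 1026 * P.cost S)) ∂(env.loss n x) ≤
          ∫ y, (y b - y a + (P.increment S (b, y b) a - ∑ c, P.q S c * P.increment S (b, y b) c +
          1 / (2 * P.s S) * ∑ c, P.q S c * P.increment S (b, y b) c ^ 2)) ∂(env.loss n x) -
          1024 * P.cost S := fun b => by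
        rw [← sub_nonneg]
        have e := integral_sub (hi b) (integrable_const (1024 * P.cost S))
        rw [integral_const, probReal_univ, one_smul] at e
        rw [← e, sub_nonneg]
        refine integral_mono (hinci' b) ((hi b).sub (integrable_const _)) fun y => ?_
        have := Params.potential_next hP hx hγ hβ (b, y b) a
        simp only at this ⊢
        linarith
      refine (Finset.sum_le_sum fun b _ => mul_le_mul_of_nonneg_left (hb b)
        measureReal_nonneg).trans ?_
      simp only [hlaw]
      rw [Finset.sum_congr rfl fun b _ => mul_sub _ _ _, Finset.sum_sub_distrib, ← Finset.sum_mul,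
        hp1, one_mul]
      exact sub_nonpos.mpr hr

include hP hπ in
/-- The expected regret is bounded by the initial potential and the accumulated cost. -/
theorem expected_regret_le (a : Fin K) :
    ∫ ω, (∑ t : Fin T, (ω.2 t).2 (ω.2 t).1 - ∑ t : Fin T, (ω.2 t).2 a) ∂(trajLaw env π T) ≤
      P.β₁ * P.h₁ + P.βbar * P.hbar +
        1026 * ∫ ω, P.cumulative P.cost T (observe ω.2) ∂(trajLaw env π T) := by
  obtain ⟨hi, hle⟩ := expected_potential_le hP env hπ a le_rfl
  have h1 := integrable_of_continuousOn (π := π) hP env le_rfl (Params.continuousOn_potential hP a)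
  have h2 := integrable_cumulative (π := π) hP env le_rfl (Params.continuousOn_cost hP)
  have e : ∀ ω : env.Seed × (Fin T → Round K),
      ∑ t : Fin T, (ω.2 t).2 (ω.2 t).1 - ∑ t : Fin T, (ω.2 t).2 a =
      (pathRegret a T ω + P.potential a (P.state T (observe ω.2)) -
        1026 * P.cumulative P.cost T (observe ω.2)) - P.potential a (P.state T (observe ω.2)) +
        1026 * P.cumulative P.cost T (observe ω.2) := fun ω => by
    unfold pathRegret; ring
  simp only [e]
  have h3 : Integrable (fun ω : env.Seed × (Fin T → Round K) =>
      pathRegret a T ω + P.potential a (P.state T (observe ω.2)) -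
        1026 * P.cumulative P.cost T (observe ω.2) - P.potential a (P.state T (observe ω.2)))
      (trajLaw env π T) := hi.sub h1
  rw [integral_add h3 (h2.const_mul 1026), integral_sub hi h1, integral_const_mul]
  have := integral_nonneg (μ := trajLaw env π T) (f := fun ω =>
    P.potential a (P.state T (observe ω.2))) fun ω => Params.potential_nonneg hP a
  linarith

include hP hπ in
/-- The expected gaps dominate the expected probability of suboptimal arms. -/
theorem expected_gap_ge (Δ : Fin K → ℝ) (a' : Fin K) {g : ℝ} (h0 : 0 ≤ Δ a')
    (hg : ∀ a, a ≠ a' → g ≤ Δ a) :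
    g * ∫ ω, P.cumulative (fun S => 1 - P.p S a') T (observe ω.2) ∂(trajLaw env π T) ≤
      ∫ ω, (∑ t : Fin T, Δ (ω.2 t).1) ∂(trajLaw env π T) := by
  have hcont : ContinuousOn (fun S => 1 - P.p S a') {S | 0 < S.2} :=
    continuousOn_const.sub ((continuous_apply a').comp_continuousOn (Params.continuousOn_p hP))
  have hΔm : Measurable Δ := measurable_of_countable Δ
  have hsm : ∀ n, Measurable fun ω : env.Seed × (Fin n → Round K) => ∑ t : Fin n, Δ (ω.2 t).1 :=
    fun n => Finset.measurable_sum _ fun t _ =>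
      hΔm.comp (measurable_fst.comp ((measurable_pi_apply t).comp measurable_snd))
  have hmeas : ∀ n ≤ T, Measurable fun ω : env.Seed × (Fin n → Round K) =>
      g * P.cumulative (fun S => 1 - P.p S a') n (observe ω.2) - ∑ t : Fin n, Δ (ω.2 t).1 :=
    fun n hn => (((Params.measurable_cumulative hP hn hcont).comp
        (measurable_observe.comp measurable_snd)).const_mul _).sub (hsm n)
  have key : ∀ n ≤ T, Integrable (fun ω : env.Seed × (Fin n → Round K) =>
      g * P.cumulative (fun S => 1 - P.p S a') n (observe ω.2) - ∑ t : Fin n, Δ (ω.2 t).1)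
      (trajLaw env π n) ∧ ∫ ω, (g * P.cumulative (fun S => 1 - P.p S a') n (observe ω.2) -
        ∑ t : Fin n, Δ (ω.2 t).1) ∂(trajLaw env π n) ≤ 0 := by
    intro n hn
    induction n with
    | zero => simp [Params.cumulative]
    | succ n ih =>
      obtain ⟨hint, hle⟩ := ih (by omega)
      obtain ⟨M, hM0, hM⟩ := Params.exists_bound hP (by omega : n ≤ T) hcont
      have hkey := integral_trajLaw_succ_le env π n (hmeas n (by omega)) (hmeas (n + 1) hn) hint
        (inc := fun x r => g * (1 - P.p (P.state n (observe x.2)) a') - Δ r.1) (fun x r => ?_)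
        (fun x b => integrable_const (g * (1 - P.p (P.state n (observe x.2)) a') - Δ b)) (B := |g| * M + ∑ b, |Δ b|) (fun x b => ?_) (fun x => ?_)
      · exact ⟨hkey.1, hkey.2.trans hle⟩
      · simp only [cumulative_snoc, Fin.sum_univ_castSucc, Fin.snoc_castSucc, Fin.snoc_last]
        ring
      · have h1 := hM (observe x.2)
        have h2 : |Δ b| ≤ ∑ b, |Δ b| :=
          Finset.single_le_sum (f := fun b => |Δ b|) (fun c _ => abs_nonneg _) (Finset.mem_univ b)
        simp only [integral_const, probReal_univ, one_smul]
        refine (abs_sub _ _).trans (add_le_add ?_ h2)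
        rw [abs_mul]
        exact mul_le_mul_of_nonneg_left h1 (abs_nonneg _)
      · have hS := Params.state_pos hP (by omega : n ≤ T) (observe x.2)
        have hγ := hP.γ_le_half n (by omega) (observe x.2)
        have hp := Params.p_mem hP hS hγ
        simp only [integral_const, probReal_univ, one_smul, hπ n (by omega) (observe x.2)]
        set p := P.p (P.state n (observe x.2))
        have h1 : ∑ b, p b * (g * (1 - p a') - Δ b) = g * (1 - p a') - ∑ b, p b * Δ b := by
          simp only [mul_sub, Finset.sum_sub_distrib, ← Finset.sum_mul, hp.2]; ring
        rw [h1]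
        have h2 := hp.2
        rw [← Finset.add_sum_erase _ _ (Finset.mem_univ a')] at h2
        rw [← Finset.add_sum_erase _ _ (Finset.mem_univ a')]
        have h3 : ∑ b ∈ Finset.univ.erase a', p b * g ≤ ∑ b ∈ Finset.univ.erase a', p b * Δ b :=
          Finset.sum_le_sum fun b hb =>
            mul_le_mul_of_nonneg_left (hg b (Finset.ne_of_mem_erase hb)) (hp.1 b)
        rw [← Finset.sum_mul] at h3
        have h4 := mul_nonneg (hp.1 a') h0
        have h5 : ∑ b ∈ Finset.univ.erase a', p b = 1 - p a' := by linarith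
        rw [h5] at h3
        linarith
  obtain ⟨hi, hle⟩ := key T le_rfl
  have h1 := (integrable_cumulative (π := π) hP env le_rfl hcont).const_mul g
  have h2 : Integrable (fun ω : env.Seed × (Fin T → Round K) => ∑ t : Fin T, Δ (ω.2 t).1)
      (trajLaw env π T) := by
    refine (h1.sub hi).congr (Filter.Eventually.of_forall fun ω => ?_)
    simp
  rw [integral_sub h1 h2, integral_const_mul] at hle
  linarith

end Expectation

/-! ### Accumulated cost under the self-adjusting learning rate. -/

section LearningRate

variable {T : ℕ} {β h z : ℕ → ℝ} {ρ : ℝ}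

/-- Replacing `β t` by `β (t + 1)` in the accumulated cost loses only a constant. -/
lemma sum_mul_rpow_neg_le {zmax : ℝ} (hρ : 0 < ρ) (hβ : ∀ t ≤ T, 0 < β t)
    (hmono : ∀ t < T, β t ≤ β (t + 1)) (hzm : ∀ t < T, z t ≤ zmax) (hzmax : 0 ≤ zmax) :
    ∑ t ∈ Finset.range T, z t * β t ^ (-ρ) ≤
      zmax * β 0 ^ (-ρ) + ∑ t ∈ Finset.range T, z t * β (t + 1) ^ (-ρ) := by
  have h1 : ∑ t ∈ Finset.range T, (z t * β t ^ (-ρ) - z t * β (t + 1) ^ (-ρ)) ≤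
      ∑ t ∈ Finset.range T, zmax * (β t ^ (-ρ) - β (t + 1) ^ (-ρ)) := by
    refine Finset.sum_le_sum fun t ht => ?_
    have ht := Finset.mem_range.mp ht
    rw [← mul_sub]
    exact mul_le_mul_of_nonneg_right (hzm t ht) (sub_nonneg.mpr
      (Real.rpow_le_rpow_of_nonpos (hβ t ht.le) (hmono t ht) (by linarith)))
  rw [Finset.sum_sub_distrib, ← Finset.mul_sum, Finset.sum_range_sub'] at h1
  have h2 := mul_nonneg hzmax (Real.rpow_nonneg (hβ T le_rfl).le (-ρ))
  linarith

/-- Rounds that end with `β` above `B` cost at most `B^{-ρ} z`. The others cost at most `θ` times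
the increment of `β`, and the increments of `min β B` telescope to at most `B`; being nonnegative,
they may be summed over all rounds instead of `I`. -/
lemma sum_subset_le_add {I : Finset ℕ} {θ B : ℝ} (hρ : 0 < ρ) (hβ : ∀ t ≤ T, 0 < β t)
    (hmono : ∀ t < T, β t ≤ β (t + 1)) (hz : ∀ t < T, 0 ≤ z t)
    (hstep : ∀ t < T, z t * β t ^ (-ρ) ≤ h t * (β (t + 1) - β t))
    (hI : I ⊆ Finset.range T) (hθ0 : 0 ≤ θ) (hθ : ∀ t ∈ I, h t ≤ θ) (hB : 0 < B) :
    ∑ t ∈ I, z t * β (t + 1) ^ (-ρ) ≤ θ * B + B ^ (-ρ) * ∑ t ∈ I, z t := by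
  have h0 : ∀ t < T, 0 ≤ min (β (t + 1)) B - min (β t) B := fun t ht =>
    sub_nonneg.mpr (min_le_min_right _ (hmono t ht))
  have hterm : ∀ t ∈ I, z t * β (t + 1) ^ (-ρ) ≤
      θ * (min (β (t + 1)) B - min (β t) B) + B ^ (-ρ) * z t := fun t htI => by
    have ht := Finset.mem_range.mp (hI htI)
    rcases le_total B (β (t + 1)) with hb | hb
    · have h1 := Real.rpow_le_rpow_of_nonpos hB hb (by linarith : -ρ ≤ 0)
      have h2 := mul_le_mul_of_nonneg_left h1 (hz t ht)
      have h3 := mul_nonneg hθ0 (h0 t ht)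
      linarith
    · rw [min_eq_left hb, min_eq_left ((hmono t ht).trans hb)]
      have h1 := Real.rpow_le_rpow_of_nonpos (hβ t ht.le) (hmono t ht) (by linarith : -ρ ≤ 0)
      have h2 := mul_le_mul_of_nonneg_left h1 (hz t ht)
      have h3 := mul_le_mul_of_nonneg_right (hθ t htI) (sub_nonneg.mpr (hmono t ht))
      have h4 := mul_nonneg (Real.rpow_nonneg hB.le (-ρ)) (hz t ht)
      linarith [hstep t ht]
  have hsum : ∑ t ∈ I, (min (β (t + 1)) B - min (β t) B) ≤ B :=
    calc _ ≤ ∑ t ∈ Finset.range T, (min (β (t + 1)) B - min (β t) B) :=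
          Finset.sum_le_sum_of_subset_of_nonneg hI fun t ht _ => h0 t (Finset.mem_range.mp ht)
      _ = min (β T) B - min (β 0) B := Finset.sum_range_sub (fun t => min (β t) B) T
      _ ≤ B := by linarith [min_le_right (β T) B, (lt_min (hβ 0 (Nat.zero_le _)) hB).le]
  calc _ ≤ ∑ t ∈ I, (θ * (min (β (t + 1)) B - min (β t) B) + B ^ (-ρ) * z t) :=
        Finset.sum_le_sum hterm
    _ = θ * ∑ t ∈ I, (min (β (t + 1)) B - min (β t) B) + B ^ (-ρ) * ∑ t ∈ I, z t := by
        rw [Finset.sum_add_distrib, Finset.mul_sum, Finset.mul_sum]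
    _ ≤ _ := add_le_add (mul_le_mul_of_nonneg_left hsum hθ0) le_rfl

/-- Over rounds whose penalty is at most `θ`, the accumulated cost is at most
`2 (θ ^ ρ ∑ z) ^ (1 / (1 + ρ))`. -/
lemma sum_subset_le {I : Finset ℕ} {θ : ℝ} (hρ : 0 < ρ) (hβ : ∀ t ≤ T, 0 < β t)
    (hmono : ∀ t < T, β t ≤ β (t + 1)) (hz : ∀ t < T, 0 ≤ z t)
    (hstep : ∀ t < T, z t * β t ^ (-ρ) ≤ h t * (β (t + 1) - β t))
    (hI : I ⊆ Finset.range T) (hθ0 : 0 < θ) (hθ : ∀ t ∈ I, h t ≤ θ) :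
    ∑ t ∈ I, z t * β (t + 1) ^ (-ρ) ≤ 2 * (θ ^ ρ * ∑ t ∈ I, z t) ^ (1 / (1 + ρ)) := by
  have hzI : ∀ t ∈ I, 0 ≤ z t := fun t ht => hz t (Finset.mem_range.mp (hI ht))
  rcases (Finset.sum_nonneg hzI).eq_or_lt with h0 | hpos
  · have h1 := (Finset.sum_eq_zero_iff_of_nonneg hzI).mp h0.symm
    rw [Finset.sum_eq_zero fun t ht => by rw [h1 t ht, zero_mul], ← h0, mul_zero,
      Real.zero_rpow (by positivity), mul_zero]
  · set Y := ∑ t ∈ I, z t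
    have hρ1 : 1 + ρ ≠ 0 := by positivity
    -- The level `B = (Y / θ)^{1/(1+ρ)}` makes the two terms equal.
    have hmain := sum_subset_le_add hρ hβ hmono hz hstep hI hθ0.le hθ
      (Real.rpow_pos_of_pos (div_pos hpos hθ0) (1 / (1 + ρ)))
    refine hmain.trans (le_of_eq ?_)
    have e1 : θ * (Y / θ) ^ (1 / (1 + ρ)) = (θ ^ ρ * Y) ^ (1 / (1 + ρ)) := by
      rw [Real.div_rpow hpos.le hθ0.le, Real.mul_rpow (by positivity) hpos.le, ← Real.rpow_mul hθ0.le,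
        mul_div_assoc', mul_comm θ, mul_div_assoc, mul_comm (θ ^ _)]
      congr 1
      nth_rewrite 1 [← Real.rpow_one θ]
      rw [← Real.rpow_sub hθ0]
      congr 1; field_simp; ring
    have e2 : ((Y / θ) ^ (1 / (1 + ρ))) ^ (-ρ) * Y = (θ ^ ρ * Y) ^ (1 / (1 + ρ)) := by
      rw [← e1, ← Real.rpow_mul (by positivity)]
      have : Y = θ * (Y / θ) ^ (1 : ℝ) := by rw [Real.rpow_one]; field_simp
      nth_rewrite 2 [this]
      rw [mul_left_comm, ← Real.rpow_add (by positivity)]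
      congr 2; field_simp; ring
    rw [e1, e2]; ring

lemma sum_range_eq_levels (f : ℕ → ℝ) {H : ℝ} (hH : 0 ≤ H) (hh : ∀ t < T, h t ≤ H) (J : ℕ) :
    ∑ t ∈ Finset.range T, f t =
      ∑ j ∈ Finset.range J, ∑ t ∈ Finset.range T with (H / 2 ^ (j + 1) < h t ∧ h t ≤ H / 2 ^ j), f t +
      ∑ t ∈ Finset.range T with h t ≤ H / 2 ^ J, f t := by
  induction J with
  | zero =>
    rw [Finset.sum_range_zero, zero_add, Finset.filter_true_of_mem fun t ht => by
      simpa using hh t (Finset.mem_range.mp ht)]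
  | succ J ih =>
    rw [ih, Finset.sum_range_succ, add_assoc]
    congr 1
    rw [← Finset.sum_union]
    · congr 1
      ext t
      simp only [Finset.mem_filter, Finset.mem_union]
      have hle : H / 2 ^ (J + 1) ≤ H / 2 ^ J := by
        rw [pow_succ]
        exact div_le_div_of_nonneg_left hH (by positivity) (by linarith [pow_pos (two_pos : (0:ℝ) < 2) J])
      constructor
      · rintro ⟨h1, h2⟩
        rcases lt_or_ge (H / 2 ^ (J + 1)) (h t) with h3 | h3
        · exact Or.inl ⟨h1, h3, h2⟩
        · exact Or.inr ⟨h1, h3⟩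
      · rintro (⟨h1, -, h2⟩ | ⟨h1, h2⟩)
        · exact ⟨h1, h2⟩
        · exact ⟨h1, h2.trans hle⟩
    · refine Finset.disjoint_filter.mpr fun t _ h1 h2 => ?_
      linarith [h1.1]

/-- The accumulated cost when the penalties are bounded by `H`. -/
lemma sum_cost_le {zmax H : ℝ} (hρ : 0 < ρ) (hβ : ∀ t ≤ T, 0 < β t)
    (hmono : ∀ t < T, β t ≤ β (t + 1)) (hz : ∀ t < T, 0 ≤ z t) (hzm : ∀ t < T, z t ≤ zmax)
    (hzmax : 0 ≤ zmax) (hstep : ∀ t < T, z t * β t ^ (-ρ) ≤ h t * (β (t + 1) - β t))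
    (hH : 0 < H) (hh : ∀ t < T, h t ≤ H) :
    ∑ t ∈ Finset.range T, z t * β t ^ (-ρ) ≤
      zmax * β 0 ^ (-ρ) + 2 * (H ^ ρ * (T * zmax)) ^ (1 / (1 + ρ)) := by
  refine (sum_mul_rpow_neg_le hρ hβ hmono hzm hzmax).trans (add_le_add le_rfl ?_)
  refine (sum_subset_le hρ hβ hmono hz hstep subset_rfl hH
    fun t ht => hh t (Finset.mem_range.mp ht)).trans ?_
  have h1 : ∑ t ∈ Finset.range T, z t ≤ T * zmax := by
    refine (Finset.sum_le_card_nsmul _ _ zmax fun t ht => hzm t (Finset.mem_range.mp ht)).trans ?_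
    simp
  have h2 : 0 ≤ ∑ t ∈ Finset.range T, z t :=
    Finset.sum_nonneg fun t ht => hz t (Finset.mem_range.mp ht)
  gcongr

/-- The accumulated cost in terms of `∑ h ^ ρ z`, by splitting the rounds into `J` dyadic levels
of the penalty and a remainder. -/
lemma sum_cost_le_levels {zmax H : ℝ} (hρ : 0 < ρ) (hβ : ∀ t ≤ T, 0 < β t)
    (hmono : ∀ t < T, β t ≤ β (t + 1)) (hz : ∀ t < T, 0 ≤ z t) (hzm : ∀ t < T, z t ≤ zmax)
    (hzmax : 0 ≤ zmax) (hstep : ∀ t < T, z t * β t ^ (-ρ) ≤ h t * (β (t + 1) - β t))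
    (hH : 0 < H) (hh : ∀ t < T, h t ≤ H) (hpos : ∀ t < T, 0 < h t) (J : ℕ) :
    ∑ t ∈ Finset.range T, z t * β t ^ (-ρ) ≤
      zmax * β 0 ^ (-ρ) +
      4 * ((J : ℝ) ^ (ρ / (1 + ρ)) *
        (∑ t ∈ Finset.range T, h t ^ ρ * z t) ^ (1 / (1 + ρ))) +
      2 * ((H / 2 ^ J) ^ ρ * (T * zmax)) ^ (1 / (1 + ρ)) := by
  have hθ0 : 0 < 1 / (1 + ρ) := by positivity
  have hθ1 : 1 / (1 + ρ) ≤ 1 := by rw [div_le_one (by positivity)]; linarith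
  rw [add_assoc]
  refine (sum_mul_rpow_neg_le hρ hβ hmono hzm hzmax).trans (add_le_add le_rfl ?_)
  rw [sum_range_eq_levels _ hH.le hh J]
  set Y : ℕ → ℝ := fun j => ∑ t ∈ Finset.range T with (H / 2 ^ (j + 1) < h t ∧ h t ≤ H / 2 ^ j),
    h t ^ ρ * z t
  have hterm0 : ∀ t < T, 0 ≤ h t ^ ρ * z t := fun t ht =>
    mul_nonneg (Real.rpow_nonneg (hpos t ht).le _) (hz t ht)
  have hY0 : ∀ j, 0 ≤ Y j := fun j => Finset.sum_nonneg fun t ht =>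
    hterm0 t (Finset.mem_range.mp (Finset.mem_filter.mp ht).1)
  refine add_le_add ?_ ?_
  -- Within a level the penalties agree up to a factor `2`, so the uniform bound `H / 2^j` may be
  -- replaced by `h t` inside the sum.
  · have hlev : ∀ j, ∑ t ∈ Finset.range T with (H / 2 ^ (j + 1) < h t ∧ h t ≤ H / 2 ^ j),
        z t * β (t + 1) ^ (-ρ) ≤ 4 * Y j ^ (1 / (1 + ρ)) := fun j => by
      refine (sum_subset_le hρ hβ hmono hz hstep (Finset.filter_subset _ _)
        (by positivity : 0 < H / 2 ^ j) fun t ht => (Finset.mem_filter.mp ht).2.2).trans ?_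
      have h1 : (H / 2 ^ j) ^ ρ * ∑ t ∈ Finset.range T with
          (H / 2 ^ (j + 1) < h t ∧ h t ≤ H / 2 ^ j), z t ≤ 2 ^ ρ * Y j := by
        rw [Finset.mul_sum, Finset.mul_sum]
        refine Finset.sum_le_sum fun t ht => ?_
        obtain ⟨htT, hlt, -⟩ := Finset.mem_filter.mp ht
        have htT := Finset.mem_range.mp htT
        rw [← mul_assoc, ← Real.mul_rpow (by norm_num) (hpos t htT).le]
        refine mul_le_mul_of_nonneg_right (Real.rpow_le_rpow (by positivity) ?_ hρ.le) (hz t htT)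
        rw [pow_succ, ← div_div, div_lt_iff₀ two_pos] at hlt
        linarith
      have h2 : 0 ≤ (H / 2 ^ j) ^ ρ * ∑ t ∈ Finset.range T with
          (H / 2 ^ (j + 1) < h t ∧ h t ≤ H / 2 ^ j), z t :=
        mul_nonneg (by positivity) (Finset.sum_nonneg fun t ht =>
          hz t (Finset.mem_range.mp (Finset.mem_filter.mp ht).1))
      have h3 := Real.rpow_le_rpow h2 h1 hθ0.le
      rw [Real.mul_rpow (by positivity) (hY0 j), ← Real.rpow_mul (by norm_num)] at h3
      have h4 : (2 : ℝ) ^ (ρ * (1 / (1 + ρ))) ≤ 2 := by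
        conv_rhs => rw [← Real.rpow_one 2]
        refine Real.rpow_le_rpow_of_exponent_le (by norm_num) ?_
        rw [mul_one_div, div_le_one (by positivity)]; linarith
      have h5 := mul_le_mul_of_nonneg_right h4 (Real.rpow_nonneg (hY0 j) (1 / (1 + ρ)))
      linarith
    refine (Finset.sum_le_sum fun j _ => hlev j).trans ?_
    rw [← Finset.mul_sum]
    refine mul_le_mul_of_nonneg_left ?_ (by norm_num)
    -- Concavity over the `J` levels is what produces the factor `J^{ρ/(1+ρ)}`.
    refine (sum_rpow_le_card (Finset.range J) Y hθ0 hθ1 fun j _ => hY0 j).trans ?_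
    have e : 1 - 1 / (1 + ρ) = ρ / (1 + ρ) := by field_simp; ring
    rw [Finset.card_range, e]
    have h6 : ∑ j ∈ Finset.range J, Y j ≤ ∑ t ∈ Finset.range T, h t ^ ρ * z t := by
      rw [sum_range_eq_levels (fun t => h t ^ ρ * z t) hH.le hh J]
      have : 0 ≤ ∑ t ∈ Finset.range T with h t ≤ H / 2 ^ J, h t ^ ρ * z t :=
        Finset.sum_nonneg fun t ht => hterm0 t (Finset.mem_range.mp (Finset.mem_filter.mp ht).1)
      linarith
    exact mul_le_mul_of_nonneg_left (Real.rpow_le_rpow (Finset.sum_nonneg fun j _ => hY0 j) h6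
      hθ0.le) (by positivity)
  · refine (sum_subset_le hρ hβ hmono hz hstep (Finset.filter_subset _ _)
      (by positivity : 0 < H / 2 ^ J) fun t ht => (Finset.mem_filter.mp ht).2).trans ?_
    have h1 : ∑ t ∈ Finset.range T with h t ≤ H / 2 ^ J, z t ≤ T * zmax := by
      refine (Finset.sum_le_sum_of_subset_of_nonneg (Finset.filter_subset _ _) fun t ht _ =>
        hz t (Finset.mem_range.mp ht)).trans ?_
      refine (Finset.sum_le_card_nsmul _ _ zmax fun t ht => hzm t (Finset.mem_range.mp ht)).trans ?_
      simp
    have h2 : 0 ≤ ∑ t ∈ Finset.range T with h t ≤ H / 2 ^ J, z t :=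
      Finset.sum_nonneg fun t ht => hz t (Finset.mem_range.mp (Finset.mem_filter.mp ht).1)
    gcongr

end LearningRate

/-! ### Orders of magnitude of `z`, `w` and `h`. -/

namespace Params

variable {K d : ℕ} {P : Params K d} {c₁ c₂ : ℝ} {T : ℕ}

/-- The order of magnitude of `h₁ z_max`. -/
noncomputable def zScale (P : Params K d) : ℝ :=
  P.σ * Real.log K ^ (P.ε - 1) * (d : ℝ) ^ (P.ε / 2)

/-- The order of magnitude of `h₁ w_max`. -/
noncomputable def wScale (P : Params K d) : ℝ := P.σ ^ (3 / P.ε) * d * Real.log K ^ 2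

variable (hP : P.Admissible c₁ c₂ T)
include hP

lemma log_K_pos : 0 < Real.log K :=
  Real.log_pos (by exact_mod_cast (by have := hP.two_le_K; omega : 1 < K))

lemma zScale_pos : 0 < P.zScale := by
  have := log_K_pos hP
  have := hP.σ_pos
  have := hP.d_pos
  unfold zScale; positivity

lemma wScale_pos : 0 < P.wScale := by
  have := log_K_pos hP
  have := hP.σ_pos
  have := hP.d_pos
  unfold wScale; positivity

lemma c₂_nonneg : 0 ≤ c₂ := by
  have h := hP.η_pos.le.trans hP.α_le
  by_contra hc
  exact absurd h (not_le.mpr (div_neg_of_neg_of_pos (not_le.mp hc) (log_K_pos hP)))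

/-- Since `(1 - α) log K ≤ c₂`, power sums with exponent `α` over the arms cost a constant rather
than a power of `K`. -/
lemma card_rpow_le : (K : ℝ) ^ (1 - P.α) ≤ Real.exp c₂ := by
  have hK : (0 : ℝ) < K := by exact_mod_cast (by have := hP.two_le_K; omega : 0 < K)
  rw [Real.rpow_def_of_pos hK]
  refine Real.exp_le_exp.mpr ?_
  have := hP.α_le
  rwa [le_div_iff₀ (log_K_pos hP), mul_comm] at this

lemma inv_η_le (hc₁ : 0 < c₁) : (1 - P.α)⁻¹ ≤ max 1 (1 / c₁) * Real.log K := by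
  have hl := log_K_pos hP
  have h1 := inv_anti₀ (by positivity) hP.le_α
  rw [inv_div, div_eq_mul_one_div, mul_comm] at h1
  exact h1.trans (mul_le_mul_of_nonneg_right (le_max_right _ _) hl.le)

lemma η_rpow_le (hc₁ : 0 < c₁) :
    (1 - P.α) ^ (1 - P.ε) ≤ max 1 (1 / c₁) * Real.log K ^ (P.ε - 1) := by
  have hl := log_K_pos hP
  have hη := hP.η_pos
  have h1 := hP.one_lt_ε
  have h2 := hP.ε_le_two
  have hk : 1 ≤ max 1 (1 / c₁) := le_max_left _ _
  have e : (1 - P.α) ^ (1 - P.ε) = ((1 - P.α)⁻¹) ^ (P.ε - 1) := by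
    rw [Real.inv_rpow hη.le, ← Real.rpow_neg hη.le]; congr 1; ring
  rw [e]
  refine (Real.rpow_le_rpow (by positivity) (inv_η_le hP hc₁) (by linarith)).trans ?_
  rw [Real.mul_rpow (by positivity) hl.le]
  refine mul_le_mul_of_nonneg_right ?_ (by positivity)
  conv_rhs => rw [← Real.rpow_one (max 1 (1 / c₁))]
  exact Real.rpow_le_rpow_of_exponent_le hk (by linarith)

lemma η_rpow_mul_le (hc₁ : 0 < c₁) :
    (1 - P.α) ^ (1 - P.ε) * P.σ * (d : ℝ) ^ (P.ε / 2) ≤ max 1 (1 / c₁) * P.zScale := by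
  have hs := hP.σ_pos
  have hd := hP.d_pos
  have := mul_le_mul_of_nonneg_right (η_rpow_le hP hc₁)
    (by positivity : 0 ≤ P.σ * (d : ℝ) ^ (P.ε / 2))
  unfold zScale
  calc _ = (1 - P.α) ^ (1 - P.ε) * (P.σ * (d : ℝ) ^ (P.ε / 2)) := by ring
    _ ≤ _ := this
    _ = _ := by ring

lemma η_sq_mul_le (hc₁ : 0 < c₁) :
    P.σ ^ (3 / P.ε) / (1 - P.α) ^ 2 * d ≤ max 1 (1 / c₁) ^ 2 * P.wScale := by
  have hs := hP.σ_pos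
  have hd := hP.d_pos
  have hη := hP.η_pos
  have := pow_le_pow_left₀ (by positivity) (inv_η_le hP hc₁) 2
  have := mul_le_mul_of_nonneg_right this (by positivity : 0 ≤ P.σ ^ (3 / P.ε) * d)
  unfold wScale
  calc _ = (1 - P.α)⁻¹ ^ 2 * (P.σ ^ (3 / P.ε) * d) := by field_simp
    _ ≤ _ := this
    _ = _ := by ring

lemma sum_rpow_α_le {s : Finset (Fin K)} {x : Fin K → ℝ} (hx : ∀ a ∈ s, 0 ≤ x a) :
    ∑ a ∈ s, x a ^ P.α ≤ Real.exp c₂ * (∑ a ∈ s, x a) ^ P.α := by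
  refine (sum_rpow_le_card s x hP.α_pos hP.α_lt_one.le hx).trans ?_
  refine mul_le_mul_of_nonneg_right ?_ (Real.rpow_nonneg (Finset.sum_nonneg hx) _)
  refine le_trans ?_ (card_rpow_le hP)
  refine Real.rpow_le_rpow (by positivity) ?_ hP.η_pos.le
  exact_mod_cast (Finset.card_le_univ s).trans (by simp)

variable {S : State K} (hS : 0 < S.2)
include hS

omit hS in
lemma h_le : P.h S ≤ 2 * Real.exp c₂ := by
  have hq := (q_spec hP S).1
  have hα := hP.α_pos
  have h1 := sum_rpow_α_le hP (s := Finset.univ) (x := P.q S) fun a _ => hq.1 a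
  rw [hq.2, Real.one_rpow, mul_one] at h1
  rw [h, tsallis_neg_eq, Finset.sum_sub_distrib, hq.2]
  have h2 : 1 / P.α ≤ 2 := by rw [div_le_iff₀ hα]; linarith [hP.half_le_α]
  calc 1 / P.α * (∑ a, P.q S a ^ P.α - 1) ≤ 1 / P.α * Real.exp c₂ :=
        mul_le_mul_of_nonneg_left (by linarith) (by positivity)
    _ ≤ _ := mul_le_mul_of_nonneg_right h2 (Real.exp_pos _).le

lemma w_le (hc₁ : 0 < c₁) : P.w S ≤ max 1 (1 / c₁) ^ 2 * P.wScale := by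
  have hη := hP.η_pos
  have hq := hP.qStar_pos hS
  have h1 : qStar (P.q S) ^ (2 * (1 - P.α)) ≤ 1 :=
    Real.rpow_le_one hq.le (by linarith [qStar_le_half (q := P.q S)]) (by linarith)
  have h2 : 0 ≤ P.σ ^ (3 / P.ε) / (1 - P.α) ^ 2 * d := by
    have := hP.σ_pos
    positivity
  exact (mul_le_of_le_one_right h2 h1).trans (η_sq_mul_le hP hc₁)

variable (hγ : P.γ S ≤ 1 / 2)
include hγ

lemma z_le (hc₁ : 0 < c₁) : P.z S ≤ max 1 (1 / c₁) * P.zScale := by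
  have hη := hP.η_pos
  have hq := hP.qStar_pos hS
  refine (z_le_zBound hP hS hγ).trans ?_
  refine le_trans ?_ (η_rpow_mul_le hP hc₁)
  have h1 : qStar (P.q S) ^ P.αbar ≤ 1 :=
    Real.rpow_le_one hq.le (by linarith [qStar_le_half (q := P.q S)]) hP.αbar_pos.le
  have h2 : 0 ≤ (1 - P.α) ^ (1 - P.ε) * P.σ * (d : ℝ) ^ (P.ε / 2) := by
    have := hP.σ_pos
    positivity
  unfold zBound
  calc _ = ((1 - P.α) ^ (1 - P.ε) * P.σ * (d : ℝ) ^ (P.ε / 2)) * qStar (P.q S) ^ P.αbar := by ring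
    _ ≤ _ := mul_le_of_le_one_right h2 h1

lemma one_sub_p_mem (a : Fin K) : 0 ≤ 1 - P.p S a ∧ 1 - P.p S a ≤ 1 :=
  ⟨by linarith [apply_le_one (p_mem hP hS hγ) a], by linarith [(p_mem hP hS hγ).1 a]⟩

lemma one_sub_q_le (a : Fin K) : 1 - P.q S a ≤ 2 * (1 - P.p S a) := by
  have hq := (q_spec hP S).1.2
  have hp := (p_mem hP hS hγ).2
  rw [← Finset.add_sum_erase _ _ (Finset.mem_univ a)] at hq hp
  have h1 : ∑ b ∈ Finset.univ.erase a, P.q S b ≤ ∑ b ∈ Finset.univ.erase a, 2 * P.p S b :=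
    Finset.sum_le_sum fun b _ => q_le_two_mul_p hP hS hγ b
  rw [← Finset.mul_sum] at h1
  linarith

lemma qStar_le_one_sub_p (a : Fin K) : qStar (P.q S) ≤ 2 * (1 - P.p S a) :=
  (min_le_right _ _).trans ((sub_le_sub_left (apply_le_norm _ a) 1).trans
    (one_sub_q_le hP hS hγ a))

/-- The arms other than `a` have mass `v = 1 - q a` and contribute at most `e^{c₂} v^α`; the term of
`a` contributes at most `v ≤ v^α`. Passing from `q` to `p` costs a factor `2`. -/
lemma h_le_rpow (a : Fin K) : P.h S ≤ 8 * Real.exp c₂ * (1 - P.p S a) ^ P.α := by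
  have hq := (q_spec hP S).1
  have hα := hP.α_pos
  have hE : 1 ≤ Real.exp c₂ := Real.one_le_exp (c₂_nonneg hP)
  obtain ⟨hu0, hu1⟩ := one_sub_p_mem hP hS hγ a
  have hle := one_sub_q_le hP hS hγ a
  set v := 1 - P.q S a
  have hv0 : 0 ≤ v := sub_nonneg.mpr (apply_le_one hq a)
  have hv1 : v ≤ 1 := by have := hq.1 a; simp only [v]; linarith
  have hsum : ∑ b ∈ Finset.univ.erase a, P.q S b = v := by
    have := hq.2
    rw [← Finset.add_sum_erase _ _ (Finset.mem_univ a)] at this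
    simp only [v]; linarith
  have h1 := sum_rpow_α_le hP (s := Finset.univ.erase a) (x := P.q S) fun b _ => hq.1 b
  rw [hsum] at h1
  have h2 : P.q S a ^ P.α ≤ 1 := Real.rpow_le_one (hq.1 a) (apply_le_one hq a) hα.le
  have h3 : v ≤ v ^ P.α := by
    conv_lhs => rw [← Real.rpow_one v]
    exact Real.rpow_le_rpow_of_exponent_ge_of_imp hv0 hv1 hP.α_lt_one.le
      (fun _ h => absurd h (by norm_num))
  have h4 : v ^ P.α ≤ 2 * (1 - P.p S a) ^ P.α := by
    refine (Real.rpow_le_rpow hv0 hle hα.le).trans ?_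
    rw [Real.mul_rpow (by norm_num) hu0]
    refine mul_le_mul_of_nonneg_right ?_ (Real.rpow_nonneg hu0 _)
    conv_rhs => rw [← Real.rpow_one 2]
    exact Real.rpow_le_rpow_of_exponent_le (by norm_num) hP.α_lt_one.le
  have h5 : 1 / P.α ≤ 2 := by rw [div_le_iff₀ hα]; linarith [hP.half_le_α]
  have h6 : ∑ b, (P.q S b ^ P.α - P.q S b) ≤ 2 * Real.exp c₂ * v ^ P.α := by
    rw [Finset.sum_sub_distrib, hq.2, ← Finset.add_sum_erase _ _ (Finset.mem_univ a)]
    have := mul_le_mul_of_nonneg_right hE (Real.rpow_nonneg hv0 P.α)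
    have : P.q S a ^ P.α - 1 ≤ v := by linarith
    linarith
  have h7 := Real.rpow_nonneg hv0 P.α
  rw [h, tsallis_neg_eq]
  calc 1 / P.α * ∑ b, (P.q S b ^ P.α - P.q S b) ≤ 1 / P.α * (2 * Real.exp c₂ * v ^ P.α) :=
        mul_le_mul_of_nonneg_left h6 (by positivity)
    _ ≤ 2 * (2 * Real.exp c₂ * v ^ P.α) := mul_le_mul_of_nonneg_right h5 (by positivity)
    _ ≤ 2 * (2 * Real.exp c₂ * (2 * (1 - P.p S a) ^ P.α)) := by gcongr
    _ = _ := by ring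

/-- All three factors are powers of `u = 1 - p a`, and the exponents `α (ε - 1)`, `(1 - α)(ε - 1)`
and `2 - ε` add up to one. The choice of `z` is made for this. -/
lemma h_rpow_mul_z_le (hc₁ : 0 < c₁) (a : Fin K) :
    P.h S ^ (P.ε - 1) * P.z S ≤
      16 * Real.exp c₂ * max 1 (1 / c₁) * P.zScale * (1 - P.p S a) := by
  have hη := hP.η_pos
  have hα := hP.α_pos
  have hr := hP.one_lt_ε
  have hr2 := hP.ε_le_two
  have hαb := hP.αbar_pos
  have hq := hP.qStar_pos hS
  have hh := h_pos hP hS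
  have hσ := hP.σ_pos
  have hE : 1 ≤ Real.exp c₂ := Real.one_le_exp (c₂_nonneg hP)
  have hqu := qStar_le_one_sub_p hP hS hγ a
  have hu0 : 0 < 1 - P.p S a := by linarith
  have hhu := h_le_rpow hP hS hγ a
  have hpu : 1 - ‖P.p S‖ ≤ 1 - P.p S a := sub_le_sub_left (apply_le_norm _ a) 1
  have hp0 := (one_sub_norm_p_mem hP hS hγ).1
  have hB := η_rpow_mul_le hP hc₁
  set u := 1 - P.p S a
  have pow_le_self : ∀ {x y : ℝ}, 1 ≤ x → y ≤ 1 → x ^ y ≤ x := fun {x y} hx hy => by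
    conv_rhs => rw [← Real.rpow_one x]
    exact Real.rpow_le_rpow_of_exponent_le hx hy
  have h1 : P.h S ^ (P.ε - 1) ≤ 8 * Real.exp c₂ * u ^ (P.α * (P.ε - 1)) := by
    refine (Real.rpow_le_rpow hh.le hhu (by linarith)).trans ?_
    rw [Real.mul_rpow (by positivity) (by positivity), ← Real.rpow_mul hu0.le]
    exact mul_le_mul_of_nonneg_right (pow_le_self (by linarith) (by linarith)) (by positivity)
  have h2 : qStar (P.q S) ^ ((P.ε - 1) * (1 - P.α)) ≤ 2 * u ^ ((P.ε - 1) * (1 - P.α)) := by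
    refine (Real.rpow_le_rpow hq.le hqu hαb.le).trans ?_
    rw [Real.mul_rpow (by norm_num) hu0.le]
    refine mul_le_mul_of_nonneg_right (pow_le_self (by norm_num) ?_) (by positivity)
    exact mul_le_one₀ (by linarith) hη.le (by linarith)
  have h3 : (1 - ‖P.p S‖) ^ (2 - P.ε) ≤ u ^ (2 - P.ε) :=
    Real.rpow_le_rpow hp0 hpu (by linarith)
  have hC0 : 0 ≤ (1 - P.α) ^ (1 - P.ε) * P.σ * (d : ℝ) ^ (P.ε / 2) := by positivity
  have hz : P.z S = ((1 - P.α) ^ (1 - P.ε) * P.σ * (d : ℝ) ^ (P.ε / 2)) *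
      (qStar (P.q S) ^ ((P.ε - 1) * (1 - P.α)) * (1 - ‖P.p S‖) ^ (2 - P.ε)) := by
    unfold z; ring
  have e : u ^ (P.α * (P.ε - 1)) * (u ^ ((P.ε - 1) * (1 - P.α)) * u ^ (2 - P.ε)) = u := by
    rw [← Real.rpow_add hu0, ← Real.rpow_add hu0]
    conv_rhs => rw [← Real.rpow_one u]
    congr 1; ring
  have hZ := zScale_pos hP
  rw [hz]
  calc _ ≤ (8 * Real.exp c₂ * u ^ (P.α * (P.ε - 1))) * ((max 1 (1 / c₁) * P.zScale) *
        ((2 * u ^ ((P.ε - 1) * (1 - P.α))) * u ^ (2 - P.ε))) := by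
        have := Real.rpow_nonneg hp0 (2 - P.ε)
        gcongr
    _ = 16 * Real.exp c₂ * max 1 (1 / c₁) * P.zScale *
        (u ^ (P.α * (P.ε - 1)) * (u ^ ((P.ε - 1) * (1 - P.α)) * u ^ (2 - P.ε))) := by ring
    _ = _ := by rw [e]

/-- Here the exponents `2 α` and `2 (1 - α)` add up to two, one more than needed; `u² ≤ u`. -/
lemma h_sq_mul_w_le (hc₁ : 0 < c₁) (a : Fin K) :
    P.h S ^ (2 : ℝ) * P.w S ≤
      128 * Real.exp c₂ ^ 2 * max 1 (1 / c₁) ^ 2 * P.wScale * (1 - P.p S a) := by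
  have hη := hP.η_pos
  have hα := hP.α_pos
  have hq := hP.qStar_pos hS
  have hh := h_pos hP hS
  have hσ := hP.σ_pos
  have hqu := qStar_le_one_sub_p hP hS hγ a
  have hu0 : 0 < 1 - P.p S a := by linarith
  have hu1 := (one_sub_p_mem hP hS hγ a).2
  have hhu := h_le_rpow hP hS hγ a
  have hB := η_sq_mul_le hP hc₁
  set u := 1 - P.p S a
  have h1 : P.h S ^ 2 ≤ (8 * Real.exp c₂ * u ^ P.α) ^ 2 := pow_le_pow_left₀ hh.le hhu 2
  have h2 : qStar (P.q S) ^ (2 * (1 - P.α)) ≤ 2 * u ^ (2 * (1 - P.α)) := by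
    refine (Real.rpow_le_rpow hq.le hqu (by linarith)).trans ?_
    rw [Real.mul_rpow (by norm_num) hu0.le]
    refine mul_le_mul_of_nonneg_right ?_ (by positivity)
    conv_rhs => rw [← Real.rpow_one 2]
    exact Real.rpow_le_rpow_of_exponent_le (by norm_num) (by linarith [hP.half_le_α])
  have e : (u ^ P.α) ^ 2 * u ^ (2 * (1 - P.α)) = u ^ 2 := by
    rw [← Real.rpow_natCast (u ^ P.α), ← Real.rpow_mul hu0.le, ← Real.rpow_add hu0,
      ← Real.rpow_natCast u]
    congr 1; push_cast; ring
  have hW := wScale_pos hP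
  rw [Real.rpow_two, w]
  calc _ ≤ (8 * Real.exp c₂ * u ^ P.α) ^ 2 * ((max 1 (1 / c₁) ^ 2 * P.wScale) *
        (2 * u ^ (2 * (1 - P.α)))) := by gcongr
    _ = 128 * Real.exp c₂ ^ 2 * max 1 (1 / c₁) ^ 2 * P.wScale *
        ((u ^ P.α) ^ 2 * u ^ (2 * (1 - P.α))) := by ring
    _ = 128 * Real.exp c₂ ^ 2 * max 1 (1 / c₁) ^ 2 * P.wScale * u ^ 2 := by rw [e]
    _ ≤ _ := by
        refine mul_le_mul_of_nonneg_left ?_ (by positivity)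
        nlinarith

end Params

/-! ### Initial values and the accumulated cost along a trajectory. -/

namespace Params

variable {K d : ℕ} {P : Params K d} {c₁ c₂ : ℝ} {T : ℕ}

section Extrema

variable (hP : P.Admissible c₁ c₂ T) {zmax wmax : ℝ}
include hP

lemma γ_state₁_le (hT : 1 ≤ T) : P.γ P.state₁ ≤ 1 / 2 := hP.γ_le_half 0 hT Fin.elim0

lemma zmax_nonneg (hT : 1 ≤ T) (hz : P.IsZMax T zmax) : 0 ≤ zmax :=
  (z_nonneg hP (S := P.state₁) hP.β₁_pos (γ_state₁_le hP hT)).trans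
    (hz.1 ⟨0, hT, Fin.elim0, rfl⟩)

lemma wmax_nonneg (hT : 1 ≤ T) (hw : P.IsWMax T wmax) : 0 ≤ wmax :=
  (w_nonneg hP (S := P.state₁) hP.β₁_pos).trans (hw.1 ⟨0, hT, Fin.elim0, rfl⟩)

lemma zmax_le (hc₁ : 0 < c₁) (hz : P.IsZMax T zmax) : zmax ≤ max 1 (1 / c₁) * P.zScale :=
  hz.2 fun _ ⟨t, ht, o, h⟩ => h ▸ z_le hP (state_pos hP ht.le o) (hP.γ_le_half t ht o) hc₁

lemma wmax_le (hc₁ : 0 < c₁) (hw : P.IsWMax T wmax) : wmax ≤ max 1 (1 / c₁) ^ 2 * P.wScale :=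
  hw.2 fun _ ⟨_, ht, o, h⟩ => h ▸ w_le hP (state_pos hP ht.le o) hc₁

lemma h₁_pos : 0 < P.h₁ := h_pos hP (S := P.state₁) hP.β₁_pos

lemma h₁_le : P.h₁ ≤ 2 * Real.exp c₂ := h_le hP

lemma hbar_nonneg : 0 ≤ P.hbar :=
  entropy_nonneg hP.αbar_pos (by linarith [hP.αbar_le]) (q_spec hP P.state₁).1

end Extrema

section Path

lemma cumulative_eq_sum (f : State K → ℝ) (o : ℕ → Fin K × ℝ) (t : ℕ) :
    P.cumulative f t (fun i => o i) =
      ∑ s ∈ Finset.range t, f (P.state s fun i => o i) := by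
  induction t with
  | zero => rfl
  | succ t ih =>
    rw [Finset.sum_range_succ, ← ih]
    rfl

/-- Sums along a trajectory are sums over a sequence of states. -/
lemma exists_path (hP : P.Admissible c₁ c₂ T) (o : Obs K T) :
    ∃ S : ℕ → State K, S 0 = P.state₁ ∧ (∀ t, ∃ x, S (t + 1) = P.next (S t) x) ∧
      (∀ t, ∃ o', S t = P.state t o') ∧
      ∀ f, P.cumulative f T o = ∑ t ∈ Finset.range T, f (S t) := by
  have hK : 0 < K := by have := hP.two_le_K; omega
  -- Beyond the horizon the observations are padded arbitrarily; the sums only involve rounds before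
  -- `T`.
  let o' : ℕ → Fin K × ℝ := fun i => if h : i < T then o ⟨i, h⟩ else (⟨0, hK⟩, 0)
  refine ⟨fun t => P.state t fun i => o' i, rfl, fun t => ⟨o' t, rfl⟩, fun t => ⟨_, rfl⟩,
    fun f => ?_⟩
  rw [← cumulative_eq_sum]
  congr 1
  funext i
  simp [o']

variable (hP : P.Admissible c₁ c₂ T) {zmax wmax : ℝ}
include hP

lemma rate_next {S : State K} (hS : 0 < S.2) (x : Fin K × ℝ) :
    P.h S * ((P.next S x).2 - S.2) = P.z S * S.2 ^ (-(P.ε - 1)) + P.w S * S.2 ^ (-2 : ℝ) := by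
  have hh := h_pos hP hS
  rw [Real.rpow_neg hS.le 2, Real.rpow_two, neg_sub, next]
  field_simp
  ring

/-- The accumulated cost along a trajectory: a bound in terms of the number of rounds, and bounds in
terms of the probabilities of the arms other than `a`. -/
lemma cumulative_cost_le (hT : 1 ≤ T) (hz : P.IsZMax T zmax) (hw : P.IsWMax T wmax) (o : Obs K T) :
    P.cumulative P.cost T o ≤ (zmax * P.β₁ ^ (1 - P.ε) + wmax / P.β₁ ^ 2) +
      (2 * ((2 * Real.exp c₂) ^ (P.ε - 1) * (T * zmax)) ^ (1 / P.ε) +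
      2 * ((2 * Real.exp c₂) ^ (2 : ℝ) * (T * wmax)) ^ (1 / 3 : ℝ)) ∧
    (0 < c₁ → ∀ (a : Fin K) (J₁ J₂ : ℕ),
      P.cumulative P.cost T o ≤ (zmax * P.β₁ ^ (1 - P.ε) + wmax / P.β₁ ^ 2) +
      (4 * ((J₁ : ℝ) ^ ((P.ε - 1) / P.ε) * (16 * Real.exp c₂ * max 1 (1 / c₁) * P.zScale *
          P.cumulative (fun S => 1 - P.p S a) T o) ^ (1 / P.ε)) +
        2 * ((2 * Real.exp c₂ / 2 ^ J₁) ^ (P.ε - 1) * (T * zmax)) ^ (1 / P.ε)) +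
      (4 * ((J₂ : ℝ) ^ (2 / 3 : ℝ) * (128 * Real.exp c₂ ^ 2 * max 1 (1 / c₁) ^ 2 * P.wScale *
          P.cumulative (fun S => 1 - P.p S a) T o) ^ (1 / 3 : ℝ)) +
        2 * ((2 * Real.exp c₂ / 2 ^ J₂) ^ (2 : ℝ) * (T * wmax)) ^ (1 / 3 : ℝ))) := by
  obtain ⟨S, hS0, hnext, hstate, hcum⟩ := exists_path hP o
  have hr : 0 < P.ε - 1 := by linarith [hP.one_lt_ε]
  have hpos : ∀ t ≤ T, 0 < (S t).2 := fun t ht => by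
    obtain ⟨o', h⟩ := hstate t
    exact h ▸ state_pos hP ht o'
  have hγ : ∀ t < T, P.γ (S t) ≤ 1 / 2 := fun t ht => by
    obtain ⟨o', h⟩ := hstate t
    exact h ▸ hP.γ_le_half t ht o'
  have hz0 : ∀ t < T, 0 ≤ P.z (S t) := fun t ht => z_nonneg hP (hpos t ht.le) (hγ t ht)
  have hw0 : ∀ t < T, 0 ≤ P.w (S t) := fun t ht => w_nonneg hP (hpos t ht.le)
  have hzm : ∀ t < T, P.z (S t) ≤ zmax := fun t ht => by
    obtain ⟨o', h⟩ := hstate t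
    exact hz.1 ⟨t, ht, o', by rw [h]⟩
  have hwm : ∀ t < T, P.w (S t) ≤ wmax := fun t ht => by
    obtain ⟨o', h⟩ := hstate t
    exact hw.1 ⟨t, ht, o', by rw [h]⟩
  have hh : ∀ t < T, 0 < P.h (S t) := fun t ht => h_pos hP (hpos t ht.le)
  have hH : ∀ t < T, P.h (S t) ≤ 2 * Real.exp c₂ := fun t _ => h_le hP
  have hH0 : 0 < 2 * Real.exp c₂ := by positivity
  have hrate : ∀ t < T, P.h (S t) * ((S (t + 1)).2 - (S t).2) =
      P.z (S t) * (S t).2 ^ (-(P.ε - 1)) + P.w (S t) * (S t).2 ^ (-2 : ℝ) := fun t ht => by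
    obtain ⟨x, h⟩ := hnext t
    rw [h]
    exact rate_next hP (hpos t ht.le) x
  have ht1 : ∀ t < T, 0 ≤ P.z (S t) * (S t).2 ^ (-(P.ε - 1)) := fun t ht =>
    mul_nonneg (hz0 t ht) (Real.rpow_nonneg (hpos t ht.le).le _)
  have ht2 : ∀ t < T, 0 ≤ P.w (S t) * (S t).2 ^ (-2 : ℝ) := fun t ht =>
    mul_nonneg (hw0 t ht) (Real.rpow_nonneg (hpos t ht.le).le _)
  have hmono : ∀ t < T, (S t).2 ≤ (S (t + 1)).2 := fun t ht => by
    have h1 := hrate t ht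
    have h2 := ht1 t ht
    have h3 := ht2 t ht
    have := nonneg_of_mul_nonneg_right (by linarith : 0 ≤ P.h (S t) * ((S (t + 1)).2 - (S t).2))
      (hh t ht)
    linarith
  -- Each of the two terms alone is below the increment of the rate times the entropy, so `z` and
  -- `w` can be treated separately, with exponents `ε - 1` and `2`.
  have hstepz : ∀ t < T, P.z (S t) * (S t).2 ^ (-(P.ε - 1)) ≤
      P.h (S t) * ((S (t + 1)).2 - (S t).2) := fun t ht => by
    rw [hrate t ht]; linarith [ht2 t ht]
  have hstepw : ∀ t < T, P.w (S t) * (S t).2 ^ (-2 : ℝ) ≤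
      P.h (S t) * ((S (t + 1)).2 - (S t).2) := fun t ht => by
    rw [hrate t ht]; linarith [ht1 t ht]
  have hcost : P.cumulative P.cost T o =
      ∑ t ∈ Finset.range T, P.z (S t) * (S t).2 ^ (-(P.ε - 1)) +
      ∑ t ∈ Finset.range T, P.w (S t) * (S t).2 ^ (-2 : ℝ) := by
    rw [hcum, ← Finset.sum_add_distrib]
    refine Finset.sum_congr rfl fun t ht => ?_
    have := hpos t (Finset.mem_range.mp ht).le
    rw [cost, Real.rpow_neg this.le 2, Real.rpow_two, neg_sub, mul_comm, div_eq_mul_inv]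
  have hzmax := zmax_nonneg hP hT hz
  have hwmax := wmax_nonneg hP hT hw
  have hβ0 : (S 0).2 = P.β₁ := by rw [hS0]; rfl
  have e1 : 1 + (P.ε - 1) = P.ε := by ring
  have e2 : (1 : ℝ) + 2 = 3 := by norm_num
  have e3 : wmax * P.β₁ ^ (-2 : ℝ) = wmax / P.β₁ ^ 2 := by
    rw [Real.rpow_neg hP.β₁_pos.le, Real.rpow_two, div_eq_mul_inv]
  constructor
  · have h1 := sum_cost_le (β := fun t => (S t).2) hr hpos hmono hz0 hzm hzmax hstepz hH0 hH
    have h2 := sum_cost_le (β := fun t => (S t).2) two_pos hpos hmono hw0 hwm hwmax hstepw hH0 hH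
    rw [hβ0, e1, neg_sub] at h1
    rw [hβ0, e2, e3] at h2
    rw [neg_sub] at hcost
    linarith
  · intro hc₁ a J₁ J₂
    have h1 := sum_cost_le_levels (β := fun t => (S t).2) hr hpos hmono hz0 hzm hzmax hstepz hH0 hH
      hh J₁
    have h2 := sum_cost_le_levels (β := fun t => (S t).2) two_pos hpos hmono hw0 hwm hwmax hstepw
      hH0 hH hh J₂
    rw [hβ0, e1, neg_sub] at h1
    rw [hβ0, e2, e3] at h2
    have h3 : ∑ t ∈ Finset.range T, P.h (S t) ^ (P.ε - 1) * P.z (S t) ≤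
        16 * Real.exp c₂ * max 1 (1 / c₁) * P.zScale *
          P.cumulative (fun S => 1 - P.p S a) T o := by
      rw [hcum, Finset.mul_sum]
      refine Finset.sum_le_sum fun t ht => ?_
      have ht := Finset.mem_range.mp ht
      exact h_rpow_mul_z_le hP (hpos t ht.le) (hγ t ht) hc₁ a
    have h4 : ∑ t ∈ Finset.range T, P.h (S t) ^ (2 : ℝ) * P.w (S t) ≤
        128 * Real.exp c₂ ^ 2 * max 1 (1 / c₁) ^ 2 * P.wScale *
          P.cumulative (fun S => 1 - P.p S a) T o := by
      rw [hcum, Finset.mul_sum]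
      refine Finset.sum_le_sum fun t ht => ?_
      have ht := Finset.mem_range.mp ht
      exact h_sq_mul_w_le hP (hpos t ht.le) (hγ t ht) hc₁ a
    have hε : 0 < P.ε := by linarith
    have h5 := mul_le_mul_of_nonneg_left (Real.rpow_le_rpow (Finset.sum_nonneg fun t ht =>
      mul_nonneg (Real.rpow_nonneg (hh t (Finset.mem_range.mp ht)).le _)
        (hz0 t (Finset.mem_range.mp ht))) h3 (by positivity : 0 ≤ 1 / P.ε))
      (by positivity : 0 ≤ (J₁ : ℝ) ^ ((P.ε - 1) / P.ε))
    have h6 := mul_le_mul_of_nonneg_left (Real.rpow_le_rpow (Finset.sum_nonneg fun t ht =>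
      mul_nonneg (Real.rpow_nonneg (hh t (Finset.mem_range.mp ht)).le _)
        (hw0 t (Finset.mem_range.mp ht))) h4 (by positivity : (0 : ℝ) ≤ 1 / 3))
      (by positivity : 0 ≤ (J₂ : ℝ) ^ (2 / 3 : ℝ))
    rw [neg_sub] at hcost
    linarith

end Path

/-! ### The self-bounding coefficients. -/

section Gaps

variable {Δ : Fin K → ℝ} {aStar : Fin K}

lemma minGap_le {a : Fin K} (ha : a ≠ aStar) : minGap Δ aStar ≤ Δ a :=
  ciInf_le (finite_range _).bddBelow (⟨a, ha⟩ : {a : Fin K // a ≠ aStar})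

lemma minGap_pos (hK : 2 ≤ K) (hΔ : ∀ a, a ≠ aStar → 0 < Δ a) : 0 < minGap Δ aStar := by
  have : Nontrivial (Fin K) := Fin.nontrivial_iff_two_le.mpr hK
  obtain ⟨b, hb⟩ := exists_ne aStar
  have : Nonempty {a : Fin K // a ≠ aStar} := ⟨⟨b, hb⟩⟩
  obtain ⟨i, hi⟩ := exists_eq_ciInf_of_finite (f := fun a : {a : Fin K // a ≠ aStar} => Δ a)
  rw [minGap, ← hi]
  exact hΔ i i.2

variable (hP : P.Admissible c₁ c₂ T) (hΔ : ∀ a, a ≠ aStar → 0 < Δ a)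
include hP hΔ

/-- The exponent is negative, so each summand is at most the one of the smallest gap. Counting at
most `K` summands costs `K^{(1-α)θ} ≤ e^{c₂ θ}`. -/
lemma sum_gap_rpow_mem {θ : ℝ} (hθ : 0 ≤ θ) :
    0 ≤ ∑ a ∈ Finset.univ.erase aStar, Δ a ^ (P.α / (P.α - 1)) ∧
    (∑ a ∈ Finset.univ.erase aStar, Δ a ^ (P.α / (P.α - 1))) ^ ((1 - P.α) * θ) ≤
      Real.exp c₂ ^ θ * minGap Δ aStar ^ (-(P.α * θ)) := by
  have hη := hP.η_pos
  have hα := hP.α_pos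
  have hm := minGap_pos hP.two_le_K hΔ
  have hexp : P.α / (P.α - 1) ≤ 0 := div_nonpos_of_nonneg_of_nonpos hα.le (by linarith)
  have h0 : 0 ≤ ∑ a ∈ Finset.univ.erase aStar, Δ a ^ (P.α / (P.α - 1)) :=
    Finset.sum_nonneg fun a ha => Real.rpow_nonneg (hΔ a (Finset.ne_of_mem_erase ha)).le _
  refine ⟨h0, ?_⟩
  have h1 : ∑ a ∈ Finset.univ.erase aStar, Δ a ^ (P.α / (P.α - 1)) ≤
      K * minGap Δ aStar ^ (P.α / (P.α - 1)) := by
    refine (Finset.sum_le_card_nsmul _ _ (minGap Δ aStar ^ (P.α / (P.α - 1))) fun a ha =>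
      Real.rpow_le_rpow_of_nonpos hm (minGap_le (Finset.ne_of_mem_erase ha)) hexp).trans ?_
    rw [nsmul_eq_mul]
    refine mul_le_mul_of_nonneg_right ?_ (by positivity)
    exact_mod_cast (Finset.card_le_univ _).trans (by simp)
  refine (Real.rpow_le_rpow h0 h1 (by positivity)).trans ?_
  rw [Real.mul_rpow (by positivity) (by positivity), ← Real.rpow_mul hm.le,
    Real.rpow_mul (Nat.cast_nonneg K)]
  have e : P.α / (P.α - 1) * ((1 - P.α) * θ) = -(P.α * θ) := by
    have : P.α - 1 ≠ 0 := by linarith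
    field_simp; ring
  rw [e]
  exact mul_le_mul_of_nonneg_right (Real.rpow_le_rpow (by positivity) (card_rpow_le hP) hθ)
    (by positivity)

/-- The powers `-α(ε - 1)` and `α(ε - 1) - 1` of the smallest gap combine to `-1`. -/
lemma ζ_le (hc₁ : 0 < c₁) : P.ζ Δ aStar ≤ 4 * Real.exp c₂ * max 1 (1 / c₁) *
    (Real.log K ^ (P.ε - 1) * P.σ * (d : ℝ) ^ (P.ε / 2) / minGap Δ aStar) := by
  have hη := hP.η_pos
  have hα := hP.α_pos
  have hr := hP.one_lt_ε
  have hr2 := hP.ε_le_two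
  have hσ := hP.σ_pos
  have hm := minGap_pos hP.two_le_K hΔ
  have hE : 1 ≤ Real.exp c₂ := Real.one_le_exp (c₂_nonneg hP)
  have pow_le_self : ∀ {x y : ℝ}, 1 ≤ x → y ≤ 1 → x ^ y ≤ x := fun {x y} hx hy => by
    conv_rhs => rw [← Real.rpow_one x]
    exact Real.rpow_le_rpow_of_exponent_le hx hy
  obtain ⟨h0, h1⟩ := sum_gap_rpow_mem hP hΔ (θ := P.ε - 1) (by linarith)
  have h2 : (2 : ℝ) ^ (P.ε - 1) ≤ 2 := pow_le_self (by norm_num) (by linarith)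
  have h3 : P.α ^ (1 - P.ε) ≤ 2 := by
    refine (Real.rpow_le_rpow_of_nonpos (by norm_num) hP.half_le_α (by linarith)).trans ?_
    rw [one_div, Real.inv_rpow (by norm_num), ← Real.rpow_neg (by norm_num)]
    exact pow_le_self (by norm_num) (by linarith)
  have h4 : Real.exp c₂ ^ (P.ε - 1) ≤ Real.exp c₂ := pow_le_self hE (by linarith)
  have h5 := η_rpow_mul_le hP hc₁
  have e : minGap Δ aStar ^ (-(P.α * (P.ε - 1))) * minGap Δ aStar ^ (P.α * (P.ε - 1) - 1) =
      (minGap Δ aStar)⁻¹ := by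
    rw [← Real.rpow_add hm, ← Real.rpow_neg_one]; congr 1; ring
  have h6 := zScale_pos hP
  unfold ζ
  rw [Real.mul_rpow hη.le hα.le]
  calc _ = (2 ^ (P.ε - 1) * P.α ^ (1 - P.ε)) * ((1 - P.α) ^ (1 - P.ε) * P.σ *
        (d : ℝ) ^ (P.ε / 2)) * ((∑ a ∈ Finset.univ.erase aStar, Δ a ^ (P.α / (P.α - 1))) ^
          ((1 - P.α) * (P.ε - 1)) * minGap Δ aStar ^ (P.α * (P.ε - 1) - 1)) := by ring
    _ ≤ (2 * 2) * (max 1 (1 / c₁) * P.zScale) * ((Real.exp c₂ *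
        minGap Δ aStar ^ (-(P.α * (P.ε - 1)))) * minGap Δ aStar ^ (P.α * (P.ε - 1) - 1)) := by
        have := Real.rpow_nonneg h0 ((1 - P.α) * (P.ε - 1))
        have h7 := h1.trans (mul_le_mul_of_nonneg_right h4
          (Real.rpow_nonneg hm.le (-(P.α * (P.ε - 1)))))
        gcongr
    _ = (2 * 2) * (max 1 (1 / c₁) * P.zScale) * (Real.exp c₂ *
        (minGap Δ aStar ^ (-(P.α * (P.ε - 1))) * minGap Δ aStar ^ (P.α * (P.ε - 1) - 1))) := by
        ring
    _ = _ := by rw [e]; unfold zScale; ring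

/-- The sum only yields the power `-2α` of the smallest gap; a gap of at most one is needed to
replace it by `-2`. -/
lemma ω_le (hc₁ : 0 < c₁) (hm1 : minGap Δ aStar ≤ 1) :
    P.ω Δ aStar ≤ 4 * Real.exp c₂ ^ 2 * max 1 (1 / c₁) ^ 2 *
      (P.σ ^ (3 / P.ε) * d * (Real.log K / minGap Δ aStar) ^ 2) := by
  have hη := hP.η_pos
  have hα := hP.α_pos
  have hσ := hP.σ_pos
  have hm := minGap_pos hP.two_le_K hΔ
  obtain ⟨h0, h1⟩ := sum_gap_rpow_mem hP hΔ (θ := 2) (by norm_num)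
  rw [mul_comm (1 - P.α), Real.rpow_two] at h1
  have h2 : 1 / P.α ^ 2 ≤ 4 := by
    rw [div_le_iff₀ (by positivity)]
    nlinarith [hP.half_le_α]
  have h3 : minGap Δ aStar ^ (-(P.α * 2)) ≤ (minGap Δ aStar ^ 2)⁻¹ := by
    rw [← Real.rpow_two, ← Real.rpow_neg hm.le]
    exact Real.rpow_le_rpow_of_exponent_ge hm hm1 (by linarith [hP.α_lt_one])
  have h5 := η_sq_mul_le hP hc₁
  have h6 := wScale_pos hP
  unfold ω
  calc _ = 1 / P.α ^ 2 * (P.σ ^ (3 / P.ε) / (1 - P.α) ^ 2 * d) *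
        (∑ a ∈ Finset.univ.erase aStar, Δ a ^ (P.α / (P.α - 1))) ^ (2 * (1 - P.α)) := by
        field_simp
    _ ≤ 4 * (max 1 (1 / c₁) ^ 2 * P.wScale) *
        (Real.exp c₂ ^ 2 * (minGap Δ aStar ^ 2)⁻¹) := by
        have h7 := h1.trans (mul_le_mul_of_nonneg_left h3 (by positivity))
        have := Real.rpow_nonneg h0 (2 * (1 - P.α))
        gcongr
    _ = _ := by unfold wScale; field_simp

end Gaps

end Params

/-! ### Choosing the number of levels and solving the self-bounding inequality. -/

section RealBounds

lemma mul_rpow_le_mul {c x θ : ℝ} (hc : 1 ≤ c) (hx : 0 ≤ x) (hθ1 : θ ≤ 1) :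
    (c * x) ^ θ ≤ c * x ^ θ := by
  rw [Real.mul_rpow (by linarith) hx]
  refine mul_le_mul_of_nonneg_right ?_ (Real.rpow_nonneg hx _)
  conv_rhs => rw [← Real.rpow_one c]
  exact Real.rpow_le_rpow_of_exponent_le hc hθ1

lemma one_le_logPlus (x : ℝ) : 1 ≤ logPlus x := le_max_left _ _

lemma le_exp_logPlus {x : ℝ} (hx : 0 ≤ x) : x ≤ Real.exp (logPlus x) := by
  rcases hx.eq_or_lt with rfl | hx
  · exact (Real.exp_pos _).le
  · calc x = Real.exp (Real.log x) := (Real.exp_log hx).symm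
      _ ≤ _ := Real.exp_le_exp.mpr (le_max_right _ _)

/-- Logarithmically many dyadic levels make the remainder term of `sum_cost_le_levels` small. -/
lemma exists_level_count {ρ X A C : ℝ} (hρ : 0 < ρ) (hX : 0 < X) (hA : 0 ≤ A) (hC : 0 ≤ C) :
    ∃ J : ℕ, (J : ℝ) ≤ (2 + ρ) / ρ * logPlus (A / (X ^ (1 + ρ) + C)) ∧
      ((1 / 2 ^ J) ^ ρ * A) ^ (1 / (1 + ρ)) ≤ X + C ^ (1 / (1 + ρ)) := by
  set D := X ^ (1 + ρ) + C with hD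
  have hDpos : 0 < D := by positivity
  set L := logPlus (A / D)
  have hL : 1 ≤ L := one_le_logPlus _
  -- As `log 2 ≥ 1/2`, this many halvings give `2^{-Jρ} ≤ e^{-L}`. The `1` lost to rounding up is
  -- absorbed by `L ≥ 1`, which is why the logarithm is truncated from below.
  refine ⟨⌈2 * L / ρ⌉₊, ?_, ?_⟩
  · refine (Nat.ceil_lt_add_one (by positivity)).le.trans ?_
    have : (2 + ρ) / ρ * L = 2 * L / ρ + L := by field_simp
    linarith
  · have hJ := Nat.le_ceil (2 * L / ρ)
    set J := ⌈2 * L / ρ⌉₊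
    rw [div_le_iff₀ hρ] at hJ
    have h1 : (1 / 2 ^ J : ℝ) ^ ρ ≤ Real.exp (-L) := by
      rw [Real.rpow_def_of_pos (by positivity), one_div, Real.log_inv, Real.log_pow]
      refine Real.exp_le_exp.mpr ?_
      have : (J * ρ) * (1 / 2) ≤ (J * ρ) * Real.log 2 :=
        mul_le_mul_of_nonneg_left (by linarith [Real.log_two_gt_d9]) (by positivity)
      linarith
    have h2 : A ≤ Real.exp L * D := (div_le_iff₀ hDpos).mp (le_exp_logPlus (by positivity))
    have h3 : (1 / 2 ^ J : ℝ) ^ ρ * A ≤ D := by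
      calc _ ≤ Real.exp (-L) * (Real.exp L * D) := by gcongr
        _ = D := by rw [← mul_assoc, ← Real.exp_add]; simp
    have h4 : 1 / (1 + ρ) ≤ 1 := by rw [div_le_one (by positivity)]; linarith
    refine (Real.rpow_le_rpow (by positivity) h3 (by positivity)).trans ?_
    refine (Real.rpow_add_le_add_rpow (by positivity) hC (by positivity) h4).trans ?_
    rw [← Real.rpow_mul hX.le, mul_one_div_cancel (by positivity), Real.rpow_one]

/-- With `Q` factored out, `(Y / Q)^θ` is at most `1` or at most `(Y / Q)^η`. This reduces the
exponent `1/3` of the exploration term to `1/ε`. -/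
lemma rpow_mul_rpow_le_add {Q Y θ η : ℝ} (hQ : 0 < Q) (hY : 0 ≤ Y) (h0 : 0 ≤ θ) (h : θ ≤ η) :
    Q ^ (1 - θ) * Y ^ θ ≤ Q + Q ^ (1 - η) * Y ^ η := by
  have e : ∀ ξ : ℝ, Q ^ (1 - ξ) * Y ^ ξ = Q * (Y / Q) ^ ξ := fun ξ => by
    rw [Real.rpow_sub hQ, Real.rpow_one, Real.div_rpow hY hQ.le]; ring
  rw [e, e]
  have hyq : 0 ≤ Y / Q := by positivity
  rcases le_total (Y / Q) 1 with h1 | h1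
  · have := mul_le_mul_of_nonneg_left (Real.rpow_le_one hyq h1 h0) hQ.le
    have := mul_nonneg hQ.le (Real.rpow_nonneg hyq η)
    linarith
  · have := mul_le_mul_of_nonneg_left (Real.rpow_le_rpow_of_exponent_le h1 h) hQ.le
    linarith

/-- Solving the self-bounding inequality for the regret `R`. -/
lemma exists_bound_of_selfBounding {θ c m : ℝ} (hθ : 1 / 2 ≤ θ) (hθ1 : θ < 1) (hc : 0 < c)
    (hm : 0 < m) : ∃ M : ℝ, 0 < M ∧ ∀ R C Q k : ℝ, 0 ≤ C → m ≤ Q → 0 ≤ k → 0 ≤ R + C →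
      R ≤ c * (k + Q + C ^ θ + C ^ (1 / 3 : ℝ) + Q ^ (1 - θ) * (R + C) ^ θ +
        Q ^ (2 / 3 : ℝ) * (R + C) ^ (1 / 3 : ℝ)) →
      R ≤ M * (Q + C ^ θ * Q ^ (1 - θ) + k) := by
  set c' := c * (2 + (m⁻¹) ^ (1 - θ) + (m⁻¹) ^ (2 / 3 : ℝ)) with hc'
  have hc'0 : 0 < c' := by positivity
  refine ⟨5 * c' + (8 * c') ^ (1 / (1 - θ)), by positivity, ?_⟩
  intro R C Q k hC hQm hk hY hR
  have hQ : 0 < Q := hm.trans_le hQm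
  have hθ0 : 0 < θ := by linarith
  set D := Q + C ^ θ * Q ^ (1 - θ) + k with hD
  have hCθ : 0 ≤ C ^ θ := Real.rpow_nonneg hC _
  have hQθ : 0 ≤ Q ^ (1 - θ) := Real.rpow_nonneg hQ.le _
  have hYθ : 0 ≤ (R + C) ^ θ := Real.rpow_nonneg hY _
  have hQD : Q ≤ D := by have := mul_nonneg hCθ hQθ; linarith
  -- The lower bound on `Q` turns a bare power of `C` into one multiplied by a power of `Q`.
  have hone : ∀ ξ : ℝ, 0 ≤ ξ → 1 ≤ m⁻¹ ^ ξ * Q ^ ξ := fun ξ hξ => by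
    rw [← Real.mul_rpow (by positivity) hQ.le]
    refine Real.one_le_rpow ?_ hξ
    rw [inv_mul_eq_div, one_le_div hm]; exact hQm
  have h1 : C ^ θ ≤ m⁻¹ ^ (1 - θ) * D := by
    have := mul_le_mul_of_nonneg_left (hone (1 - θ) (by linarith)) hCθ
    have h2 : C ^ θ * Q ^ (1 - θ) ≤ D := by linarith
    have := mul_le_mul_of_nonneg_left h2 (by positivity : 0 ≤ m⁻¹ ^ (1 - θ))
    linarith
  have h2 : C ^ (1 / 3 : ℝ) ≤ m⁻¹ ^ (2 / 3 : ℝ) * D := by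
    have h3 := mul_le_mul_of_nonneg_left (hone (2 / 3) (by norm_num))
      (Real.rpow_nonneg hC (1 / 3))
    have h4 := rpow_mul_rpow_le_add hQ hC (by norm_num : (0 : ℝ) ≤ 1 / 3) (by linarith : 1 / 3 ≤ θ)
    rw [show (1 : ℝ) - 1 / 3 = 2 / 3 by norm_num] at h4
    have h5 : Q ^ (2 / 3 : ℝ) * C ^ (1 / 3 : ℝ) ≤ D := by linarith
    have := mul_le_mul_of_nonneg_left h5 (by positivity : 0 ≤ m⁻¹ ^ (2 / 3 : ℝ))
    linarith
  have h3 := rpow_mul_rpow_le_add hQ hY (by norm_num : (0 : ℝ) ≤ 1 / 3) (by linarith : 1 / 3 ≤ θ)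
  rw [show (1 : ℝ) - 1 / 3 = 2 / 3 by norm_num] at h3
  have hD0 : 0 < D := by linarith
  have hQY : 0 ≤ Q ^ (1 - θ) * (R + C) ^ θ := mul_nonneg hQθ hYθ
  have hR2 : R ≤ c' * (D + Q ^ (1 - θ) * (R + C) ^ θ) := by
    refine hR.trans ?_
    rw [hc', mul_assoc]
    refine mul_le_mul_of_nonneg_left ?_ hc.le
    have h4 : 0 ≤ m⁻¹ ^ (1 - θ) * (Q ^ (1 - θ) * (R + C) ^ θ) := by positivity
    have h5 : 0 ≤ m⁻¹ ^ (2 / 3 : ℝ) * (Q ^ (1 - θ) * (R + C) ^ θ) := by positivity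
    have h6 : k + Q ≤ D := by have := mul_nonneg hCθ hQθ; linarith
    nlinarith
  have two_le : ∀ x : ℝ, 0 ≤ x → (2 * x) ^ θ ≤ 2 * x ^ θ := fun x hx =>
    mul_rpow_le_mul (by norm_num) hx hθ1.le
  have hlast : 0 ≤ (8 * c') ^ (1 / (1 - θ)) := by positivity
  -- If `R ≤ C`, the power of `R + C` is controlled by that of `C`. Otherwise either `R ≤ 2 c' D`,
  -- or the `D`-term is at most half of `R` and the inequality becomes `R^{1-θ} ≤ 8 c' Q^{1-θ}`.
  rcases le_total R C with hRC | hCR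
  · have h4 : (R + C) ^ θ ≤ 2 * C ^ θ :=
      (Real.rpow_le_rpow hY (by linarith) hθ0.le).trans (two_le C hC)
    have h5 : Q ^ (1 - θ) * (R + C) ^ θ ≤ 2 * D := by
      have := mul_le_mul_of_nonneg_left h4 hQθ
      linarith
    have h6 := mul_le_mul_of_nonneg_left (add_le_add (le_refl D) h5) hc'0.le
    have := mul_nonneg hlast hD0.le
    have := mul_pos hc'0 hD0
    linarith
  · have hR0 : 0 ≤ R := hC.trans hCR
    have h4 : (R + C) ^ θ ≤ 2 * R ^ θ :=
      (Real.rpow_le_rpow hY (by linarith) hθ0.le).trans (two_le R hR0)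
    rcases le_total R (2 * c' * D) with h5 | h5
    · have := mul_nonneg hlast hD0.le
      have := mul_pos hc'0 hD0
      linarith
    · have hRpos : 0 < R := lt_of_lt_of_le (by positivity) h5
      have h6 : R ≤ 8 * c' * (Q ^ (1 - θ) * R ^ θ) := by
        have := mul_le_mul_of_nonneg_left (mul_le_mul_of_nonneg_left h4 hQθ) hc'0.le
        have : 0 ≤ c' * (Q ^ (1 - θ) * R ^ θ) := by positivity
        linarith
      have h7 : R ^ (1 - θ) ≤ 8 * c' * Q ^ (1 - θ) := by
        rw [Real.rpow_sub hRpos, Real.rpow_one, div_le_iff₀ (by positivity)]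
        linarith
      have h8 := Real.rpow_le_rpow (by positivity) h7 (by
        have : 0 < 1 - θ := by linarith
        positivity : 0 ≤ 1 / (1 - θ))
      have hne : (1 - θ) * (1 / (1 - θ)) = 1 := mul_one_div_cancel (by linarith)
      rw [Real.mul_rpow (by positivity) (by positivity), ← Real.rpow_mul hRpos.le,
        ← Real.rpow_mul hQ.le, hne, Real.rpow_one, Real.rpow_one] at h8
      have := mul_le_mul_of_nonneg_left hQD hlast
      have := mul_pos hc'0 hD0
      linarith

/-- Jensen's inequality for a power with exponent in `[0, 1]`. -/
lemma integral_rpow_le {Ω : Type*} [MeasurableSpace Ω] {μ : Measure Ω} [IsProbabilityMeasure μ]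
    {f : Ω → ℝ} {θ : ℝ} (h0 : 0 ≤ θ) (h1 : θ ≤ 1) (hf : Integrable f μ) (hf0 : ∀ x, 0 ≤ f x) :
    Integrable (fun x => f x ^ θ) μ ∧ ∫ x, f x ^ θ ∂μ ≤ (∫ x, f x ∂μ) ^ θ := by
  have hi : Integrable (fun x => f x ^ θ) μ := by
    refine Integrable.mono' ((integrable_const (1 : ℝ)).add hf)
      (hf.aestronglyMeasurable.aemeasurable.pow_const θ).aestronglyMeasurable
      (Filter.Eventually.of_forall fun x => ?_)
    rw [Real.norm_of_nonneg (Real.rpow_nonneg (hf0 x) _)]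
    have h := hf0 x
    simp only [Pi.add_apply]
    rcases le_total (f x) 1 with hx | hx
    · linarith [Real.rpow_le_one h hx h0]
    · have := Real.rpow_le_rpow_of_exponent_le hx h1
      rw [Real.rpow_one] at this
      linarith
  exact ⟨hi, (Real.concaveOn_rpow h0 h1).le_map_integral
    (Real.continuous_rpow_const h0).continuousOn isClosed_Ici
    (Filter.Eventually.of_forall fun x => hf0 x) hf hi⟩

end RealBounds

/-! ### The adversarial regime. -/

namespace Params

variable {K d : ℕ} {P : Params K d} {c₁ c₂ : ℝ} {T : ℕ}

section Scales

variable (hP : P.Admissible c₁ c₂ T)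
include hP

lemma zScale_rpow : P.zScale ^ (1 / P.ε) =
    Real.log K ^ (1 - 1 / P.ε) * P.σ ^ (1 / P.ε) * (d : ℝ) ^ (1 / 2 : ℝ) := by
  have hl := log_K_pos hP
  have hσ := hP.σ_pos
  have hd := hP.d_pos
  have hε : 0 < P.ε := by linarith [hP.one_lt_ε]
  rw [zScale, Real.mul_rpow (by positivity) (by positivity), Real.mul_rpow hσ.le (by positivity),
    ← Real.rpow_mul hl.le, ← Real.rpow_mul (by linarith),
    show (P.ε - 1) * (1 / P.ε) = 1 - 1 / P.ε by field_simp,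
    show P.ε / 2 * (1 / P.ε) = 1 / 2 by field_simp]
  ring

lemma wScale_rpow : P.wScale ^ (1 / 3 : ℝ) =
    Real.log K ^ (2 / 3 : ℝ) * P.σ ^ (1 / P.ε) * (d : ℝ) ^ (1 / 3 : ℝ) := by
  have hl := log_K_pos hP
  have hσ := hP.σ_pos
  have hd := hP.d_pos
  have hε : 0 < P.ε := by linarith [hP.one_lt_ε]
  rw [wScale, Real.mul_rpow (by positivity) (by positivity), Real.mul_rpow (by positivity)
    (by positivity), ← Real.rpow_mul hσ.le, ← Real.rpow_natCast, ← Real.rpow_mul hl.le,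
    show 3 / P.ε * (1 / 3) = 1 / P.ε by field_simp,
    show ((2 : ℕ) : ℝ) * (1 / 3) = 2 / 3 by norm_num]
  ring

end Scales

section Regret

variable (hP : P.Admissible c₁ c₂ T) {π : Policy K} (hπ : P.Runs π T) {zmax wmax : ℝ}
include hP

lemma κ_nonneg (hT : 1 ≤ T) (hz : P.IsZMax T zmax) (hw : P.IsWMax T wmax) :
    0 ≤ P.κ zmax wmax := by
  have := zmax_nonneg hP hT hz
  have := wmax_nonneg hP hT hw
  have := h₁_pos hP
  have := hbar_nonneg hP
  have := hP.β₁_pos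
  have := hP.βbar_pos
  unfold κ
  positivity

include hπ

lemma regret_le (env : Environment P.φ P.ε P.σ) : regret env π T ≤
    P.β₁ * P.h₁ + P.βbar * P.hbar +
      1026 * ∫ ω, P.cumulative P.cost T (observe ω.2) ∂(trajLaw env π T) := by
  have := hP.neZero
  exact ciSup_le fun a => expected_regret_le hP env hπ a

/-- The adversarial regret bound. -/
lemma regret_le_adversarial (hc₁ : 0 < c₁) (hT : 1 ≤ T) (hz : P.IsZMax T zmax)
    (hw : P.IsWMax T wmax) (env : Environment P.φ P.ε P.σ) :
    regret env π T ≤ 8208 * Real.exp c₂ ^ 2 * max 1 (1 / c₁) ^ 2 *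
      (Real.log K ^ (1 - 1 / P.ε) * P.σ ^ (1 / P.ε) * (d : ℝ) ^ (1 / 2 : ℝ) *
        (T : ℝ) ^ (1 / P.ε) +
      Real.log K ^ (2 / 3 : ℝ) * P.σ ^ (1 / P.ε) * (d : ℝ) ^ (1 / 3 : ℝ) *
        (T : ℝ) ^ (1 / 3 : ℝ) + P.κ zmax wmax) := by
  have hE : 1 ≤ Real.exp c₂ := Real.one_le_exp (c₂_nonneg hP)
  have hk : 1 ≤ max 1 (1 / c₁) := le_max_left _ _
  have hε := hP.one_lt_ε
  have hε2 := hP.ε_le_two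
  have hZ := zScale_pos hP
  have hW := wScale_pos hP
  have hzm := zmax_le hP hc₁ hz
  have hwm := wmax_le hP hc₁ hw
  have hz0 := zmax_nonneg hP hT hz
  have hw0 := wmax_nonneg hP hT hw
  have hκ : P.κ zmax wmax = zmax * P.β₁ ^ (1 - P.ε) + wmax / P.β₁ ^ 2 +
      (P.β₁ * P.h₁ + P.βbar * P.hbar) := by unfold κ; ring
  have hκ1 : 0 ≤ P.β₁ * P.h₁ + P.βbar * P.hbar := by
    have := h₁_pos hP
    have := hbar_nonneg hP
    have := hP.β₁_pos
    have := hP.βbar_pos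
    positivity
  have hκ0 := κ_nonneg hP hT hz hw
  rw [← zScale_rpow hP, ← wScale_rpow hP, ← Real.mul_rpow hZ.le (Nat.cast_nonneg T),
    ← Real.mul_rpow hW.le (Nat.cast_nonneg T)]
  set E := Real.exp c₂
  set k := max 1 (1 / c₁)
  have hEk : 1 ≤ E * k := one_le_mul_of_one_le_of_one_le hE hk
  have h1 : ((2 * E) ^ (P.ε - 1) * (T * zmax)) ^ (1 / P.ε) ≤
      2 * E * k * (P.zScale * T) ^ (1 / P.ε) := by
    refine le_trans (Real.rpow_le_rpow (by positivity) ?_ (by positivity))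
      (mul_rpow_le_mul (by linarith) (by positivity) (by rw [div_le_one] <;> linarith))
    have h2 : (2 * E) ^ (P.ε - 1) ≤ 2 * E := by
      conv_rhs => rw [← Real.rpow_one (2 * E)]
      exact Real.rpow_le_rpow_of_exponent_le (by linarith) (by linarith)
    calc _ ≤ 2 * E * (T * (k * P.zScale)) := by gcongr
      _ = _ := by ring
  have h2 : ((2 * E) ^ (2 : ℝ) * (T * wmax)) ^ (1 / 3 : ℝ) ≤
      4 * (E * k) ^ 2 * (P.wScale * T) ^ (1 / 3 : ℝ) := by
    refine le_trans (Real.rpow_le_rpow (by positivity) ?_ (by positivity))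
      (mul_rpow_le_mul (by nlinarith) (by positivity) (by norm_num))
    rw [Real.rpow_two]
    calc _ ≤ (2 * E) ^ 2 * (T * (k ^ 2 * P.wScale)) := by gcongr
      _ = _ := by ring
  have h3 : ∫ ω, P.cumulative P.cost T (observe ω.2) ∂(trajLaw env π T) ≤
      (zmax * P.β₁ ^ (1 - P.ε) + wmax / P.β₁ ^ 2) +
      (2 * (2 * E * k * (P.zScale * T) ^ (1 / P.ε)) +
        2 * (4 * (E * k) ^ 2 * (P.wScale * T) ^ (1 / 3 : ℝ))) := by
    have h4 := integral_mono (integrable_cumulative (π := π) hP env le_rfl (continuousOn_cost hP))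
      (integrable_const _) fun ω => (cumulative_cost_le hP hT hz hw (observe ω.2)).1
    rw [integral_const, probReal_univ, one_smul] at h4
    linarith
  have h4 := regret_le hP hπ env
  have h5 : 0 ≤ (P.zScale * T) ^ (1 / P.ε) := by positivity
  have h6 : 0 ≤ (P.wScale * T) ^ (1 / 3 : ℝ) := by positivity
  have h7 : E * k ≤ (E * k) ^ 2 := by nlinarith
  have h8 := mul_le_mul_of_nonneg_right h7 h5
  have h9 := mul_le_mul_of_nonneg_right (by linarith : 1 ≤ (E * k) ^ 2) hκ0
  have h10 : 0 ≤ (E * k) ^ 2 * (P.zScale * T) ^ (1 / P.ε) := by positivity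
  -- The coefficients are `1026` from the potential argument times `4` and `8`.
  calc regret env π T ≤ 1026 * P.κ zmax wmax + 4104 * ((E * k) * (P.zScale * T) ^ (1 / P.ε)) +
        8208 * ((E * k) ^ 2 * (P.wScale * T) ^ (1 / 3 : ℝ)) := by rw [hκ]; linarith
    _ ≤ 8208 * ((E * k) ^ 2 * (P.zScale * T) ^ (1 / P.ε) +
        (E * k) ^ 2 * (P.wScale * T) ^ (1 / 3 : ℝ) + (E * k) ^ 2 * P.κ zmax wmax) := by linarith
    _ = _ := by ring

end Regret

end Params

/-- The number of levels is of order `I / X` while `V` carries `X^ρ`, so the powers of `X` cancel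
and a Hölder product of `Q` and `Y` remains. -/
lemma level_term_le {ρ J X I Q V Y : ℝ} (hρ : 0 < ρ) (hJ : 0 ≤ J) (hX : 0 < X) (hV0 : 0 ≤ V)
    (hJX : J * X ≤ 3 * I) (hI : 0 ≤ I) (hIQ : I ≤ Q) (hY : 0 ≤ Y) (hV : V ≤ X ^ ρ * Y) :
    J ^ (ρ / (1 + ρ)) * V ^ (1 / (1 + ρ)) ≤ 3 * (Q ^ (ρ / (1 + ρ)) * Y ^ (1 / (1 + ρ))) := by
  have h1 : V ^ (1 / (1 + ρ)) ≤ X ^ (ρ / (1 + ρ)) * Y ^ (1 / (1 + ρ)) := by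
    refine (Real.rpow_le_rpow hV0 hV (by positivity)).trans (le_of_eq ?_)
    rw [Real.mul_rpow (by positivity) hY, ← Real.rpow_mul hX.le, mul_one_div]
  have h2 : (J * X) ^ (ρ / (1 + ρ)) ≤ 3 * Q ^ (ρ / (1 + ρ)) := by
    refine (Real.rpow_le_rpow (by positivity) (hJX.trans
      (mul_le_mul_of_nonneg_left hIQ (by norm_num))) (by positivity)).trans ?_
    refine mul_rpow_le_mul (by norm_num) (hI.trans hIQ) ?_
    rw [div_le_one (by positivity)]; linarith
  calc _ ≤ J ^ (ρ / (1 + ρ)) * (X ^ (ρ / (1 + ρ)) * Y ^ (1 / (1 + ρ))) := by gcongr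
    _ = (J * X) ^ (ρ / (1 + ρ)) * Y ^ (1 / (1 + ρ)) := by rw [Real.mul_rpow hJ hX.le]; ring
    _ ≤ 3 * Q ^ (ρ / (1 + ρ)) * Y ^ (1 / (1 + ρ)) := by gcongr
    _ = _ := by ring

lemma integral_add_const_add_const {Ω : Type*} [MeasurableSpace Ω] {μ : Measure Ω}
    [IsProbabilityMeasure μ] {f g : Ω → ℝ} (hf : Integrable f μ) (hg : Integrable g μ)
    (a b c : ℝ) : ∫ x, (a + (f x + b) + (g x + c)) ∂μ = a + (∫ x, f x ∂μ + b) + (∫ x, g x ∂μ + c) := by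
  have h1 : Integrable (fun x => f x + b) μ := hf.add (integrable_const b)
  have h2 : Integrable (fun x => g x + c) μ := hg.add (integrable_const c)
  have h3 : Integrable (fun x => a + (f x + b)) μ := (integrable_const a).add h1
  rw [integral_add h3 h2, integral_add (integrable_const a) h1, integral_add hf (integrable_const b),
    integral_add hg (integrable_const c)]
  simp

/-! ### The self-bounding regime. -/

namespace Params

variable {K d : ℕ} {P : Params K d} {c₁ c₂ : ℝ} {T : ℕ}

section Iota

variable (hP : P.Admissible c₁ c₂ T) {g C : ℝ} (hg : 0 < g)
include hP hg

lemma zScale_div_rpow (s : ℝ) : (P.zScale / g) ^ (s / (P.ε - 1)) =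
    P.σ ^ (s / (P.ε - 1)) * (d : ℝ) ^ (P.ε * s / (2 * (P.ε - 1))) * Real.log K ^ s /
      g ^ (s / (P.ε - 1)) := by
  have hl := log_K_pos hP
  have hσ := hP.σ_pos
  have hd := hP.d_pos
  have hr : P.ε - 1 ≠ 0 := by linarith [hP.one_lt_ε]
  rw [Real.div_rpow (zScale_pos hP).le hg.le, zScale, Real.mul_rpow (by positivity) (by positivity),
    Real.mul_rpow hσ.le (by positivity), ← Real.rpow_mul hl.le, ← Real.rpow_mul (by linarith),
    show (P.ε - 1) * (s / (P.ε - 1)) = s by field_simp,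
    show P.ε / 2 * (s / (P.ε - 1)) = P.ε * s / (2 * (P.ε - 1)) by field_simp]
  ring

/-- With `X = (zScale / g)^{1/(ε-1)}`, the denominator inside the logarithm is `X^ε + C`, the form
required by `exists_level_count` for `ρ = ε - 1`. -/
lemma iota_eq : iota K d T P.ε P.σ g C = (2 / P.ε) ^ (1 / (P.ε - 1)) *
    ((P.zScale / g) ^ (1 / (P.ε - 1)) * (logPlus (P.zScale * T /
      (((P.zScale / g) ^ (1 / (P.ε - 1))) ^ (1 + (P.ε - 1)) + C)) / (P.ε - 1))) := by
  have hσ := hP.σ_pos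
  have hε : 0 < P.ε := by linarith [hP.one_lt_ε]
  have hZ := zScale_pos hP
  rw [← Real.rpow_mul (by positivity), show 1 / (P.ε - 1) * (1 + (P.ε - 1)) = P.ε / (P.ε - 1) by ring,
    zScale_div_rpow hP hg, zScale_div_rpow hP hg, Real.rpow_one, mul_one, ← pow_two, zScale, iota,
    mul_comm 2 P.σ, mul_div_assoc P.σ 2, Real.mul_rpow hσ.le (by positivity)]
  have e : P.σ * (d : ℝ) ^ (P.ε / 2) * T * Real.log K ^ (P.ε - 1) =
      P.σ * Real.log K ^ (P.ε - 1) * (d : ℝ) ^ (P.ε / 2) * T := by ring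
  rw [e]
  ring

lemma exists_level_iota (hC : 0 ≤ C) : ∃ J : ℕ,
    (J : ℝ) * (P.zScale / g) ^ (1 / (P.ε - 1)) ≤ 3 * iota K d T P.ε P.σ g C ∧
    (P.zScale / g) ^ (1 / (P.ε - 1)) ≤ iota K d T P.ε P.σ g C ∧
    ((1 / 2 ^ J) ^ (P.ε - 1) * (P.zScale * T)) ^ (1 / P.ε) ≤
      iota K d T P.ε P.σ g C + C ^ (1 / P.ε) := by
  have hε := hP.one_lt_ε
  have hε2 := hP.ε_le_two
  have hr : 0 < P.ε - 1 := by linarith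
  have hZ := zScale_pos hP
  obtain ⟨J, h1, h2⟩ := exists_level_count hr
    (by positivity : 0 < (P.zScale / g) ^ (1 / (P.ε - 1)))
    (by positivity : 0 ≤ P.zScale * T) hC
  rw [iota_eq hP hg]
  set X := (P.zScale / g) ^ (1 / (P.ε - 1))
  have hX : 0 < X := by positivity
  set L := logPlus (P.zScale * T / (X ^ (1 + (P.ε - 1)) + C))
  have hL : 1 ≤ L := one_le_logPlus _
  have h3 : X * (L / (P.ε - 1)) ≤ (2 / P.ε) ^ (1 / (P.ε - 1)) * (X * (L / (P.ε - 1))) := by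
    refine le_mul_of_one_le_left (by positivity) (Real.one_le_rpow ?_ (by positivity))
    rw [le_div_iff₀] <;> linarith
  have h4 : L ≤ L / (P.ε - 1) := by
    rw [le_div_iff₀ hr]
    exact mul_le_of_le_one_right (by linarith) (by linarith)
  have h5 : X ≤ X * (L / (P.ε - 1)) := le_mul_of_one_le_right hX.le (hL.trans h4)
  refine ⟨J, ?_, h5.trans h3, ?_⟩
  · calc (J : ℝ) * X ≤ (2 + (P.ε - 1)) / (P.ε - 1) * L * X := by gcongr
      _ = (2 + (P.ε - 1)) * (X * (L / (P.ε - 1))) := by ring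
      _ ≤ 3 * (X * (L / (P.ε - 1))) := by
        refine mul_le_mul_of_nonneg_right (by linarith) (by positivity)
      _ ≤ _ := mul_le_mul_of_nonneg_left h3 (by norm_num)
  · rw [add_sub_cancel] at h2
    linarith

/-- The square root of `w`-scale divided by the gap. -/
lemma wScale_eq : P.wScale = (P.σ ^ (3 / (2 * P.ε)) * (d : ℝ) ^ (1 / 2 : ℝ) * Real.log K / g) ^ 2 *
    g ^ 2 := by
  have hσ := hP.σ_pos
  have hε : 0 < P.ε := by linarith [hP.one_lt_ε]
  rw [div_pow, div_mul_cancel₀ _ (by positivity), mul_pow, mul_pow, ← Real.rpow_natCast (P.σ ^ _),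
    ← Real.rpow_mul hσ.le, ← Real.rpow_natCast ((d : ℝ) ^ _), ← Real.rpow_mul (by linarith [hP.d_pos]),
    show 3 / (2 * P.ε) * ((2 : ℕ) : ℝ) = 3 / P.ε by push_cast; field_simp,
    show (1 / 2 : ℝ) * ((2 : ℕ) : ℝ) = 1 by norm_num, Real.rpow_one, wScale]

lemma exists_level_iota' (hC : 0 ≤ C) : ∃ J : ℕ,
    (J : ℝ) * (P.σ ^ (3 / (2 * P.ε)) * (d : ℝ) ^ (1 / 2 : ℝ) * Real.log K / g) ≤
      3 * iota' K d T P.ε P.σ g C ∧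
    0 ≤ iota' K d T P.ε P.σ g C ∧
    ((1 / 2 ^ J) ^ (2 : ℝ) * (P.wScale * T)) ^ (1 / 3 : ℝ) ≤
      2 * iota' K d T P.ε P.σ g C + C ^ (1 / 3 : ℝ) := by
  have hl := log_K_pos hP
  have hσ := hP.σ_pos
  have hd := hP.d_pos
  have hW := wScale_pos hP
  have hX : 0 < P.σ ^ (3 / (2 * P.ε)) * (d : ℝ) ^ (1 / 2 : ℝ) * Real.log K / g := by positivity
  obtain ⟨J, h1, h2⟩ := exists_level_count two_pos hX (by positivity : 0 ≤ P.wScale * T) hC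
  have hι : iota' K d T P.ε P.σ g C = (3 / 2 : ℝ) ^ (-(1 / 2) : ℝ) *
      ((P.σ ^ (3 / (2 * P.ε)) * (d : ℝ) ^ (1 / 2 : ℝ) * Real.log K / g) *
      logPlus (P.wScale * T /
        ((P.σ ^ (3 / (2 * P.ε)) * (d : ℝ) ^ (1 / 2 : ℝ) * Real.log K / g) ^ (1 + 2 : ℝ) + C))) := by
    have e : P.σ ^ (3 / P.ε) * d * T * Real.log K ^ 2 = P.σ ^ (3 / P.ε) * d * Real.log K ^ 2 * T := by
      ring
    rw [show (1 + 2 : ℝ) = ((3 : ℕ) : ℝ) by norm_num, Real.rpow_natCast, iota', e, wScale]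
    ring
  rw [hι]
  set X := P.σ ^ (3 / (2 * P.ε)) * (d : ℝ) ^ (1 / 2 : ℝ) * Real.log K / g
  set L := logPlus (P.wScale * T / (X ^ (1 + 2 : ℝ) + C))
  have hL : 1 ≤ L := one_le_logPlus _
  -- For `ρ = 2` the level count is at most `2 L`, and `2 X L = 3 · (2/3) X L`; so it suffices that
  -- the prefactor of `ι'` is at least `2/3`.
  have h3 : (2 / 3 : ℝ) ≤ (3 / 2 : ℝ) ^ (-(1 / 2) : ℝ) := by
    rw [show (2 / 3 : ℝ) = (3 / 2 : ℝ) ^ (-1 : ℝ) by rw [Real.rpow_neg_one]; norm_num]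
    exact Real.rpow_le_rpow_of_exponent_le (by norm_num) (by norm_num)
  have h4 := mul_le_mul_of_nonneg_right h3 (by positivity : 0 ≤ X * L)
  have h5 : X ≤ X * L := le_mul_of_one_le_right hX.le hL
  refine ⟨J, ?_, by positivity, ?_⟩
  · have := mul_le_mul_of_nonneg_right h1 hX.le
    linarith
  · rw [show (1 + 2 : ℝ) = 3 by norm_num] at h2
    linarith

end Iota

section SelfBounding

variable (hP : P.Admissible c₁ c₂ T) {π : Policy K} (hπ : P.Runs π T) {zmax wmax : ℝ}
include hP

lemma cumulative_one_sub_p_nonneg (a : Fin K) (o : Obs K T) :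
    0 ≤ P.cumulative (fun S => 1 - P.p S a) T o := by
  obtain ⟨S, -, -, hstate, hcum⟩ := exists_path hP o
  rw [hcum]
  refine Finset.sum_nonneg fun t ht => ?_
  have ht := Finset.mem_range.mp ht
  obtain ⟨o', h⟩ := hstate t
  rw [h]
  exact (one_sub_p_mem hP (state_pos hP ht.le o') (hP.γ_le_half t ht o') a).1

include hπ

/-- The regret in terms of the expected number of pulls of arms other than `a`. -/
lemma regret_le_levels (hc₁ : 0 < c₁) (hT : 1 ≤ T) (hz : P.IsZMax T zmax) (hw : P.IsWMax T wmax)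
    (env : Environment P.φ P.ε P.σ) (a : Fin K) (J₁ J₂ : ℕ) {U : ℝ}
    (hU : U = ∫ ω, P.cumulative (fun S => 1 - P.p S a) T (observe ω.2) ∂(trajLaw env π T)) :
    regret env π T ≤ 525312 * Real.exp c₂ ^ 2 * max 1 (1 / c₁) ^ 2 * (P.κ zmax wmax +
      ((J₁ : ℝ) ^ ((P.ε - 1) / P.ε) * (P.zScale * U) ^ (1 / P.ε) +
        ((1 / 2 ^ J₁) ^ (P.ε - 1) * (P.zScale * T)) ^ (1 / P.ε)) +
      ((J₂ : ℝ) ^ (2 / 3 : ℝ) * (P.wScale * U) ^ (1 / 3 : ℝ) +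
        ((1 / 2 ^ J₂) ^ (2 : ℝ) * (P.wScale * T)) ^ (1 / 3 : ℝ))) := by
  have hE : 1 ≤ Real.exp c₂ := Real.one_le_exp (c₂_nonneg hP)
  have hk : 1 ≤ max 1 (1 / c₁) := le_max_left _ _
  have hε := hP.one_lt_ε
  have hε2 := hP.ε_le_two
  have hεi : 1 / P.ε ≤ 1 := by rw [div_le_one] <;> linarith
  have hZ := zScale_pos hP
  have hW := wScale_pos hP
  have hzm := zmax_le hP hc₁ hz
  have hwm := wmax_le hP hc₁ hw
  have hz0 := zmax_nonneg hP hT hz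
  have hw0 := wmax_nonneg hP hT hw
  have hκ0 := κ_nonneg hP hT hz hw
  have hκ1 : 0 ≤ P.β₁ * P.h₁ + P.βbar * P.hbar := by
    have := h₁_pos hP
    have := hbar_nonneg hP
    have := hP.β₁_pos
    have := hP.βbar_pos
    positivity
  have hκ : P.κ zmax wmax = zmax * P.β₁ ^ (1 - P.ε) + wmax / P.β₁ ^ 2 +
      (P.β₁ * P.h₁ + P.βbar * P.hbar) := by unfold κ; ring
  have hUint := integrable_cumulative (π := π) hP env le_rfl
    (f := fun S => 1 - P.p S a) (continuousOn_const.sub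
      ((continuous_apply a).comp_continuousOn (continuousOn_p hP)))
  have hpath := fun ω : env.Seed × (Fin T → Round K) =>
    (cumulative_cost_le hP hT hz hw (observe ω.2)).2 hc₁ a J₁ J₂
  have hU0 : 0 ≤ U := hU ▸ integral_nonneg fun ω => cumulative_one_sub_p_nonneg hP a _
  set E := Real.exp c₂
  set k := max 1 (1 / c₁)
  have hEk : 1 ≤ E * k := one_le_mul_of_one_le_of_one_le hE hk
  have hEk2 : E * k ≤ (E * k) ^ 2 := by nlinarith
  -- Concavity moves the expectation inside the power, and a constant `A ≥ 1` leaves a power with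
  -- exponent at most one at the cost of `A` itself.
  have jensen : ∀ (A θ : ℝ), 1 ≤ A → 0 ≤ θ → θ ≤ 1 → ∀ V, 0 < V →
      Integrable (fun ω => (A * V * P.cumulative (fun S => 1 - P.p S a) T (observe ω.2)) ^ θ)
        (trajLaw env π T) ∧
      ∫ ω, (A * V * P.cumulative (fun S => 1 - P.p S a) T (observe ω.2)) ^ θ ∂(trajLaw env π T) ≤
        A * (V * U) ^ θ := fun A θ hA h0 h1 V hV => by
    obtain ⟨hi, hle⟩ := integral_rpow_le h0 h1 (hUint.const_mul (A * V)) fun ω =>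
      mul_nonneg (by positivity) (cumulative_one_sub_p_nonneg hP a _)
    refine ⟨hi, hle.trans ?_⟩
    rw [integral_const_mul, ← hU, mul_assoc]
    exact mul_rpow_le_mul hA (by positivity) h1
  obtain ⟨i1, j1⟩ := jensen (16 * E * k) (1 / P.ε) (by linarith) (by positivity) hεi _ hZ
  obtain ⟨i2, j2⟩ := jensen (128 * E ^ 2 * k ^ 2) (1 / 3) (by nlinarith) (by norm_num)
    (by norm_num) _ hW
  have t1 : ((2 * E / 2 ^ J₁) ^ (P.ε - 1) * (T * zmax)) ^ (1 / P.ε) ≤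
      2 * E * k * ((1 / 2 ^ J₁) ^ (P.ε - 1) * (P.zScale * T)) ^ (1 / P.ε) := by
    refine le_trans (Real.rpow_le_rpow (by positivity) ?_ (by positivity))
      (mul_rpow_le_mul (by linarith) (by positivity) hεi)
    have h2 : (2 * E) ^ (P.ε - 1) ≤ 2 * E := by
      conv_rhs => rw [← Real.rpow_one (2 * E)]
      exact Real.rpow_le_rpow_of_exponent_le (by linarith) (by linarith)
    rw [div_eq_mul_one_div (2 * E), Real.mul_rpow (by positivity) (by positivity)]
    calc _ ≤ 2 * E * (1 / 2 ^ J₁) ^ (P.ε - 1) * (T * (k * P.zScale)) := by gcongr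
      _ = _ := by ring
  have t2 : ((2 * E / 2 ^ J₂) ^ (2 : ℝ) * (T * wmax)) ^ (1 / 3 : ℝ) ≤
      4 * (E * k) ^ 2 * ((1 / 2 ^ J₂) ^ (2 : ℝ) * (P.wScale * T)) ^ (1 / 3 : ℝ) := by
    refine le_trans (Real.rpow_le_rpow (by positivity) ?_ (by positivity))
      (mul_rpow_le_mul (by nlinarith) (by positivity) (by norm_num))
    simp only [Real.rpow_two]
    calc _ ≤ (2 * E / 2 ^ J₂) ^ 2 * (T * (k ^ 2 * P.wScale)) := by gcongr
      _ = _ := by ring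
  have hint : ∫ ω, P.cumulative P.cost T (observe ω.2) ∂(trajLaw env π T) ≤
      (zmax * P.β₁ ^ (1 - P.ε) + wmax / P.β₁ ^ 2) +
      (4 * ((J₁ : ℝ) ^ ((P.ε - 1) / P.ε) * (16 * E * k * (P.zScale * U) ^ (1 / P.ε))) +
        2 * ((2 * E / 2 ^ J₁) ^ (P.ε - 1) * (T * zmax)) ^ (1 / P.ε)) +
      (4 * ((J₂ : ℝ) ^ (2 / 3 : ℝ) * (128 * E ^ 2 * k ^ 2 * (P.wScale * U) ^ (1 / 3 : ℝ))) +
        2 * ((2 * E / 2 ^ J₂) ^ (2 : ℝ) * (T * wmax)) ^ (1 / 3 : ℝ)) := by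
    have i1' := (i1.const_mul ((J₁ : ℝ) ^ ((P.ε - 1) / P.ε))).const_mul 4
    have i2' := (i2.const_mul ((J₂ : ℝ) ^ (2 / 3 : ℝ))).const_mul 4
    have h4 := integral_mono (integrable_cumulative (π := π) hP env le_rfl (continuousOn_cost hP))
      (((integrable_const _).add (i1'.add (integrable_const _))).add
        (i2'.add (integrable_const _))) hpath
    refine h4.trans ?_
    refine (integral_add_const_add_const i1' i2' _ _ _).trans_le ?_
    rw [integral_const_mul, integral_const_mul, integral_const_mul, integral_const_mul]
    have := mul_le_mul_of_nonneg_left j1 (by positivity : 0 ≤ (J₁ : ℝ) ^ ((P.ε - 1) / P.ε))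
    have := mul_le_mul_of_nonneg_left j2 (by positivity : 0 ≤ (J₂ : ℝ) ^ (2 / 3 : ℝ))
    linarith
  have h4 := regret_le hP hπ env
  have p1 : 0 ≤ (J₁ : ℝ) ^ ((P.ε - 1) / P.ε) * (P.zScale * U) ^ (1 / P.ε) := by positivity
  have p2 : 0 ≤ ((1 / 2 ^ J₁) ^ (P.ε - 1) * (P.zScale * T)) ^ (1 / P.ε) := by positivity
  have p3 : 0 ≤ (J₂ : ℝ) ^ (2 / 3 : ℝ) * (P.wScale * U) ^ (1 / 3 : ℝ) := by positivity
  have p4 : 0 ≤ ((1 / 2 ^ J₂) ^ (2 : ℝ) * (P.wScale * T)) ^ (1 / 3 : ℝ) := by positivity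
  generalize (J₁ : ℝ) ^ ((P.ε - 1) / P.ε) = a₁ at *
  generalize (J₂ : ℝ) ^ (2 / 3 : ℝ) = a₂ at *
  generalize (P.zScale * U) ^ (1 / P.ε) = b₁ at *
  generalize (P.wScale * U) ^ (1 / 3 : ℝ) = b₂ at *
  generalize ((1 / 2 ^ J₁) ^ (P.ε - 1) * (P.zScale * T)) ^ (1 / P.ε) = d₁ at *
  generalize ((1 / 2 ^ J₂) ^ (2 : ℝ) * (P.wScale * T)) ^ (1 / 3 : ℝ) = d₂ at *
  have q1 := mul_le_mul_of_nonneg_right hEk2 p1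
  have q2 := mul_le_mul_of_nonneg_right hEk2 p2
  have q3 := mul_le_mul_of_nonneg_right (hEk.trans hEk2) hκ0
  have q4 : 0 ≤ (E * k) ^ 2 * (a₁ * b₁) := by positivity
  have q5 : 0 ≤ (E * k) ^ 2 * d₁ := by positivity
  have q6 : 0 ≤ (E * k) ^ 2 * d₂ := by positivity
  -- The largest coefficient is `525312 = 1026 · 4 · 128`, from the levels of the exploration term.
  calc regret env π T ≤ 1026 * P.κ zmax wmax + 65664 * ((E * k) * (a₁ * b₁)) +
        4104 * ((E * k) * d₁) + 525312 * ((E * k) ^ 2 * (a₂ * b₂)) +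
        8208 * ((E * k) ^ 2 * d₂) := by rw [hκ]; linarith
    _ ≤ 525312 * ((E * k) ^ 2 * P.κ zmax wmax + ((E * k) ^ 2 * (a₁ * b₁) + (E * k) ^ 2 * d₁) +
        ((E * k) ^ 2 * (a₂ * b₂) + (E * k) ^ 2 * d₂)) := by linarith
    _ = _ := by ring

end SelfBounding

/-- The regret bound in the self-bounding regime. -/
theorem exists_regret_le_selfBounding (hc₁ : 0 < c₁) {ε σ₀ : ℝ} (hε : 1 < ε) (hε2 : ε ≤ 2)
    (hσ₀ : 0 < σ₀) : ∃ M : ℝ, 0 < M ∧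
      ∀ (K d T : ℕ) (P : Params K d) (π : Policy K) (zmax wmax : ℝ),
        1 ≤ T → P.ε = ε → σ₀ ≤ P.σ →
        P.Admissible c₁ c₂ T → P.Runs π T → P.IsZMax T zmax → P.IsWMax T wmax →
        ∀ (Δ : Fin K → ℝ) (aStar : Fin K) (C : ℝ), 0 ≤ C → 0 ≤ Δ aStar →
          (∀ a, a ≠ aStar → 0 < Δ a) → minGap Δ aStar ≤ 1 →
          ∀ env : Environment P.φ P.ε P.σ, SelfBounding env Δ C T →
            regret env π T ≤ M * (iota K d T ε P.σ (minGap Δ aStar) C +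
              iota' K d T ε P.σ (minGap Δ aStar) C +
              C ^ (1 / ε) * (iota K d T ε P.σ (minGap Δ aStar) C +
                iota' K d T ε P.σ (minGap Δ aStar) C) ^ (1 - 1 / ε) + P.κ zmax wmax) := by
  have hr : 0 < ε - 1 := by linarith
  have hθ : 1 / 2 ≤ 1 / ε := one_div_le_one_div_of_le (by linarith) hε2
  have hθ1 : 1 / ε < 1 := by rw [div_lt_one] <;> linarith
  set G := 525312 * Real.exp c₂ ^ 2 * max 1 (1 / c₁) ^ 2 with hG
  have hGpos : 0 < G := by
    have : 0 < max 1 (1 / c₁) := lt_max_of_lt_left one_pos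
    positivity
  have hlog2 : 0 < Real.log 2 := Real.log_pos (by norm_num)
  -- The factor `3` comes from `level_term_le`; the second constant is a lower bound for `ι + ι'`,
  -- which brings in `σ₀`.
  obtain ⟨M, hM, hbound⟩ := exists_bound_of_selfBounding hθ hθ1
    (by positivity : 0 < 3 * G) (by positivity : 0 < σ₀ ^ (1 / (ε - 1)) * Real.log 2)
  refine ⟨M, hM, ?_⟩
  intro K d T P π zmax wmax hT hPε hσ hP hπ hz hw Δ aStar C hC hΔ0 hΔ hm1 env hSB
  subst hPε
  have hg := minGap_pos hP.two_le_K hΔ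
  set g := minGap Δ aStar
  obtain ⟨J₁, hJ₁, hXι, htail₁⟩ := exists_level_iota hP hg hC
  obtain ⟨J₂, hJ₂, hι', htail₂⟩ := exists_level_iota' hP hg hC
  set ι := iota K d T P.ε P.σ g C
  set ι' := iota' K d T P.ε P.σ g C
  have hZ := zScale_pos hP
  have hW := wScale_pos hP
  have hl := log_K_pos hP
  have hσ0 := hP.σ_pos
  have hd := hP.d_pos
  have hX : 0 < (P.zScale / g) ^ (1 / (P.ε - 1)) := by positivity
  have hX' : 0 < P.σ ^ (3 / (2 * P.ε)) * (d : ℝ) ^ (1 / 2 : ℝ) * Real.log K / g := by positivity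
  have hι : 0 ≤ ι := hX.le.trans hXι
  have hκ0 := κ_nonneg hP hT hz hw
  obtain ⟨U, hU⟩ : ∃ U, U = ∫ ω, P.cumulative (fun S => 1 - P.p S aStar) T (observe ω.2)
      ∂(trajLaw env π T) := ⟨_, rfl⟩
  have hU0 : 0 ≤ U := hU ▸ integral_nonneg fun ω => cumulative_one_sub_p_nonneg hP aStar _
  have hgap := expected_gap_ge hP env hπ Δ aStar hΔ0 (g := g) fun a ha => minGap_le ha
  rw [← hU] at hgap
  -- The self-bounding constraint, applied to the algorithm itself, bounds the expected mass off
  -- `aStar` by the regret.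
  have hY : g * U ≤ regret env π T + C := by linarith [hSB π]
  have hgU : 0 ≤ g * U := by positivity
  have hreg := regret_le_levels hP hπ hc₁ hT hz hw env aStar J₁ J₂ hU
  refine hbound (regret env π T) C (ι + ι') _ hC ?_ hκ0 (hgU.trans hY) ?_
  -- The lower bound on `ι` uses `K ≥ 2`, `d ≥ 1`, a smallest gap of at most one and `σ ≥ σ₀`.
  · refine le_trans ?_ (hXι.trans (le_add_of_nonneg_right hι'))
    rw [zScale_div_rpow hP hg, Real.rpow_one]
    have h1 : Real.log 2 ≤ Real.log K :=
      Real.log_le_log (by norm_num) (by exact_mod_cast hP.two_le_K)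
    have h2 : σ₀ ^ (1 / (P.ε - 1)) ≤ P.σ ^ (1 / (P.ε - 1)) :=
      Real.rpow_le_rpow hσ₀.le hσ (by positivity)
    have h3 : 1 ≤ (d : ℝ) ^ (P.ε * 1 / (2 * (P.ε - 1))) := Real.one_le_rpow hd (by positivity)
    have h4 : g ^ (1 / (P.ε - 1)) ≤ 1 := Real.rpow_le_one hg.le hm1 (by positivity)
    rw [le_div_iff₀ (by positivity)]
    calc _ ≤ σ₀ ^ (1 / (P.ε - 1)) * Real.log 2 * 1 := by gcongr
      _ = σ₀ ^ (1 / (P.ε - 1)) * 1 * Real.log 2 := by ring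
      _ ≤ _ := by gcongr
  · have e : 1 - 1 / P.ε = (P.ε - 1) / P.ε := by
      have : P.ε ≠ 0 := by linarith
      field_simp
    have h1 := level_term_le hr (Nat.cast_nonneg J₁) hX (by positivity : 0 ≤ P.zScale * U) hJ₁ hι
      (le_add_of_nonneg_right hι') (hgU.trans hY) (by
        rw [← Real.rpow_mul (by positivity), one_div_mul_cancel hr.ne', Real.rpow_one]
        calc P.zScale * U = P.zScale / g * (g * U) := by field_simp
          _ ≤ _ := by gcongr)
    have h2 := level_term_le two_pos (Nat.cast_nonneg J₂) hX' (by positivity : 0 ≤ P.wScale * U) hJ₂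
      hι' (le_add_of_nonneg_left hι) (hgU.trans hY) (by
        rw [Real.rpow_two]
        -- The exploration scale carries two powers of the gap but only one is available from the
        -- constraint; the other is at most one.
        have h3 : g * (g * U) ≤ regret env π T + C :=
          (mul_le_of_le_one_left hgU hm1).trans hY
        calc P.wScale * U = (P.σ ^ (3 / (2 * P.ε)) * (d : ℝ) ^ (1 / 2 : ℝ) * Real.log K / g) ^ 2 *
              (g * (g * U)) := by rw [wScale_eq hP hg]; ring
          _ ≤ _ := by gcongr)
    rw [add_sub_cancel] at h1
    rw [show (1 + 2 : ℝ) = 3 by norm_num] at h2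
    rw [e]
    refine hreg.trans ?_
    rw [mul_comm 3 G, mul_assoc G]
    refine mul_le_mul_of_nonneg_left ?_ hGpos.le
    have p1 := Real.rpow_nonneg hC (1 / P.ε)
    have p2 := Real.rpow_nonneg hC (1 / 3)
    linarith

end Params

end HTBandit

theorem corollary1 (c₁ c₂ : ℝ) (hc₁ : 0 < c₁) (hc₂ : c₁ ≤ c₂) :
    -- one constant, depending on `c₁` and `c₂` only
    (∃ M : ℝ, 0 < M ∧
      ∀ (K d T : ℕ) (P : HTBandit.Params K d) (π : HTBandit.Policy K) (zmax wmax : ℝ),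
        1 ≤ T → P.Admissible c₁ c₂ T → P.Runs π T → P.IsZMax T zmax → P.IsWMax T wmax →
        P.h₁ * zmax ≤ M * (P.σ * Real.log K ^ (P.ε - 1) * (d : ℝ) ^ (P.ε / 2)) ∧
        P.h₁ * wmax ≤ M * (P.σ ^ (3 / P.ε) * d * Real.log K ^ 2) ∧
        P.h₁ ^ (1 - 1 / P.ε) * zmax ^ (1 / P.ε) ≤
          M * (Real.log K ^ (1 - 1 / P.ε) * P.σ ^ (1 / P.ε) * (d : ℝ) ^ (1 / 2 : ℝ)) ∧
        P.h₁ ^ (2 / 3 : ℝ) * wmax ^ (1 / 3 : ℝ) ≤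
          M * (Real.log K ^ (2 / 3 : ℝ) * P.σ ^ (1 / P.ε) * (d : ℝ) ^ (1 / 3 : ℝ)) ∧
        (∀ (Δ : Fin K → ℝ) (aStar : Fin K), (∀ a, a ≠ aStar → 0 < Δ a) →
          P.ζ Δ aStar ≤ M * (Real.log K ^ (P.ε - 1) * P.σ * (d : ℝ) ^ (P.ε / 2) /
            HTBandit.Params.minGap Δ aStar)) ∧
        (∀ (Δ : Fin K → ℝ) (aStar : Fin K), (∀ a, a ≠ aStar → 0 < Δ a) →
          HTBandit.Params.minGap Δ aStar ≤ 1 →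
          P.ω Δ aStar ≤ M * (P.σ ^ (3 / P.ε) * d *
            (Real.log K / HTBandit.Params.minGap Δ aStar) ^ 2)) ∧
        -- the adversarial regime
        (∀ env : HTBandit.Environment P.φ P.ε P.σ,
          HTBandit.regret env π T ≤
            M * (Real.log K ^ (1 - 1 / P.ε) * P.σ ^ (1 / P.ε) * (d : ℝ) ^ (1 / 2 : ℝ) *
                (T : ℝ) ^ (1 / P.ε) +
              Real.log K ^ (2 / 3 : ℝ) * P.σ ^ (1 / P.ε) * (d : ℝ) ^ (1 / 3 : ℝ) *
                (T : ℝ) ^ (1 / 3 : ℝ) +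
              P.κ zmax wmax))) ∧
    -- the self-bounding regime; the constant depends on `c₁`, `c₂`, `ε` and a lower bound on `σ`
    (∀ ε σ₀ : ℝ, 1 < ε → ε ≤ 2 → 0 < σ₀ → ∃ M : ℝ, 0 < M ∧
      ∀ (K d T : ℕ) (P : HTBandit.Params K d) (π : HTBandit.Policy K) (zmax wmax : ℝ),
        1 ≤ T → P.ε = ε → σ₀ ≤ P.σ →
        P.Admissible c₁ c₂ T → P.Runs π T → P.IsZMax T zmax → P.IsWMax T wmax →
        ∀ (Δ : Fin K → ℝ) (aStar : Fin K) (C : ℝ), 0 ≤ C → 0 ≤ Δ aStar →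
          (∀ a, a ≠ aStar → 0 < Δ a) → HTBandit.Params.minGap Δ aStar ≤ 1 →
          ∀ env : HTBandit.Environment P.φ P.ε P.σ, HTBandit.SelfBounding env Δ C T →
            HTBandit.regret env π T ≤
              M * (HTBandit.iota K d T ε P.σ (HTBandit.Params.minGap Δ aStar) C +
                HTBandit.iota' K d T ε P.σ (HTBandit.Params.minGap Δ aStar) C +
                C ^ (1 / ε) *
                  (HTBandit.iota K d T ε P.σ (HTBandit.Params.minGap Δ aStar) C +
                    HTBandit.iota' K d T ε P.σ (HTBandit.Params.minGap Δ aStar) C) ^ (1 - 1 / ε) +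
                P.κ zmax wmax)) := by
  have hc₂0 : 0 ≤ c₂ := hc₁.le.trans hc₂
  have hE : 1 ≤ Real.exp c₂ := Real.one_le_exp hc₂0
  have hk : 1 ≤ max 1 (1 / c₁) := le_max_left _ _
  -- The adversarial constant is the largest of those needed in the first part and serves for all of
  -- them.
  refine ⟨⟨8208 * Real.exp c₂ ^ 2 * max 1 (1 / c₁) ^ 2, by positivity, ?_⟩,
    fun ε σ₀ hε hε2 hσ₀ => HTBandit.Params.exists_regret_le_selfBounding hc₁ hε hε2 hσ₀⟩
  intro K d T P π zmax wmax hT hP hπ hz hw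
  have hε := hP.one_lt_ε
  have hεi : 1 / P.ε ≤ 1 := by rw [div_le_one] <;> linarith
  have hεi0 : 0 ≤ 1 / P.ε := by positivity
  have hZ := HTBandit.Params.zScale_pos hP
  have hW := HTBandit.Params.wScale_pos hP
  have hl := HTBandit.Params.log_K_pos hP
  have hσ := hP.σ_pos
  have hz0 := HTBandit.Params.zmax_nonneg hP hT hz
  have hw0 := HTBandit.Params.wmax_nonneg hP hT hw
  have hzm := HTBandit.Params.zmax_le hP hc₁ hz
  have hwm := HTBandit.Params.wmax_le hP hc₁ hw
  have hh0 := HTBandit.Params.h₁_pos hP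
  have hh := HTBandit.Params.h₁_le hP
  have hadv := HTBandit.Params.regret_le_adversarial hP hπ hc₁ hT hz hw
  have hζ := fun Δ aStar hΔ => HTBandit.Params.ζ_le (Δ := Δ) (aStar := aStar) hP hΔ hc₁
  have hω := fun Δ aStar hΔ => HTBandit.Params.ω_le (Δ := Δ) (aStar := aStar) hP hΔ hc₁
  set E := Real.exp c₂
  set k := max 1 (1 / c₁)
  have hEk : 1 ≤ E * k := one_le_mul_of_one_le_of_one_le hE hk
  have hEk2 : E * k ≤ E ^ 2 * k ^ 2 := by nlinarith
  have hEk3 : E * k ^ 2 ≤ E ^ 2 * k ^ 2 := by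
    refine mul_le_mul_of_nonneg_right ?_ (by positivity)
    nlinarith
  have hpow : ∀ θ : ℝ, θ ≤ 1 → 0 ≤ θ → P.h₁ ^ θ ≤ 2 * E := fun θ h1 h0 => by
    refine (Real.rpow_le_rpow hh0.le hh h0).trans ?_
    conv_rhs => rw [← Real.rpow_one (2 * E)]
    exact Real.rpow_le_rpow_of_exponent_le (by linarith) h1
  refine ⟨?_, ?_, ?_, ?_, ?_, ?_, hadv⟩
  · change _ ≤ _ * P.zScale
    calc P.h₁ * zmax ≤ 2 * E * (k * P.zScale) := by gcongr
      _ = 2 * (E * k) * P.zScale := by ring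
      _ ≤ _ := mul_le_mul_of_nonneg_right (by linarith) hZ.le
  · change _ ≤ _ * P.wScale
    calc P.h₁ * wmax ≤ 2 * E * (k ^ 2 * P.wScale) := by gcongr
      _ = 2 * (E * k ^ 2) * P.wScale := by ring
      _ ≤ _ := mul_le_mul_of_nonneg_right (by linarith) hW.le
  · rw [← HTBandit.Params.zScale_rpow hP]
    calc P.h₁ ^ (1 - 1 / P.ε) * zmax ^ (1 / P.ε) ≤ 2 * E * (k * P.zScale ^ (1 / P.ε)) :=
          mul_le_mul (hpow _ (by linarith) (by linarith)) ((Real.rpow_le_rpow hz0 hzm hεi0).trans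
            (HTBandit.mul_rpow_le_mul hk hZ.le hεi)) (by positivity) (by positivity)
      _ = 2 * (E * k) * P.zScale ^ (1 / P.ε) := by ring
      _ ≤ _ := mul_le_mul_of_nonneg_right (by linarith) (by positivity)
  · rw [← HTBandit.Params.wScale_rpow hP]
    calc P.h₁ ^ (2 / 3 : ℝ) * wmax ^ (1 / 3 : ℝ) ≤ 2 * E * (k ^ 2 * P.wScale ^ (1 / 3 : ℝ)) :=
          mul_le_mul (hpow _ (by norm_num) (by norm_num))
            ((Real.rpow_le_rpow hw0 hwm (by norm_num)).trans
            (HTBandit.mul_rpow_le_mul (one_le_pow₀ hk) hW.le (by norm_num))) (by positivity)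
            (by positivity)
      _ = 2 * (E * k ^ 2) * P.wScale ^ (1 / 3 : ℝ) := by ring
      _ ≤ _ := mul_le_mul_of_nonneg_right (by linarith) (by positivity)
  · intro Δ aStar hΔ
    have hg := HTBandit.Params.minGap_pos hP.two_le_K hΔ
    refine (hζ Δ aStar hΔ).trans (mul_le_mul_of_nonneg_right (by linarith) (by positivity))
  · intro Δ aStar hΔ hm
    have hg := HTBandit.Params.minGap_pos hP.two_le_K hΔ
    refine (hω Δ aStar hΔ hm).trans (mul_le_mul_of_nonneg_right (by nlinarith) (by positivity))
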